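/- Let $k$ be a commutative ring and let $H$ be a faithfully projective Hopf algebra over $k$ (i.e. finitely generated and projective as a $k$-module; the condition $\sum_j m_j^*(m_j)=1$ for suitable $m_j\in H$, $m_j^*\in H^*$ is then automatic) with bijective antipode $S$. Let $H^*=\mathrm{Hom}_k(H,k)$ be the dual Hopf algebra, with convolution product $(\xi\eta)(h)=\sum\xi(h_{(1)})\eta(h_{(2)})$ and coproduct given by $\sum\xi_{(1)}(a)\xi_{(2)}(b)=\xi(ab)$. Definitions. A Yetter–Drinfel'd $H$-module is a $k$-module $M$ with a left $H$-action $\cdot$ and a right $H$-coaction $\chi(m)=\sum m_{(0)}\otimes m_{(1)}\in M\otimes H$ such that $\sum h_{(1)}\cdot m_{(0)}\otimes h_{(2)}m_{(1)}=\sum (h_{(2)}\cdot m)_{(0)}\otimes (h_{(2)}\cdot m)_{(1)}h_{(1)}$. With the linear and colinear maps as morphisms, with $h\cdot(m\otimes n)=\sum h_{(1)}\cdot m\otimes h_{(2)}\cdot n$, $\chi(m\otimes n)=\sum m_{(0)}\otimes n_{(0)}\otimes n_{(1)}m_{(1)}$ and with the braiding $\phi_{MN}(m\otimes n)=\sum n_{(0)}\otimes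 n_{(1)}\cdot m$ they form a braided monoidal category $\mathcal{YD}(H)$. Algebras in it are called Yetter–Drinfel'd $H$-module algebras; for two of them $A\# B$ is $A\otimes B$ with product $(a\# c)(b\# d)=\sum ab_{(0)}\#(b_{(1)}\cdot c)d$. For a finitely generated projective $M\in\mathcal{YD}(H)$, $\mathrm{End}(M)$ is such an algebra via $(h\cdot f)(m)=\sum h_{(1)}\cdot f(S(h_{(2)})\cdot m)$ and $\chi(f)(m)=\sum f(m_{(0)})_{(0)}\otimes S^{-1}(m_{(1)})f(m_{(0)})_{(1)}$. A $k$-module $M$ is faithfully projective if it is finitely generated projective and $\sum_j m_j^*(m_j)=1$ for finitely many $m_j\in M$, $m_j^*\in M^*$. A Yetter–Drinfel'd $H$-module algebra $A$ is $H$-Azumaya if it is faithfully projective and the maps $F,G\colon A\otimes A\to\mathrm{End}_k(A)$, $F(a\otimes b)(c)=\sum ac_{(0)}(c_{(1)}\cdot b)$, $G(a\otimes b)(c)=\sum a_{(0)}(a_{(1)}\cdot c)b$, are bijective. Two $H$-Azumaya algebras are equivalent, $A\sim B$, if $A\#\mathrm{End}(M)\cong B\#\mathrm{End}(N)$ as Yetter–Drinfel'd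 module algebras for some faithfully projective $M,N\in\mathcal{YD}(H)$; $BQ(k,H)$ is the set of classes $[A]$ of $H$-Azumaya algebras. For $M\in\mathcal{YD}(H)$ let $\mathcal D(M)$ be the $k$-module $M$ with the $H^*$-action $\xi\rightharpoonup m=\sum\xi(m_{(1)})m_{(0)}$ and the $H^*$-coaction $\rho$ such that $(\mathrm{id}\otimes\langle -,l\rangle)\rho(m)=l\cdot m$ for all $l\in H$; for a Yetter–Drinfel'd $H$-module algebra $A$ let $\mathcal D(A)$ carry the opposite of the product of $A$. Claim. (1) $\mathcal D$, which is the identity on the underlying maps of morphisms, is together with the flips $\tau\colon\mathcal D(N)\otimes\mathcal D(M)\to\mathcal D(M\otimes N)$ an anti-equivalence of braided monoidal categories from $\mathcal{YD}(H)$ to $\mathcal{YD}(H^*)$, i.e. a braided monoidal equivalence from $\mathcal{YD}(H)$ to $\mathcal{YD}(H^*)$ with the reversed tensor product $M\otimes^{op}N=N\otimes M$ and with the braiding $\psi^{op}_{MN}=\psi_{NM}$, where $\psi$ is the braiding of $\mathcal{YD}(H^*)$. (2) $\sim$ is an equivalence relation on $H$-Azumaya algebras, $A\# B$ is $H$-Azumaya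 if $A$ and $B$ are, and $BQ(k,H)$ is a group under $[A][B]=[A\# B]$; the same holds for $H^*$. If $A$ is $H$-Azumaya then $\mathcal D(A)$ is $H^*$-Azumaya, and $[A]\mapsto[\mathcal D(A)]$ is a well-defined anti-isomorphism of groups $BQ(k,H)\to BQ(k,H^*)$. Hence $[A]\mapsto[\mathcal D(A)]^{-1}$ is an isomorphism of groups $BQ(k,H)\cong BQ(k,H^*)$. -/

import Mathlib

open CategoryTheory TensorProduct Coalgebra HopfAlgebra
open scoped MonoidalCategory

universe u v w

noncomputable section

set_option linter.unusedSectionVars false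

section Shortcuts

variable {R M N : Type*} [CommSemiring R] [AddCommMonoid M] [Module R M]
  [AddCommMonoid N] [Module R N]

/-- A shortcut for type class inference. -/
theorem zeroHomClass_linearMap : ZeroHomClass (M →ₗ[R] N) M N := inferInstance

/-- A shortcut for type class inference. -/
theorem zeroHomClass_linearEquiv : ZeroHomClass (M ≃ₗ[R] N) M N := inferInstance

/-- A shortcut for type class inference. -/
theorem addHomClass_linearMap : AddHomClass (M →ₗ[R] N) M N := inferInstance

/-- A shortcut for type class inference. -/
theorem addHomClass_linearEquiv : AddHomClass (M ≃ₗ[R] N) M N := inferInstance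

end Shortcuts

attribute [local instance] zeroHomClass_linearMap zeroHomClass_linearEquiv addHomClass_linearMap
  addHomClass_linearEquiv

section DualHopf

variable (k : Type u) [CommRing k] (H : Type v) [Ring H] [HopfAlgebra k H]

/-- The dual `H^* = Hom_k(H, k)` with the convolution product
`(ξ η)(h) = ∑ ξ(h₁) η(h₂)` and with the counit of `H` as unit. -/
def HopfDual : Type (max u v) := WithConv (H →ₗ[k] k)

instance : Ring (HopfDual k H) := inferInstanceAs (Ring (WithConv (H →ₗ[k] k)))

instance : Algebra k (HopfDual k H) := inferInstanceAs (Algebra k (WithConv (H →ₗ[k] k)))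

namespace HopfDual

/-- Elements of `H^*` are linear forms on `H`. -/
def lin : HopfDual k H ≃ₗ[k] (H →ₗ[k] k) := WithConv.linearEquiv k (H →ₗ[k] k)

instance : CoeFun (HopfDual k H) (fun _ => H → k) := ⟨fun ξ => lin k H ξ⟩

variable {k H}

@[ext]
lemma ext {ξ η : HopfDual k H} (h : ∀ a, ξ a = η a) : ξ = η :=
  (lin k H).injective (LinearMap.ext h)

@[simp]
lemma lin_symm_apply (f : H →ₗ[k] k) (a : H) : ((lin k H).symm f : HopfDual k H) a = f a := rfl

lemma repr_mul_apply {ι : Type*} {a : H} (r : Coalgebra.Repr k a ι) (ξ η : HopfDual k H) :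
    (ξ * η) a = ∑ i ∈ r.index, ξ (r.left i) * η (r.right i) :=
  r.convMul_apply (A := k) ξ η

lemma mul_apply (ξ η : HopfDual k H) (a : H) :
    (ξ * η) a = LinearMap.mul' k k (TensorProduct.map (lin k H ξ) (lin k H η) (comul a)) := rfl

@[simp]
lemma one_apply (a : H) : (1 : HopfDual k H) a = counit (R := k) a := rfl

@[simp]
lemma algebraMap_apply (c : k) (a : H) :
    (algebraMap k (HopfDual k H) c) a = c * counit (R := k) a := rfl

variable [Module.Finite k H] [Module.Projective k H]

instance : Module.Finite k (HopfDual k H) := Module.Finite.equiv (lin k H).symm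

instance : Module.Projective k (HopfDual k H) := Module.Projective.of_equiv (lin k H).symm

variable (k H) in
/-- The canonical isomorphism `H^* ⊗ H^* ≃ (H ⊗ H)^*`, with `(ξ ⊗ η)(a ⊗ b) = ξ(a) η(b)`. -/
def pairing : HopfDual k H ⊗[k] HopfDual k H ≃ₗ[k] (H ⊗[k] H →ₗ[k] k) :=
  TensorProduct.congr (lin k H) (lin k H) ≪≫ₗ homTensorHomEquiv k H H k k
    ≪≫ₗ LinearEquiv.arrowCongr (LinearEquiv.refl k _) (TensorProduct.lid k k)

@[simp]
lemma pairing_tmul (ξ η : HopfDual k H) (a b : H) :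
    pairing k H (ξ ⊗ₜ η) (a ⊗ₜ b) = ξ a * η b := by
  simp only [pairing, LinearEquiv.trans_apply, congr_tmul, homTensorHomEquiv_apply]
  rw [LinearEquiv.arrowCongr_apply]
  simp

/-- The comultiplication of `H^*` is determined by `∑ ξ₁(a) ξ₂(b) = ξ(ab)`, its counit is
`ξ ↦ ξ(1)`. -/
instance : CoalgebraStruct k (HopfDual k H) where
  comul := (pairing k H).symm.toLinearMap ∘ₗ
    (LinearMap.lcomp k k (LinearMap.mul' k H)) ∘ₗ (lin k H).toLinearMap
  counit := LinearMap.applyₗ (1 : H) ∘ₗ (lin k H).toLinearMap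

@[simp]
lemma counit_apply (ξ : HopfDual k H) : counit (R := k) ξ = ξ 1 := rfl

lemma pairing_comul (ξ : HopfDual k H) :
    pairing k H (comul ξ) = lin k H ξ ∘ₗ LinearMap.mul' k H := by
  change pairing k H ((pairing k H).symm _) = _
  rw [LinearEquiv.apply_symm_apply]; rfl

@[simp]
lemma pairing_comul_tmul (ξ : HopfDual k H) (a b : H) :
    pairing k H (comul ξ) (a ⊗ₜ b) = ξ (a * b) := by
  rw [pairing_comul]; rfl

/-- Evaluation of the first tensor factor at `a`. -/
def eval {X : Type*} [AddCommMonoid X] [Module k X] (a : H) :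
    HopfDual k H ⊗[k] X →ₗ[k] X :=
  TensorProduct.lid k X ∘ₗ (LinearMap.applyₗ a ∘ₗ (lin k H).toLinearMap).rTensor X

@[simp]
lemma eval_tmul {X : Type*} [AddCommMonoid X] [Module k X] (a : H)
    (ξ : HopfDual k H) (x : X) : eval a (ξ ⊗ₜ[k] x) = ξ a • x := by
  simp [eval]

lemma eval_ext {X : Type*} [AddCommMonoid X] [Module k X] {x y : HopfDual k H ⊗[k] X}
    (h : ∀ a : H, eval a x = eval a y) : x = y := by
  let e := (TensorProduct.congr (lin k H) (LinearEquiv.refl k X)) ≪≫ₗ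
    dualTensorHomEquiv k H X
  have key : ∀ (z : HopfDual k H ⊗[k] X) a, e z a = eval a z := by
    intro z a
    induction z with
    | zero => simp
    | add x y hx hy => simp [hx, hy]
    | tmul ξ x => simp [e, dualTensorHomEquiv]
  apply e.injective
  ext a
  rw [key, key, h]

lemma eval_pairing (x : HopfDual k H ⊗[k] HopfDual k H) (a b : H) :
    (eval a x : HopfDual k H) b = pairing k H x (a ⊗ₜ b) := by
  induction x with
  | zero => simp
  | add x y hx hy => simp [hx, hy]
  | tmul ξ η => simp

/-- `ξ ↦ ξ(a -)`. -/
def translate (a : H) : HopfDual k H →ₗ[k] HopfDual k H :=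
  (lin k H).symm.toLinearMap ∘ₗ LinearMap.lcomp k k (LinearMap.mulLeft k a) ∘ₗ
    (lin k H).toLinearMap

@[simp]
lemma translate_apply (a b : H) (ξ : HopfDual k H) : translate a ξ b = ξ (a * b) := rfl

lemma eval_comul (ξ : HopfDual k H) (a : H) : eval a (comul ξ) = translate a ξ := by
  ext b
  simp [eval_pairing]

lemma translate_comul (ξ : HopfDual k H) (a : H) :
    (translate a).rTensor _ (comul (R := k) ξ) = comul (translate a ξ) := by
  apply eval_ext
  intro b
  have : ∀ x : HopfDual k H ⊗[k] HopfDual k H,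
      eval b ((translate a).rTensor _ x) = eval (a * b) x := by
    intro x
    induction x with
    | zero => simp
    | add x y hx hy => simp [hx, hy]
    | tmul ξ η => simp
  rw [this, eval_comul, eval_comul]
  ext c
  simp [mul_assoc]

instance : Coalgebra k (HopfDual k H) where
  coassoc := by
    ext1 ξ
    apply eval_ext
    intro a
    have h1 : ∀ x : HopfDual k H ⊗[k] HopfDual k H,
        eval a (TensorProduct.assoc k _ _ _ (comul.rTensor _ x)) =
          (translate a).rTensor _ x := by
      intro x
      induction x with
      | zero => simp
      | add x y hx hy => simp only [map_add, hx, hy]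
      | tmul ξ η =>
        simp only [LinearMap.rTensor_tmul, ← eval_comul]
        generalize comul (R := k) ξ = z
        induction z with
        | zero => simp
        | add x y hx hy => simp only [map_add, hx, hy, add_tmul]
        | tmul α β => simp [smul_tmul']
    have h2 : ∀ x : HopfDual k H ⊗[k] HopfDual k H,
        eval a (comul.lTensor (HopfDual k H) x) = comul (eval a x) := by
      intro x
      induction x with
      | zero => simp
      | add x y hx hy => simp only [map_add, hx, hy]
      | tmul ξ η => simp
    simp only [LinearMap.comp_apply, LinearEquiv.coe_coe]
    rw [h1, h2, translate_comul, eval_comul]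
  rTensor_counit_comp_comul := by
    ext1 ξ
    apply (TensorProduct.lid k _).injective
    have : ∀ x : HopfDual k H ⊗[k] HopfDual k H,
        TensorProduct.lid k _ (counit.rTensor _ x) = eval (1 : H) x := by
      intro x
      induction x with
      | zero => simp
      | add x y hx hy => simp only [map_add, hx, hy]
      | tmul ξ η => simp
    simp only [LinearMap.comp_apply, this, eval_comul]
    ext b; simp
  lTensor_counit_comp_comul := by
    ext1 ξ
    apply (TensorProduct.rid k _).injective
    have : ∀ (x : HopfDual k H ⊗[k] HopfDual k H) (a : H),
        (TensorProduct.rid k (HopfDual k H) (counit.lTensor _ x)) a =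
          pairing k H x (a ⊗ₜ 1) := by
      intro x a
      induction x with
      | zero => simp
      | add x y hx hy => simp only [map_add, hx, hy, LinearMap.add_apply]
      | tmul ξ η => simp [mul_comm]
    ext b
    simp only [LinearMap.comp_apply, this, pairing_comul_tmul]
    simp

lemma pairing_mul {ι κ : Type*} (x y : HopfDual k H ⊗[k] HopfDual k H) (a b : H)
    (r : Coalgebra.Repr k a ι) (s : Coalgebra.Repr k b κ) :
    pairing k H (x * y) (a ⊗ₜ b) = ∑ i ∈ r.index, ∑ j ∈ s.index,
      pairing k H x (r.left i ⊗ₜ s.left j) * pairing k H y (r.right i ⊗ₜ s.right j) := by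
  induction x with
  | zero => simp
  | add x x' hx hy =>
    simp only [add_mul, map_add, hx, hy, LinearMap.add_apply, Finset.sum_add_distrib]
  | tmul ξ η =>
    induction y with
    | zero => simp
    | add x x' hx hy =>
      simp only [mul_add, map_add, hx, hy, LinearMap.add_apply, Finset.sum_add_distrib]
    | tmul ξ' η' =>
      rw [Algebra.TensorProduct.tmul_mul_tmul, pairing_tmul, repr_mul_apply r, repr_mul_apply s]
      simp [Finset.sum_mul_sum, mul_mul_mul_comm]

instance : Bialgebra k (HopfDual k H) :=
  Bialgebra.mk' k (HopfDual k H)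
    (by simp)
    (by intro ξ η; rw [counit_apply, mul_apply, Bialgebra.comul_one, Algebra.TensorProduct.one_def]
        simp)
    (by
      apply (pairing k H).injective
      ext a b
      simp [Algebra.TensorProduct.one_def])
    (by
      intro ξ η
      apply (pairing k H).injective
      ext a b
      simp only [AlgebraTensorModule.curry_apply, curry_apply, LinearMap.coe_restrictScalars]
      rw [pairing_mul _ _ _ _ (ℛ k a) (ℛ k b), pairing_comul_tmul,
        repr_mul_apply ((ℛ k a).mul (ℛ k b))]
      simp [Finset.sum_product])

variable (k H) in
/-- The transpose of the antipode of `H`. -/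
def antipodeTranspose : HopfDual k H →ₗ[k] HopfDual k H :=
  (lin k H).symm.toLinearMap ∘ₗ LinearMap.lcomp k k (antipode k) ∘ₗ (lin k H).toLinearMap

@[simp]
lemma antipodeTranspose_apply (ξ : HopfDual k H) (h : H) :
    antipodeTranspose k H ξ h = ξ (antipode k h) := rfl

instance : HopfAlgebra k (HopfDual k H) where
  antipode := antipodeTranspose k H
  mul_antipode_rTensor_comul := by
    ext ξ h
    have : ∀ x : HopfDual k H ⊗[k] HopfDual k H,
        (LinearMap.mul' k (HopfDual k H) ((antipodeTranspose k H).rTensor _ x)) h =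
        pairing k H x ((antipode k).rTensor H (comul h)) := by
      intro x
      induction x with
      | zero => simp
      | add x y hx hy => simp only [map_add, hx, hy, LinearMap.add_apply]
      | tmul ξ η =>
        simp only [LinearMap.rTensor_tmul, LinearMap.mul'_apply]
        rw [repr_mul_apply (ℛ k h), ← (ℛ k h).eq]
        simp
    simp only [LinearMap.comp_apply] at this ⊢
    rw [this, pairing_comul, LinearMap.comp_apply, mul_antipode_rTensor_comul_apply]
    simp [Algebra.algebraMap_eq_smul_one, mul_comm]
  mul_antipode_lTensor_comul := by
    ext ξ h
    have : ∀ x : HopfDual k H ⊗[k] HopfDual k H,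
        (LinearMap.mul' k (HopfDual k H) ((antipodeTranspose k H).lTensor _ x)) h =
        pairing k H x ((antipode k).lTensor H (comul h)) := by
      intro x
      induction x with
      | zero => simp
      | add x y hx hy => simp only [map_add, hx, hy, LinearMap.add_apply]
      | tmul ξ η =>
        simp only [LinearMap.lTensor_tmul, LinearMap.mul'_apply]
        rw [repr_mul_apply (ℛ k h), ← (ℛ k h).eq]
        simp
    simp only [LinearMap.comp_apply] at this ⊢
    rw [this, pairing_comul, LinearMap.comp_apply, mul_antipode_lTensor_comul_apply]
    simp [Algebra.algebraMap_eq_smul_one, mul_comm]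

@[simp]
lemma antipode_apply (ξ : HopfDual k H) (h : H) : antipode k ξ h = ξ (antipode k h) := rfl

end HopfDual

end DualHopf

section YD

variable (k : Type u) [CommRing k] (H : Type v) [Ring H] [HopfAlgebra k H]

/-- The structure of a Yetter-Drinfel'd `H`-module on a `k`-module `M`: a left action `h · m` and
a right coaction `m ↦ ∑ m₀ ⊗ m₁ ∈ M ⊗ H` subject to
`∑ h₁ · m₀ ⊗ h₂ m₁ = ∑ (h₂ · m)₀ ⊗ (h₂ · m)₁ h₁`. -/
structure YDStruct (M : Type w) [AddCommGroup M] [Module k M] where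
  /-- the left `H`-action -/
  act : H →ₐ[k] Module.End k M
  /-- the right `H`-coaction -/
  coact : M →ₗ[k] M ⊗[k] H
  coassoc : ∀ m, TensorProduct.assoc k M H H (coact.rTensor H (coact m)) =
    (comul (R := k) (A := H)).lTensor M (coact m)
  counit_coact : ∀ m, TensorProduct.rid k M ((counit (R := k) (A := H)).lTensor M (coact m)) = m
  /-- The left hand side is the image of `Δ(h) ⊗ χ(m)` under `(a ⊗ b) ⊗ (m ⊗ g) ↦ a · m ⊗ b g`,
  the right hand side is the image of `Δ(h)` under `a ⊗ b ↦ (id ⊗ (- * a)) χ(b · m)`. -/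
  compat : ∀ h m,
    TensorProduct.map₂ act.toLinearMap (LinearMap.mul k H) (comul (R := k) h) (coact m) =
      TensorProduct.lift ((LinearMap.lTensorHom M ∘ₗ (LinearMap.mul k H).flip).compl₂
        (coact ∘ₗ act.toLinearMap.flip m)) (comul (R := k) h)

variable {k H}

namespace YDStruct

section tensor

variable {M : Type*} [AddCommGroup M] [Module k M] {N : Type*} [AddCommGroup N] [Module k N]

/-- `(m ⊗ g, n ⊗ g') ↦ (m ⊗ n) ⊗ g' g` -/
def mulOp (k : Type u) [CommRing k] (H : Type v) [Ring H] [HopfAlgebra k H]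
    (M : Type*) [AddCommGroup M] [Module k M] (N : Type*) [AddCommGroup N] [Module k N] :
    M ⊗[k] H →ₗ[k] N ⊗[k] H →ₗ[k] (M ⊗[k] N) ⊗[k] H :=
  TensorProduct.map₂ (TensorProduct.mk k M N) (LinearMap.mul k H).flip

@[simp]
lemma mulOp_tmul (m : M) (g : H) (n : N) (g' : H) :
    mulOp k H M N (m ⊗ₜ g) (n ⊗ₜ g') = (m ⊗ₜ n) ⊗ₜ (g' * g) := by
  simp [mulOp]

variable (X : YDStruct k H M) (Y : YDStruct k H N)

/-- `h · (m ⊗ n) = ∑ h₁ · m ⊗ h₂ · n` -/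
def tensorAct : H →ₐ[k] Module.End k (M ⊗[k] N) :=
  (Module.endTensorEndAlgHom (R := k) (A := k) (M := M) (N := N)).comp
    ((Algebra.TensorProduct.map X.act Y.act).comp (Bialgebra.comulAlgHom k H))

lemma tensorAct_apply (h : H) (m : M) (n : N) :
    tensorAct X Y h (m ⊗ₜ n) =
      TensorProduct.map (X.act.toLinearMap.flip m) (Y.act.toLinearMap.flip n)
        (comul (R := k) h) := by
  simp only [tensorAct, AlgHom.comp_apply, Bialgebra.comulAlgHom_apply]
  generalize comul (R := k) h = z
  induction z with
  | zero => simp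
  | add x y hx hy => simp only [map_add, hx, hy, LinearMap.add_apply]
  | tmul a b =>
    simp only [Algebra.TensorProduct.map_tmul, map_tmul]
    rw [Module.endTensorEndAlgHom_apply]; rfl

/-- `a ⊗ b ↦ (a · -) ⊗ (b · -)` -/
def tensorActAux : H ⊗[k] H →ₗ[k] Module.End k (M ⊗[k] N) :=
  TensorProduct.lift ((TensorProduct.mapBilinear (.id k) M N M N).compl₁₂
    X.act.toLinearMap Y.act.toLinearMap)

@[simp]
lemma tensorActAux_tmul (a b : H) :
    tensorActAux X Y (a ⊗ₜ b) = TensorProduct.map (X.act a) (Y.act b) := rfl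

lemma tensorAct_eq (h : H) : tensorAct X Y h = tensorActAux X Y (comul h) := by
  simp only [tensorAct, AlgHom.comp_apply, Bialgebra.comulAlgHom_apply]
  generalize comul (R := k) h = z
  induction z with
  | zero => simp
  | add x y hx hy => simp only [map_add, hx, hy]
  | tmul a b =>
    simp only [Algebra.TensorProduct.map_tmul, tensorActAux_tmul]
    rw [Module.endTensorEndAlgHom_apply]; rfl

/-- `χ(m ⊗ n) = ∑ m₀ ⊗ n₀ ⊗ n₁ m₁` -/
def tensorCoact : M ⊗[k] N →ₗ[k] (M ⊗[k] N) ⊗[k] H :=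
  TensorProduct.lift ((mulOp k H M N).compl₁₂ X.coact Y.coact)

@[simp]
lemma tensorCoact_tmul (m : M) (n : N) :
    tensorCoact X Y (m ⊗ₜ n) = mulOp k H M N (X.coact m) (Y.coact n) := by
  simp [tensorCoact]

lemma tensor_coassoc_left (x : M ⊗[k] H) (y : N ⊗[k] H) :
    TensorProduct.assoc k _ H H ((tensorCoact X Y).rTensor H (mulOp k H M N x y)) =
      TensorProduct.map₂ (TensorProduct.mk k M N)
        (TensorProduct.map₂ (LinearMap.mul k H).flip (LinearMap.mul k H).flip)
        (TensorProduct.assoc k _ _ _ (X.coact.rTensor H x))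
        (TensorProduct.assoc k _ _ _ (Y.coact.rTensor H y)) := by
  induction x with
  | zero => simp
  | add x x' hx hx' => simp only [map_add, LinearMap.add_apply, hx, hx']
  | tmul m g =>
  induction y with
  | zero => simp
  | add x x' hx hx' => simp only [map_add, hx, hx']
  | tmul n g' =>
  simp only [mulOp_tmul, LinearMap.rTensor_tmul, tensorCoact_tmul]
  generalize X.coact m = x
  generalize Y.coact n = y
  induction x with
  | zero => simp
  | add x x' hx hx' => simp only [map_add, LinearMap.add_apply, hx, hx', add_tmul]
  | tmul m g =>
  induction y with
  | zero => simp
  | add x x' hx hx' => simp only [map_add, hx, hx', add_tmul]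
  | tmul n g' => simp

lemma tensor_coassoc_right (x : M ⊗[k] H) (y : N ⊗[k] H) :
    (comul (R := k) (A := H)).lTensor _ (mulOp k H M N x y) =
      TensorProduct.map₂ (TensorProduct.mk k M N)
        (TensorProduct.map₂ (LinearMap.mul k H).flip (LinearMap.mul k H).flip)
        (comul.lTensor _ x) (comul.lTensor _ y) := by
  induction x with
  | zero => simp
  | add x x' hx hx' => simp only [map_add, LinearMap.add_apply, hx, hx']
  | tmul m g =>
  induction y with
  | zero => simp
  | add x x' hx hx' => simp only [map_add, hx, hx']
  | tmul n g' =>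
  simp only [mulOp_tmul, LinearMap.lTensor_tmul, Bialgebra.comul_mul]
  generalize comul (R := k) g = x
  generalize comul (R := k) g' = y
  induction x with
  | zero => simp
  | add x x' hx hx' => simp only [mul_add, map_add, LinearMap.add_apply, hx, hx', tmul_add]
  | tmul m g =>
  induction y with
  | zero => simp
  | add x x' hx hx' => simp only [add_mul, map_add, hx, hx', tmul_add]
  | tmul n g' => simp

lemma tensor_counit (x : M ⊗[k] H) (y : N ⊗[k] H) :
    TensorProduct.rid k _ ((counit (R := k) (A := H)).lTensor _ (mulOp k H M N x y)) =
      TensorProduct.rid k M (counit.lTensor _ x) ⊗ₜ TensorProduct.rid k N (counit.lTensor _ y) := by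
  induction x with
  | zero => simp
  | add x x' hx hx' => simp only [map_add, LinearMap.add_apply, hx, hx', add_tmul]
  | tmul m g =>
  induction y with
  | zero => simp
  | add x x' hx hx' => simp only [map_add, hx, hx', tmul_add]
  | tmul n g' => simp [smul_tmul', smul_smul, mul_comm]

/-- `∑ h₁ · m₀ ⊗ h₂ m₁` as a function of `h₁ ⊗ h₂` -/
abbrev cL (m : M) : H ⊗[k] H →ₗ[k] M ⊗[k] H :=
  (TensorProduct.map₂ X.act.toLinearMap (LinearMap.mul k H)).flip (X.coact m)

/-- `∑ (h₂ · m)₀ ⊗ (h₂ · m)₁ h₁` as a function of `h₁ ⊗ h₂` -/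
abbrev cR (m : M) : H ⊗[k] H →ₗ[k] M ⊗[k] H :=
  TensorProduct.lift ((LinearMap.lTensorHom M ∘ₗ (LinearMap.mul k H).flip).compl₂
        (X.coact ∘ₗ X.act.toLinearMap.flip m))

lemma cL_eq_cR (h : H) (m : M) : X.cL m (comul h) = X.cR m (comul h) := X.compat h m

lemma cR_tmul (a b : H) (m : M) :
    X.cR m (a ⊗ₜ b) = (LinearMap.mulRight k a).lTensor M (X.coact (X.act b m)) := rfl

lemma cL_tmul (a b : H) (m : M) :
    X.cL m (a ⊗ₜ b) = TensorProduct.map (X.act a) (LinearMap.mulLeft k b) (X.coact m) := rfl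

lemma coassoc_H (h : H) : TensorProduct.assoc k H H H (comul.rTensor H (comul (R := k) h)) =
    comul.lTensor H (comul (R := k) h) := Coalgebra.coassoc_apply h

lemma tensor_compat_aux1 (x : M ⊗[k] H) (y : N ⊗[k] H) (c d b : H) :
    TensorProduct.map (TensorProduct.map (X.act c) (Y.act d)) (LinearMap.mulLeft k b)
      (mulOp k H M N x y) =
    mulOp k H M N ((X.act c).rTensor H x)
      (TensorProduct.map (Y.act d) (LinearMap.mulLeft k b) y) := by
  induction x with
  | zero => simp
  | add x x' hx hx' => simp only [map_add, LinearMap.add_apply, hx, hx']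
  | tmul m g =>
  induction y with
  | zero => simp
  | add x x' hx hx' => simp only [map_add, hx, hx']
  | tmul n g' => simp [mul_assoc]

lemma tensor_compat_aux2 (x : M ⊗[k] H) (y : N ⊗[k] H) (c b : H) :
    mulOp k H M N ((X.act c).rTensor H x) ((LinearMap.mulRight k b).lTensor N y) =
    mulOp k H M N (TensorProduct.map (X.act c) (LinearMap.mulLeft k b) x) y := by
  induction x with
  | zero => simp
  | add x x' hx hx' => simp only [map_add, LinearMap.add_apply, hx, hx']
  | tmul m g =>
  induction y with
  | zero => simp
  | add x x' hx hx' => simp only [map_add, hx, hx']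
  | tmul n g' => simp [mul_assoc]

lemma tensor_compat_aux3 (x : M ⊗[k] H) (y : N ⊗[k] H) (b : H) :
    mulOp k H M N ((LinearMap.mulRight k b).lTensor M x) y =
    (LinearMap.mulRight k b).lTensor _ (mulOp k H M N x y) := by
  induction x with
  | zero => simp
  | add x x' hx hx' => simp only [map_add, LinearMap.add_apply, hx, hx']
  | tmul m g =>
  induction y with
  | zero => simp
  | add x x' hx hx' => simp only [map_add, hx, hx']
  | tmul n g' => simp [mul_assoc]

/-- `a ⊗ y ↦ ∑ (a · m₀ ⊗ y₀) ⊗ y₁ m₁` -/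
def tensorP (m : M) : H →ₗ[k] N ⊗[k] H →ₗ[k] (M ⊗[k] N) ⊗[k] H :=
  (mulOp k H M N) ∘ₗ (LinearMap.applyₗ (X.coact m)) ∘ₗ
          (LinearMap.rTensorHom H) ∘ₗ X.act.toLinearMap

lemma tensorP_apply (m : M) (a : H) (y : N ⊗[k] H) :
  tensorP X m a y = mulOp k H M N ((X.act a).rTensor H (X.coact m)) y := rfl

lemma tensor_compat_left (m : M) (n : N) (x : H ⊗[k] H) :
    TensorProduct.map₂ (tensorAct X Y).toLinearMap (LinearMap.mul k H) x
        (tensorCoact X Y (m ⊗ₜ n)) =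
      TensorProduct.lift ((tensorP X m).compl₂ (Y.cL n))
        (TensorProduct.assoc k H H H (comul.rTensor H x)) := by
  induction x with
  | zero => simp
  | add x x' hx hx' => simp only [map_add, LinearMap.add_apply, hx, hx']
  | tmul a b =>
  simp only [LinearMap.rTensor_tmul, tensorCoact_tmul]
  change TensorProduct.map (tensorAct X Y a) (LinearMap.mulLeft k b) _ = _
  rw [tensorAct_eq]
  generalize comul (R := k) a = z
  induction z with
  | zero => simp
  | add x x' hx hx' =>
    simp only [map_add, hx, hx', add_tmul, TensorProduct.map_add_left, LinearMap.add_apply]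
  | tmul c d => exact tensor_compat_aux1 X Y _ _ c d b

lemma tensor_compat_mid (m : M) (n : N) (x : H ⊗[k] H) :
    TensorProduct.lift ((tensorP X m).compl₂ (Y.cR n))
        (TensorProduct.assoc k H H H (comul.rTensor H x)) =
      TensorProduct.lift ((mulOp k H M N).compl₁₂ (X.cL m ∘ₗ comul)
        (Y.coact ∘ₗ Y.act.toLinearMap.flip n)) x := by
  induction x with
  | zero => simp
  | add x x' hx hx' => simp only [map_add, hx, hx']
  | tmul a b =>
  simp only [LinearMap.rTensor_tmul, lift.tmul, LinearMap.compl₁₂_apply, LinearMap.comp_apply]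
  generalize comul (R := k) a = z
  induction z with
  | zero => simp
  | add x x' hx hx' => simp only [map_add, hx, hx', add_tmul, LinearMap.add_apply]
  | tmul c d => exact tensor_compat_aux2 X _ _ c d

lemma tensor_compat_right (m : M) (n : N) (x : H ⊗[k] H) :
    TensorProduct.lift ((LinearMap.lTensorHom (M ⊗[k] N) ∘ₗ (LinearMap.mul k H).flip).compl₂
        (tensorCoact X Y ∘ₗ (tensorAct X Y).toLinearMap.flip (m ⊗ₜ n))) x =
    TensorProduct.lift ((mulOp k H M N).compl₁₂ (X.cR m)
        (Y.coact ∘ₗ Y.act.toLinearMap.flip n))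
        ((TensorProduct.assoc k H H H).symm (comul.lTensor H x)) := by
  induction x with
  | zero => simp
  | add x x' hx hx' => simp only [map_add, hx, hx']
  | tmul a b =>
  simp only [LinearMap.lTensor_tmul]
  change (LinearMap.mulRight k a).lTensor _ (tensorCoact X Y (tensorAct X Y b (m ⊗ₜ n))) = _
  rw [tensorAct_eq]
  generalize comul (R := k) b = z
  induction z with
  | zero => simp
  | add x x' hx hx' => simp only [map_add, hx, hx', tmul_add, LinearMap.add_apply]
  | tmul c d =>
    simp only [tensorActAux_tmul, map_tmul, tensorCoact_tmul, assoc_symm_tmul]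
    exact (tensor_compat_aux3 _ _ _).symm

lemma lift_comul_congr {P Q : Type*} [AddCommGroup P] [Module k P] [AddCommGroup Q] [Module k Q]
    (f g : H ⊗[k] H →ₗ[k] P) (B : H →ₗ[k] P →ₗ[k] Q) (h : ∀ a, f (comul a) = g (comul a))
    (x : H ⊗[k] H) :
    TensorProduct.lift (B.compl₂ f) (comul.lTensor H x) =
      TensorProduct.lift (B.compl₂ g) (comul.lTensor H x) := by
  induction x with
  | zero => simp
  | add x x' hx hx' => simp only [map_add, hx, hx']
  | tmul a b => simp [h]

lemma tensor_compat (h : H) (m : M) (n : N) :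
    TensorProduct.map₂ (tensorAct X Y).toLinearMap (LinearMap.mul k H) (comul (R := k) h)
        (tensorCoact X Y (m ⊗ₜ n)) =
    TensorProduct.lift ((LinearMap.lTensorHom (M ⊗[k] N) ∘ₗ (LinearMap.mul k H).flip).compl₂
        (tensorCoact X Y ∘ₗ (tensorAct X Y).toLinearMap.flip (m ⊗ₜ n))) (comul (R := k) h) := by
  rw [tensor_compat_left, tensor_compat_right, coassoc_H,
    lift_comul_congr _ _ _ (fun a => Y.cL_eq_cR a n), ← coassoc_H, tensor_compat_mid,
    LinearEquiv.symm_apply_apply]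
  generalize comul (R := k) h = z
  induction z with
  | zero => simp
  | add x x' hx hx' => simp only [map_add, hx, hx']
  | tmul c d =>
    simp only [lift.tmul, LinearMap.compl₁₂_apply, LinearMap.comp_apply, LinearMap.rTensor_tmul,
      cL_eq_cR]

/-- The tensor product of Yetter-Drinfel'd modules. -/
def tensor : YDStruct k H (M ⊗[k] N) where
  act := tensorAct X Y
  coact := tensorCoact X Y
  coassoc z := by
    induction z with
    | zero => simp
    | add x x' hx hx' => simp only [map_add, hx, hx']
    | tmul m n =>
      rw [tensorCoact_tmul, tensor_coassoc_left, tensor_coassoc_right, X.coassoc, Y.coassoc]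
  counit_coact z := by
    induction z with
    | zero => simp
    | add x x' hx hx' => simp only [map_add, hx, hx']
    | tmul m n => rw [tensorCoact_tmul, tensor_counit, X.counit_coact, Y.counit_coact]
  compat h z := by
    induction z with
    | zero =>
      simp only [map_zero, LinearMap.comp_zero]
      generalize comul (R := k) h = z
      induction z with
      | zero => simp
      | add x x' hx hx' => simp only [map_add, ← hx, ← hx', add_zero]
      | tmul c d => simp
    | add x x' hx hx' =>
      simp only [map_add, hx, hx', LinearMap.comp_add]
      generalize comul (R := k) h = z
      induction z with
      | zero => simp
      | add x x' hx hx' => simp only [map_add, ← hx, ← hx']; abel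
      | tmul c d => simp
    | tmul m n => exact tensor_compat X Y h m n

end tensor

/-- The trivial Yetter-Drinfel'd module `k`. -/
def unit (k : Type u) [CommRing k] (H : Type v) [Ring H] [HopfAlgebra k H] : YDStruct k H k where
  act := (Algebra.ofId k (Module.End k k)).comp (Bialgebra.counitAlgHom k H)
  coact := (TensorProduct.mk k k H).flip 1
  coassoc m := by simp [Algebra.TensorProduct.one_def]
  counit_coact m := by simp
  compat h m := by
    have hl : ∀ x : H ⊗[k] H, TensorProduct.map₂
        ((Algebra.ofId k (Module.End k k)).comp (Bialgebra.counitAlgHom k H)).toLinearMap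
        (LinearMap.mul k H) x ((TensorProduct.mk k k H).flip 1 m) =
        m ⊗ₜ TensorProduct.lid k H (counit.rTensor H x) := by
      intro x
      induction x with
      | zero => simp
      | add x x' hx hx' => simp only [map_add, hx, hx', LinearMap.add_apply, tmul_add]
      | tmul a b => simp [Algebra.ofId_apply, smul_tmul', mul_comm]
    have hr : ∀ x : H ⊗[k] H, TensorProduct.lift ((LinearMap.lTensorHom k ∘ₗ
        (LinearMap.mul k H).flip).compl₂ ((TensorProduct.mk k k H).flip 1 ∘ₗ
        ((Algebra.ofId k (Module.End k k)).comp
          (Bialgebra.counitAlgHom k H)).toLinearMap.flip m)) x =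
        m ⊗ₜ TensorProduct.rid k H (counit.lTensor H x) := by
      intro x
      induction x with
      | zero => simp
      | add x x' hx hx' => simp only [map_add, hx, hx', tmul_add]
      | tmul a b => simp [Algebra.ofId_apply, smul_tmul', mul_comm]
    rw [hl, hr]
    simp

section hom

variable {M : Type*} [AddCommGroup M] [Module k M] {N : Type*} [AddCommGroup N] [Module k N]
  {M' : Type*} [AddCommGroup M'] [Module k M'] {N' : Type*} [AddCommGroup N'] [Module k N']
  {P : Type*} [AddCommGroup P] [Module k P]

/-- A linear map is a morphism of Yetter-Drinfel'd modules if it is `H`-linear and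
`H`-colinear. -/
structure IsHom (X : YDStruct k H M) (Y : YDStruct k H N) (f : M →ₗ[k] N) : Prop where
  act_comm : ∀ h m, f (X.act h m) = Y.act h (f m)
  coact_comm : ∀ m, Y.coact (f m) = f.rTensor H (X.coact m)

lemma IsHom.symm {X : YDStruct k H M} {Y : YDStruct k H N} {e : M ≃ₗ[k] N}
    (he : IsHom X Y e.toLinearMap) : IsHom Y X e.symm.toLinearMap where
  act_comm h m := by
    apply e.injective
    simpa using (he.act_comm h (e.symm m)).symm
  coact_comm m := by
    obtain ⟨m, rfl⟩ := e.surjective m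
    have := he.coact_comm m
    simp only [LinearEquiv.coe_coe] at this ⊢
    rw [this]
    simp [← LinearMap.rTensor_comp_apply]

lemma isHom_id (X : YDStruct k H M) : IsHom X X LinearMap.id := ⟨by simp, by simp⟩

lemma IsHom.comp {X : YDStruct k H M} {Y : YDStruct k H N} {Z : YDStruct k H P}
    {f : M →ₗ[k] N} {g : N →ₗ[k] P} (hg : IsHom Y Z g) (hf : IsHom X Y f) :
    IsHom X Z (g ∘ₗ f) :=
  ⟨by simp [hf.act_comm, hg.act_comm],
    by simp [hf.coact_comm, hg.coact_comm, LinearMap.rTensor_comp]⟩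

lemma IsHom.tensor {X : YDStruct k H M} {Y : YDStruct k H N} {X' : YDStruct k H M'}
    {Y' : YDStruct k H N'} {f : M →ₗ[k] N} {g : M' →ₗ[k] N'} (hf : IsHom X Y f)
    (hg : IsHom X' Y' g) : IsHom (X.tensor X') (Y.tensor Y') (TensorProduct.map f g) where
  act_comm h z := by
    change TensorProduct.map f g (tensorAct _ _ h z) = tensorAct _ _ h _
    induction z with
    | zero => simp
    | add x x' hx hx' => simp only [map_add, hx, hx']
    | tmul m n =>
      simp only [tensorAct_eq, map_tmul]
      generalize comul (R := k) h = z
      induction z with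
      | zero => simp
      | add x x' hx hx' => simp only [map_add, hx, hx', LinearMap.add_apply]
      | tmul a b => simp [hf.act_comm, hg.act_comm]
  coact_comm z := by
    change tensorCoact _ _ _ = LinearMap.rTensor H _ (tensorCoact _ _ z)
    induction z with
    | zero => simp
    | add x x' hx hx' => simp only [map_add, hx, hx']
    | tmul m n =>
      simp only [tensorCoact_tmul, map_tmul, hf.coact_comm, hg.coact_comm]
      generalize X.coact m = x
      generalize X'.coact n = y
      induction x with
      | zero => simp
      | add x x' hx hx' => simp only [map_add, hx, hx', LinearMap.add_apply]
      | tmul a b =>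
      induction y with
      | zero => simp
      | add x x' hx hx' => simp only [map_add, hx, hx']
      | tmul a b => simp

lemma isHom_assoc (X : YDStruct k H M) (Y : YDStruct k H N) (Z : YDStruct k H P) :
    IsHom ((X.tensor Y).tensor Z) (X.tensor (Y.tensor Z))
      (TensorProduct.assoc k M N P).toLinearMap where
  act_comm h z := by
    change TensorProduct.assoc k M N P (tensorAct (X.tensor Y) Z h z) =
      tensorAct X (Y.tensor Z) h (TensorProduct.assoc k M N P z)
    have hl : ∀ (x : H ⊗[k] H) (m : M) (n : N) (p : P),
      TensorProduct.assoc k M N P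
        (tensorActAux (X.tensor Y) Z x ((m ⊗ₜ n) ⊗ₜ p)) =
        TensorProduct.map (X.act.toLinearMap.flip m)
          (TensorProduct.map (Y.act.toLinearMap.flip n) (Z.act.toLinearMap.flip p))
          (TensorProduct.assoc k H H H (comul.rTensor H x)) := by
      intro x m n p
      induction x with
      | zero => simp
      | add x x' hx hx' => simp only [map_add, hx, hx', LinearMap.add_apply]
      | tmul a b =>
        change TensorProduct.assoc k M N P (tensorAct X Y a (m ⊗ₜ n) ⊗ₜ _) = _
        rw [tensorAct_eq, LinearMap.rTensor_tmul]
        generalize comul (R := k) a = z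
        induction z with
        | zero => simp
        | add x x' hx hx' => simp only [map_add, hx, hx', LinearMap.add_apply, add_tmul]
        | tmul a b => simp
    have hr : ∀ (x : H ⊗[k] H) (m : M) (n : N) (p : P),
        (tensorActAux X (Y.tensor Z) x (m ⊗ₜ (n ⊗ₜ p))) =
        TensorProduct.map (X.act.toLinearMap.flip m)
          (TensorProduct.map (Y.act.toLinearMap.flip n) (Z.act.toLinearMap.flip p))
          (comul.lTensor H x) := by
      intro x m n p
      induction x with
      | zero => simp
      | add x x' hx hx' => simp only [map_add, hx, hx', LinearMap.add_apply]
      | tmul a b =>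
        change X.act a m ⊗ₜ[k] (tensorAct Y Z b (n ⊗ₜ p)) = _
        rw [tensorAct_eq, LinearMap.lTensor_tmul]
        generalize comul (R := k) b = z
        induction z with
        | zero => simp
        | add x x' hx hx' => simp only [map_add, hx, hx', LinearMap.add_apply, tmul_add]
        | tmul a b => simp
    induction z with
    | zero => simp
    | add x x' hx hx' => simp only [map_add, hx, hx']
    | tmul z p =>
    induction z with
    | zero => simp
    | add x x' hx hx' => simp only [map_add, hx, hx', add_tmul]
    | tmul m n =>
      rw [tensorAct_eq, hl, assoc_tmul, tensorAct_eq, hr, coassoc_H]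
  coact_comm z := by
    change tensorCoact X (Y.tensor Z) (TensorProduct.assoc k M N P z) =
      LinearMap.rTensor H _ (tensorCoact (X.tensor Y) Z z)
    induction z with
    | zero => simp
    | add x x' hx hx' => simp only [map_add, hx, hx']
    | tmul z p =>
    induction z with
    | zero => simp
    | add x x' hx hx' => simp only [map_add, hx, hx', add_tmul]
    | tmul m n =>
      rw [assoc_tmul, tensorCoact_tmul, tensorCoact_tmul]
      change mulOp k H M (N ⊗[k] P) _ (tensorCoact Y Z _) =
        LinearMap.rTensor H _ (mulOp k H (M ⊗[k] N) P (tensorCoact X Y _) _)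
      rw [tensorCoact_tmul, tensorCoact_tmul]
      generalize X.coact m = x
      generalize Y.coact n = y
      generalize Z.coact p = z
      induction x with
      | zero => simp
      | add x x' hx hx' => simp only [map_add, hx, hx', LinearMap.add_apply]
      | tmul a b =>
      induction y with
      | zero => simp
      | add x x' hx hx' => simp only [map_add, hx, hx', LinearMap.add_apply]
      | tmul a b =>
      induction z with
      | zero => simp
      | add x x' hx hx' => simp only [map_add, hx, hx']
      | tmul a b => simp [mul_assoc]

lemma isHom_lid (X : YDStruct k H M) :
    IsHom ((unit k H).tensor X) X (TensorProduct.lid k M).toLinearMap where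
  act_comm h z := by
    change TensorProduct.lid k M (tensorAct (unit k H) X h z) = _
    induction z with
    | zero => simp
    | add x x' hx hx' => simp only [map_add, hx, hx']
    | tmul c m =>
      rw [tensorAct_eq]
      have : ∀ x : H ⊗[k] H, TensorProduct.lid k M (tensorActAux (unit k H) X x (c ⊗ₜ m)) =
          X.act (TensorProduct.lid k H (counit.rTensor H x)) (c • m) := by
        intro x
        induction x with
        | zero => simp
        | add x x' hx hx' => simp only [map_add, hx, hx', LinearMap.add_apply]
        | tmul a b => simp [unit, Algebra.ofId_apply, smul_smul, mul_comm]
      rw [this]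
      simp
  coact_comm z := by
    change _ = LinearMap.rTensor H _ (tensorCoact (unit k H) X z)
    induction z with
    | zero => simp
    | add x x' hx hx' => simp only [map_add, hx, hx']
    | tmul c m =>
      rw [tensorCoact_tmul]
      simp only [LinearEquiv.coe_coe, lid_tmul, map_smul]
      generalize X.coact m = y
      change _ = LinearMap.rTensor H _ (mulOp k H k M (c ⊗ₜ 1) y)
      induction y with
      | zero => simp
      | add x x' hx hx' => simp only [map_add, hx, hx', smul_add]
      | tmul a b => simp [smul_tmul']

lemma isHom_rid (X : YDStruct k H M) :
    IsHom (X.tensor (unit k H)) X (TensorProduct.rid k M).toLinearMap where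
  act_comm h z := by
    change TensorProduct.rid k M (tensorAct X (unit k H) h z) = _
    induction z with
    | zero => simp
    | add x x' hx hx' => simp only [map_add, hx, hx']
    | tmul m c =>
      rw [tensorAct_eq]
      have : ∀ x : H ⊗[k] H, TensorProduct.rid k M (tensorActAux X (unit k H) x (m ⊗ₜ c)) =
          X.act (TensorProduct.rid k H (counit.lTensor H x)) (c • m) := by
        intro x
        induction x with
        | zero => simp
        | add x x' hx hx' => simp only [map_add, hx, hx', LinearMap.add_apply]
        | tmul a b => simp [unit, Algebra.ofId_apply, smul_smul, mul_comm]
      rw [this]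
      simp
  coact_comm z := by
    change _ = LinearMap.rTensor H _ (tensorCoact X (unit k H) z)
    induction z with
    | zero => simp
    | add x x' hx hx' => simp only [map_add, hx, hx']
    | tmul m c =>
      rw [tensorCoact_tmul]
      simp only [LinearEquiv.coe_coe, rid_tmul, map_smul]
      generalize X.coact m = y
      change _ = LinearMap.rTensor H _ (mulOp k H M k y (c ⊗ₜ 1))
      induction y with
      | zero => simp
      | add x x' hx hx' => simp only [map_add, hx, hx', smul_add, LinearMap.add_apply]
      | tmul a b => simp [smul_tmul']

end hom
end YDStruct
end YD

section YD2
variable {k : Type u} [CommRing k] {H : Type v} [Ring H] [HopfAlgebra k H]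

namespace YDStruct

section braid

variable {M : Type*} [AddCommGroup M] [Module k M] {N : Type*} [AddCommGroup N] [Module k N]
  {M' : Type*} [AddCommGroup M'] [Module k M'] {N' : Type*} [AddCommGroup N'] [Module k N']
  {P : Type*} [AddCommGroup P] [Module k P]

/-- The map `m ⊗ n ↦ ∑ n₀ ⊗ n₁ · m`. -/
def braid (X : YDStruct k H M) (Y : YDStruct k H N) : M ⊗[k] N →ₗ[k] N ⊗[k] M :=
  TensorProduct.lift ((LinearMap.lTensorHom N ∘ₗ X.act.toLinearMap.flip).compl₂ Y.coact)

lemma braid_tmul (X : YDStruct k H M) (Y : YDStruct k H N) (m : M) (n : N) :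
    braid X Y (m ⊗ₜ n) = (X.act.toLinearMap.flip m).lTensor N (Y.coact n) := rfl

/-- The map `n ⊗ m ↦ ∑ S(n₁) · m ⊗ n₀`. -/
def braidInv (X : YDStruct k H M) (Y : YDStruct k H N) : N ⊗[k] M →ₗ[k] M ⊗[k] N :=
  (TensorProduct.comm k N M).toLinearMap ∘ₗ TensorProduct.lift (LinearMap.flip
    ((LinearMap.lTensorHom N ∘ₗ LinearMap.lcomp k M (antipode k) ∘ₗ
      X.act.toLinearMap.flip).compl₂ Y.coact))

lemma braidInv_tmul (X : YDStruct k H M) (Y : YDStruct k H N) (m : M) (n : N) :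
    braidInv X Y (n ⊗ₜ m) = TensorProduct.comm k N M
      ((X.act.toLinearMap.flip m ∘ₗ antipode k).lTensor N (Y.coact n)) := rfl

lemma lTensor_counit (X : YDStruct k H M) (m : M) (Y : YDStruct k H N) (n : N) :
    (X.act.toLinearMap.flip m ∘ₗ Algebra.linearMap k H ∘ₗ counit).lTensor N (Y.coact n) =
      n ⊗ₜ m := by
  conv_rhs => rw [← Y.counit_coact n]
  generalize Y.coact n = z
  induction z with
  | zero => simp
  | add x x' hx hx' => simp only [map_add, hx, hx', add_tmul]
  | tmul a b => simp [smul_tmul', Algebra.algebraMap_eq_smul_one]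

lemma braid_braidInv (X : YDStruct k H M) (Y : YDStruct k H N) :
    braid X Y ∘ₗ braidInv X Y = LinearMap.id := by
  ext n m
  have key : ∀ z : N ⊗[k] H, braid X Y (TensorProduct.comm k N M
      ((X.act.toLinearMap.flip m ∘ₗ antipode k).lTensor N z)) =
      (X.act.toLinearMap.flip m ∘ₗ LinearMap.mul' k H ∘ₗ (antipode k).lTensor H).lTensor N
        (TensorProduct.assoc k N H H (Y.coact.rTensor H z)) := by
    intro z
    induction z with
    | zero => simp
    | add x x' hx hx' => simp only [map_add, hx, hx']
    | tmul a b =>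
      simp only [LinearMap.lTensor_tmul, comm_tmul, braid_tmul, LinearMap.rTensor_tmul]
      generalize Y.coact a = z
      induction z with
      | zero => simp
      | add x x' hx hx' => simp only [map_add, hx, hx', add_tmul]
      | tmul a b => simp
  simp only [AlgebraTensorModule.curry_apply, curry_apply, LinearMap.coe_restrictScalars,
    LinearMap.comp_apply, LinearMap.id_apply]
  rw [braidInv_tmul, key, Y.coassoc, ← LinearMap.lTensor_comp_apply, LinearMap.comp_assoc,
    LinearMap.comp_assoc, mul_antipode_lTensor_comul, lTensor_counit]

lemma braidInv_braid (X : YDStruct k H M) (Y : YDStruct k H N) :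
    braidInv X Y ∘ₗ braid X Y = LinearMap.id := by
  ext m n
  have key : ∀ z : N ⊗[k] H, braidInv X Y ((X.act.toLinearMap.flip m).lTensor N z) =
      TensorProduct.comm k N M
      ((X.act.toLinearMap.flip m ∘ₗ LinearMap.mul' k H ∘ₗ (antipode k).rTensor H).lTensor N
        (TensorProduct.assoc k N H H (Y.coact.rTensor H z))) := by
    intro z
    induction z with
    | zero => simp
    | add x x' hx hx' => simp only [map_add, hx, hx']
    | tmul a b =>
      simp only [LinearMap.lTensor_tmul, braidInv_tmul, LinearMap.rTensor_tmul]
      generalize Y.coact a = z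
      induction z with
      | zero => simp
      | add x x' hx hx' => simp only [map_add, hx, hx', add_tmul]
      | tmul a b => simp
  simp only [AlgebraTensorModule.curry_apply, curry_apply, LinearMap.coe_restrictScalars,
    LinearMap.comp_apply, LinearMap.id_apply]
  rw [braid_tmul, key, Y.coassoc, ← LinearMap.lTensor_comp_apply, LinearMap.comp_assoc,
    LinearMap.comp_assoc, mul_antipode_rTensor_comul, lTensor_counit, comm_tmul]

/-- The braiding as a linear isomorphism. -/
def braidEquiv (X : YDStruct k H M) (Y : YDStruct k H N) : M ⊗[k] N ≃ₗ[k] N ⊗[k] M :=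
  LinearEquiv.ofLinearMap (braid X Y) (braidInv X Y) (braid_braidInv X Y) (braidInv_braid X Y)

lemma braidEquiv_toLinearMap (X : YDStruct k H M) (Y : YDStruct k H N) :
    (braidEquiv X Y).toLinearMap = braid X Y := rfl

lemma isHom_braid (X : YDStruct k H M) (Y : YDStruct k H N) :
    IsHom (X.tensor Y) (Y.tensor X) (braid X Y) where
  act_comm h z := by
    change braid X Y (tensorAct X Y h z) = tensorAct Y X h (braid X Y z)
    induction z with
    | zero => simp
    | add x x' hx hx' => simp only [map_add, hx, hx']
    | tmul m n =>
      have hl : ∀ x : H ⊗[k] H, braid X Y (tensorActAux X Y x (m ⊗ₜ n)) =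
          (X.act.toLinearMap.flip m).lTensor N (Y.cR n x) := by
        intro x
        induction x with
        | zero => simp
        | add x x' hx hx' => simp only [map_add, hx, hx', LinearMap.add_apply]
        | tmul a b =>
          rw [cR_tmul, tensorActAux_tmul, map_tmul, braid_tmul]
          generalize Y.coact _ = z
          induction z with
          | zero => simp
          | add x x' hx hx' => simp only [map_add, hx, hx']
          | tmul c d => simp
      have hr : ∀ x : H ⊗[k] H, tensorActAux Y X x (braid X Y (m ⊗ₜ n)) =
          (X.act.toLinearMap.flip m).lTensor N (Y.cL n x) := by
        intro x
        induction x with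
        | zero => simp
        | add x x' hx hx' => simp only [map_add, hx, hx', LinearMap.add_apply]
        | tmul a b =>
          rw [cL_tmul, tensorActAux_tmul, braid_tmul]
          generalize Y.coact _ = z
          induction z with
          | zero => simp
          | add x x' hx hx' => simp only [map_add, hx, hx']
          | tmul c d => simp
      rw [tensorAct_eq, tensorAct_eq, hl, hr, cL_eq_cR]
  coact_comm z := by
    change tensorCoact Y X (braid X Y z) = (braid X Y).rTensor H (tensorCoact X Y z)
    induction z with
    | zero => simp
    | add x x' hx hx' => simp only [map_add, hx, hx']
    | tmul m n =>
      have hl : ∀ z : N ⊗[k] H, tensorCoact Y X ((X.act.toLinearMap.flip m).lTensor N z) =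
          (TensorProduct.assoc k N M H).symm ((X.cR m).lTensor N
            (TensorProduct.assoc k N H H (Y.coact.rTensor H z))) := by
        intro z
        induction z with
        | zero => simp
        | add x x' hx hx' => simp only [map_add, hx, hx']
        | tmul a b =>
          simp only [LinearMap.lTensor_tmul, LinearMap.rTensor_tmul, tensorCoact_tmul]
          generalize Y.coact _ = z
          induction z with
          | zero => simp
          | add x x' hx hx' => simp only [map_add, hx, hx', add_tmul, LinearMap.add_apply]
          | tmul c d =>
            simp only [assoc_tmul, LinearMap.lTensor_tmul, cR_tmul, LinearMap.flip_apply,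
              AlgHom.toLinearMap_apply]
            generalize X.coact _ = z
            induction z with
            | zero => simp
            | add x x' hx hx' => simp only [map_add, hx, hx', tmul_add]
            | tmul c d => simp
      have hr : ∀ z : N ⊗[k] H, (braid X Y).rTensor H (mulOp k H M N (X.coact m) z) =
          (TensorProduct.assoc k N M H).symm ((X.cL m).lTensor N
            (TensorProduct.assoc k N H H (Y.coact.rTensor H z))) := by
        intro z
        induction z with
        | zero => simp
        | add x x' hx hx' => simp only [map_add, hx, hx']
        | tmul a b =>
          simp only [LinearMap.rTensor_tmul]
          rw [cL]
          generalize X.coact m = x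
          induction x with
          | zero => simp
          | add x x' hx hx' =>
            simp only [map_add, hx, hx', LinearMap.add_apply, LinearMap.lTensor_add]
          | tmul m g =>
          rw [mulOp_tmul, LinearMap.rTensor_tmul, braid_tmul]
          generalize Y.coact _ = z
          induction z with
          | zero => simp
          | add x x' hx hx' => simp only [map_add, hx, hx', add_tmul]
          | tmul c d => simp
      rw [tensorCoact_tmul, braid_tmul, hl, hr, Y.coassoc]
      congr 1
      generalize Y.coact n = z
      induction z with
      | zero => simp
      | add x x' hx hx' => simp only [map_add, hx, hx']
      | tmul a b => simp only [LinearMap.lTensor_tmul, cL_eq_cR]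

lemma braid_natural {X : YDStruct k H M} {X' : YDStruct k H M'} {Y : YDStruct k H N}
    {Y' : YDStruct k H N'} {f : M →ₗ[k] M'} {g : N →ₗ[k] N'} (hf : IsHom X X' f)
    (hg : IsHom Y Y' g) :
    braid X' Y' ∘ₗ TensorProduct.map f g = TensorProduct.map g f ∘ₗ braid X Y := by
  ext m n
  simp only [AlgebraTensorModule.curry_apply, curry_apply, LinearMap.coe_restrictScalars,
    LinearMap.comp_apply, map_tmul, braid_tmul, hg.coact_comm]
  generalize Y.coact n = z
  induction z with
  | zero => simp
  | add x x' hx hx' => simp only [map_add, hx, hx']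
  | tmul a b => simp [hf.act_comm]

lemma braid_hexagon_forward (X : YDStruct k H M) (Y : YDStruct k H N) (Z : YDStruct k H P) :
    (TensorProduct.assoc k N P M).toLinearMap ∘ₗ braid X (Y.tensor Z) ∘ₗ
      (TensorProduct.assoc k M N P).toLinearMap =
    (braid X Z).lTensor N ∘ₗ (TensorProduct.assoc k N M P).toLinearMap ∘ₗ
      (braid X Y).rTensor P := by
  refine TensorProduct.ext_threefold fun m n p => ?_
  simp only [LinearMap.comp_apply, LinearEquiv.coe_coe, assoc_tmul, LinearMap.rTensor_tmul,
    braid_tmul]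
  change TensorProduct.assoc k N P M (LinearMap.lTensor _ _ (tensorCoact Y Z _)) = _
  rw [tensorCoact_tmul]
  generalize Y.coact n = x
  induction x with
  | zero => simp
  | add x x' hx hx' => simp only [map_add, hx, hx', add_tmul, LinearMap.add_apply]
  | tmul a b =>
  simp only [LinearMap.lTensor_tmul, assoc_tmul, braid_tmul]
  generalize Z.coact p = x
  induction x with
  | zero => simp
  | add x x' hx hx' => simp only [map_add, hx, hx', tmul_add]
  | tmul a b => simp

lemma braid_hexagon_reverse (X : YDStruct k H M) (Y : YDStruct k H N) (Z : YDStruct k H P) :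
    (TensorProduct.assoc k P M N).symm.toLinearMap ∘ₗ braid (X.tensor Y) Z ∘ₗ
      (TensorProduct.assoc k M N P).symm.toLinearMap =
    (braid X Z).rTensor N ∘ₗ (TensorProduct.assoc k M P N).symm.toLinearMap ∘ₗ
      (braid Y Z).lTensor M := by
  apply LinearMap.cancel_right (TensorProduct.assoc k M N P).surjective |>.1
  refine TensorProduct.ext_threefold fun m n p => ?_
  simp only [LinearMap.comp_apply, LinearEquiv.coe_coe,
    assoc_tmul, LinearMap.lTensor_tmul, braid_tmul]
  have hl : ∀ z : P ⊗[k] H, (TensorProduct.assoc k P M N).symm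
      (((X.tensor Y).act.toLinearMap.flip (m ⊗ₜ n)).lTensor P z) =
      (TensorProduct.assoc k P M N).symm
        ((TensorProduct.map (X.act.toLinearMap.flip m) (Y.act.toLinearMap.flip n)).lTensor P
          (comul.lTensor P z)) := by
    intro z
    induction z with
    | zero => simp
    | add x x' hx hx' => simp only [map_add, hx, hx']
    | tmul a b =>
      simp only [LinearMap.lTensor_tmul]
      congr 2
      exact tensorAct_apply X Y b m n
  have hr : ∀ z : P ⊗[k] H, (braid X Z).rTensor N ((TensorProduct.assoc k M P N).symm
      (m ⊗ₜ (Y.act.toLinearMap.flip n).lTensor P z)) =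
      (TensorProduct.assoc k P M N).symm
        ((TensorProduct.map (X.act.toLinearMap.flip m) (Y.act.toLinearMap.flip n)).lTensor P
          (TensorProduct.assoc k P H H (Z.coact.rTensor H z))) := by
    intro z
    induction z with
    | zero => simp
    | add x x' hx hx' => simp only [map_add, hx, hx', tmul_add]
    | tmul a b =>
      simp only [LinearMap.lTensor_tmul, LinearMap.rTensor_tmul, assoc_symm_tmul, braid_tmul]
      generalize Z.coact _ = z
      induction z with
      | zero => simp
      | add x x' hx hx' => simp only [map_add, hx, hx', add_tmul]
      | tmul a b => simp
  rw [assoc_symm_tmul, braid_tmul, hl, hr, Z.coassoc]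

end braid
end YDStruct

variable (k H) in
/-- The objects of the category `YD(H)` of Yetter-Drinfel'd `H`-modules. -/
structure YDMod where
  /-- the underlying `k`-module -/
  carrier : Type u
  [addCommGroup : AddCommGroup carrier]
  [module : Module k carrier]
  /-- the action and the coaction -/
  str : YDStruct k H carrier

attribute [instance] YDMod.addCommGroup YDMod.module

namespace YDMod

open YDStruct

instance : CoeSort (YDMod k H) (Type u) := ⟨carrier⟩

/-- Morphisms are the linear maps that are `H`-linear and `H`-colinear. -/
@[ext]
structure Hom (M N : YDMod k H) where
  /-- the underlying linear map -/
  lin : M →ₗ[k] N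
  isHom : IsHom M.str N.str lin

instance : Category (YDMod k H) where
  Hom := Hom
  id M := ⟨LinearMap.id, isHom_id _⟩
  comp f g := ⟨g.lin ∘ₗ f.lin, g.isHom.comp f.isHom⟩

@[ext]
lemma hom_ext {M N : YDMod k H} {f g : M ⟶ N} (h : f.lin = g.lin) : f = g := Hom.ext h

@[simp]
lemma id_lin (M : YDMod k H) : Hom.lin (𝟙 M) = LinearMap.id := rfl

@[simp]
lemma comp_lin {M N P : YDMod k H} (f : M ⟶ N) (g : N ⟶ P) : (f ≫ g).lin = g.lin ∘ₗ f.lin := rfl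

/-- A bijective morphism is an isomorphism. -/
def isoMk {M N : YDMod k H} (e : M ≃ₗ[k] N) (he : IsHom M.str N.str e.toLinearMap) : M ≅ N where
  hom := ⟨e.toLinearMap, he⟩
  inv := ⟨e.symm.toLinearMap, he.symm⟩
  hom_inv_id := by ext; simp
  inv_hom_id := by ext; simp

/-- The tensor product of two objects. -/
def tensorObj (M N : YDMod k H) : YDMod k H := ⟨M ⊗[k] N, M.str.tensor N.str⟩

variable (k H) in
/-- The unit object `k`. -/
def unitObj : YDMod k H := ⟨k, YDStruct.unit k H⟩

/-- The tensor product of two morphisms. -/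
def tensorHom {M N M' N' : YDMod k H} (f : M ⟶ N) (g : M' ⟶ N') :
    tensorObj M M' ⟶ tensorObj N N' :=
  ⟨TensorProduct.map f.lin g.lin, f.isHom.tensor g.isHom⟩

instance : MonoidalCategoryStruct (YDMod k H) where
  tensorObj := tensorObj
  tensorHom := tensorHom
  whiskerLeft M _ _ f := tensorHom (𝟙 M) f
  whiskerRight f N := tensorHom f (𝟙 N)
  tensorUnit := unitObj k H
  associator M N P := isoMk (M := tensorObj (tensorObj M N) P) (N := tensorObj M (tensorObj N P))
    (TensorProduct.assoc k M N P) (isHom_assoc M.str N.str P.str)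
  leftUnitor M := isoMk (M := tensorObj (unitObj k H) M) (TensorProduct.lid k M) (isHom_lid M.str)
  rightUnitor M := isoMk (M := tensorObj M (unitObj k H)) (TensorProduct.rid k M) (isHom_rid M.str)

/-- The monoidal category `YD(H)`. -/
instance : MonoidalCategory (YDMod k H) :=
  MonoidalCategory.ofTensorHom
    (id_tensorHom_id := fun M N => hom_ext (TensorProduct.map_id))
    (tensorHom_comp_tensorHom := fun f g f' g' =>
      hom_ext (TensorProduct.map_comp _ _ _ _).symm)
    (associator_naturality := fun f g h => hom_ext (TensorProduct.ext_threefold fun _ _ _ => rfl))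
    (leftUnitor_naturality := fun {M N} f => hom_ext
      (TensorProduct.ext' fun (a : k) b => (f.lin.map_smul a b).symm))
    (rightUnitor_naturality := fun {M N} f => hom_ext
      (TensorProduct.ext' fun a (b : k) => (f.lin.map_smul b a).symm))
    (pentagon := fun M N P Q => hom_ext (TensorProduct.ext_fourfold fun _ _ _ _ => rfl))
    (triangle := fun M N => hom_ext (TensorProduct.ext_threefold fun a (b : k) c =>
      (TensorProduct.smul_tmul b a c).symm))

/-- The braided monoidal category `YD(H)`, with braiding `m ⊗ n ↦ ∑ n₀ ⊗ n₁ · m`. -/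
instance : BraidedCategory (YDMod k H) where
  braiding M N := isoMk (M := tensorObj M N) (N := tensorObj N M)
    (braidEquiv M.str N.str) (isHom_braid M.str N.str)
  braiding_naturality_right M {_ _} f := hom_ext (braid_natural (isHom_id M.str) f.isHom)
  braiding_naturality_left f M := hom_ext (braid_natural f.isHom (isHom_id M.str))
  hexagon_forward M N P := hom_ext (braid_hexagon_forward M.str N.str P.str)
  hexagon_reverse M N P := hom_ext (braid_hexagon_reverse M.str N.str P.str)

end YDMod
end YD2

section YD3

/-- The antipode of `H` is bijective. -/
class BijectiveAntipode (k : Type u) [CommRing k] (H : Type v) [Ring H] [HopfAlgebra k H] :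
    Prop where
  bijective : Function.Bijective (antipode k : H →ₗ[k] H)

variable {k : Type u} [CommRing k] {H : Type v} [Ring H] [HopfAlgebra k H]

instance [Module.Finite k H] [Module.Projective k H] [BijectiveAntipode k H] :
    BijectiveAntipode k (HopfDual k H) where
  bijective := by
    let e : H ≃ₗ[k] H := LinearEquiv.ofBijective _ (BijectiveAntipode.bijective (k := k))
    constructor
    · intro ξ η h
      ext a
      obtain ⟨b, rfl⟩ := e.surjective a
      exact congr($h b)
    · intro ξ
      refine ⟨(HopfDual.lin k H).symm (HopfDual.lin k H ξ ∘ₗ e.symm.toLinearMap), ?_⟩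
      ext a
      change HopfDual.lin k H ξ (e.symm (e a)) = _
      simp

variable (k H) in
/-- The inverse `S⁻¹` of the antipode. -/
def antipodeInv [BijectiveAntipode k H] : H →ₗ[k] H :=
  (LinearEquiv.ofBijective (antipode k) (BijectiveAntipode.bijective (k := k) (H := H))).symm

section
variable [BijectiveAntipode k H]

@[simp]
lemma antipode_antipodeInv (h : H) : antipode k (antipodeInv k H h) = h :=
  (LinearEquiv.ofBijective (antipode k)
    (BijectiveAntipode.bijective (k := k) (H := H))).apply_symm_apply h

lemma antipodeInv_mul_comul :
    TensorProduct.lift ((LinearMap.mul k H).flip.compl₁₂ LinearMap.id (antipodeInv k H)) ∘ₗ comul =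
      Algebra.linearMap k H ∘ₗ counit := by
  ext h
  apply (BijectiveAntipode.bijective (k := k) (H := H)).1
  have : ∀ x : H ⊗[k] H, antipode k (TensorProduct.lift
      ((LinearMap.mul k H).flip.compl₁₂ LinearMap.id (antipodeInv k H)) x) =
      LinearMap.mul' k H ((antipode k).rTensor H x) := by
    intro x
    induction x with
    | zero => simp
    | add x x' hx hx' => simp only [map_add, hx, hx']
    | tmul a b => simp [antipode_mul_antidistrib]
  simp only [LinearMap.comp_apply]
  rw [this, mul_antipode_rTensor_comul_apply]
  simp [Algebra.algebraMap_eq_smul_one]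

lemma mul_antipodeInv_comul :
    TensorProduct.lift ((LinearMap.mul k H).flip.compl₁₂ (antipodeInv k H) LinearMap.id) ∘ₗ comul =
      Algebra.linearMap k H ∘ₗ counit := by
  ext h
  apply (BijectiveAntipode.bijective (k := k) (H := H)).1
  have : ∀ x : H ⊗[k] H, antipode k (TensorProduct.lift
      ((LinearMap.mul k H).flip.compl₁₂ (antipodeInv k H) LinearMap.id) x) =
      LinearMap.mul' k H ((antipode k).lTensor H x) := by
    intro x
    induction x with
    | zero => simp
    | add x x' hx hx' => simp only [map_add, hx, hx']
    | tmul a b => simp [antipode_mul_antidistrib]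
  simp only [LinearMap.comp_apply]
  rw [this, mul_antipode_lTensor_comul_apply]
  simp [Algebra.algebraMap_eq_smul_one]

end

namespace YDStruct

section twist

variable {M : Type*} [AddCommGroup M] [Module k M] {Q : Type*} [AddCommGroup Q] [Module k Q]

/-- For `y : M → M ⊗ Q` and `ρ : H → End(Q)`, the map `m ↦ ∑ (id ⊗ ρ(m₁)) y(m₀)`. -/
def twist (X : YDStruct k H M) (ρ : H →ₗ[k] Module.End k Q) :
    (M →ₗ[k] M ⊗[k] Q) →ₗ[k] (M →ₗ[k] M ⊗[k] Q) where
  toFun y := TensorProduct.lift ((LinearMap.lTensorHom M ∘ₗ ρ).flip ∘ₗ y) ∘ₗ X.coact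
  map_add' y y' := by
    ext m
    simp only [LinearMap.comp_apply, LinearMap.add_apply]
    generalize X.coact m = z
    induction z with
    | zero => simp
    | add x x' hx hx' => simp only [map_add, hx, hx']; abel
    | tmul a b => simp
  map_smul' c y := by
    ext m
    simp only [LinearMap.comp_apply, LinearMap.smul_apply]
    generalize X.coact m = z
    induction z with
    | zero => simp
    | add x x' hx hx' => simp only [map_add, hx, hx', smul_add]
    | tmul a b => simp

lemma twist_apply (X : YDStruct k H M) (ρ : H →ₗ[k] Module.End k Q) (y : M →ₗ[k] M ⊗[k] Q)
    (m : M) : twist X ρ y m =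
      TensorProduct.lift ((LinearMap.lTensorHom M ∘ₗ ρ).flip ∘ₗ y) (X.coact m) := rfl

lemma twist_twist (X : YDStruct k H M) (ρ σ : H →ₗ[k] Module.End k Q) (y : M →ₗ[k] M ⊗[k] Q) :
    twist X σ (twist X ρ y) =
      twist X (TensorProduct.lift ((LinearMap.mul k (Module.End k Q)).flip.compl₁₂ ρ σ) ∘ₗ comul)
        y := by
  ext m
  rw [twist_apply, twist_apply]
  have hl : ∀ z : M ⊗[k] H,
      TensorProduct.lift ((LinearMap.lTensorHom M ∘ₗ σ).flip ∘ₗ (twist X ρ y)) z =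
      TensorProduct.lift ((LinearMap.lTensorHom M ∘ₗ (TensorProduct.lift
        ((LinearMap.mul k (Module.End k Q)).flip.compl₁₂ ρ σ))).flip ∘ₗ y)
        (TensorProduct.assoc k M H H (X.coact.rTensor H z)) := by
    intro z
    induction z with
    | zero => simp
    | add x x' hx hx' => simp only [map_add, hx, hx']
    | tmul a b =>
      simp only [lift.tmul, LinearMap.comp_apply, LinearMap.flip_apply, twist_apply,
        LinearMap.rTensor_tmul]
      generalize X.coact a = z
      induction z with
      | zero => simp
      | add x x' hx hx' => simp only [map_add, hx, hx', add_tmul]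
      | tmul c d =>
        simp only [lift.tmul, LinearMap.comp_apply, LinearMap.flip_apply, assoc_tmul,
          LinearMap.compl₁₂_apply, LinearMap.coe_lTensorHom, LinearMap.mul_apply']
        rw [← LinearMap.comp_apply, ← LinearMap.lTensor_comp]; rfl
  rw [hl, X.coassoc]
  generalize X.coact m = z
  induction z with
  | zero => simp
  | add x x' hx hx' => simp only [map_add, hx, hx']
  | tmul a b => simp

lemma twist_counit (X : YDStruct k H M) (y : M →ₗ[k] M ⊗[k] Q) :
    twist X (Algebra.linearMap k (Module.End k Q) ∘ₗ counit) y = y := by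
  ext m
  rw [twist_apply]
  conv_rhs => rw [← X.counit_coact m]
  generalize X.coact m = z
  induction z with
  | zero => simp
  | add x x' hx hx' => simp only [map_add, hx, hx']
  | tmul a b => simp [Algebra.algebraMap_eq_smul_one, LinearMap.lTensor_smul, Module.End.one_eq_id]

variable [BijectiveAntipode k H]

lemma twist_left_inv (X : YDStruct k H M) (ρ : H →ₐ[k] Module.End k Q) (y : M →ₗ[k] M ⊗[k] Q) :
    twist X (ρ.toLinearMap ∘ₗ antipodeInv k H) (twist X ρ.toLinearMap y) = y := by
  rw [twist_twist]
  convert twist_counit X y using 2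
  have : TensorProduct.lift ((LinearMap.mul k (Module.End k Q)).flip.compl₁₂ ρ.toLinearMap
      (ρ.toLinearMap ∘ₗ antipodeInv k H)) = ρ.toLinearMap ∘ₗ TensorProduct.lift
      ((LinearMap.mul k H).flip.compl₁₂ LinearMap.id (antipodeInv k H)) := by
    ext a b : 3
    simp
  rw [this, LinearMap.comp_assoc, antipodeInv_mul_comul]
  exact congrArg (twist X) (LinearMap.ext fun a => ρ.commutes _)

lemma twist_right_inv (X : YDStruct k H M) (ρ : H →ₐ[k] Module.End k Q) (y : M →ₗ[k] M ⊗[k] Q) :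
    twist X ρ.toLinearMap (twist X (ρ.toLinearMap ∘ₗ antipodeInv k H) y) = y := by
  rw [twist_twist]
  convert twist_counit X y using 2
  have : TensorProduct.lift ((LinearMap.mul k (Module.End k Q)).flip.compl₁₂
      (ρ.toLinearMap ∘ₗ antipodeInv k H) ρ.toLinearMap) = ρ.toLinearMap ∘ₗ TensorProduct.lift
      ((LinearMap.mul k H).flip.compl₁₂ (antipodeInv k H) LinearMap.id) := by
    ext a b : 3
    simp
  rw [this, LinearMap.comp_assoc, mul_antipodeInv_comul]
  exact congrArg (twist X) (LinearMap.ext fun a => ρ.commutes _)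

end twist

section End

variable {M : Type*} [AddCommGroup M] [Module k M]

/-- `a ⊗ b ↦ (f ↦ a ∘ f ∘ S(b))` -/
def endActAux (X : YDStruct k H M) : H ⊗[k] H →ₐ[k] Module.End k (Module.End k M) :=
  Algebra.TensorProduct.lift ((Algebra.lmul k (Module.End k M)).comp X.act)
    (AlgHom.ofLinearMap
      ((LinearMap.mul k (Module.End k M)).flip ∘ₗ X.act.toLinearMap ∘ₗ antipode k)
      (by ext; simp) (by intro a b; ext; simp [antipode_mul_antidistrib]))
    (fun a b => (commute_iff_eq _ _).2 (by ext; simp))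

@[simp]
lemma endActAux_tmul (X : YDStruct k H M) (a b : H) (f : Module.End k M) :
    endActAux X (a ⊗ₜ b) f = X.act a * f * X.act (antipode k b) := by
  rw [endActAux, Algebra.TensorProduct.lift_tmul]
  simp [mul_assoc]

/-- `(h · f)(m) = ∑ h₁ · f(S(h₂) · m)` -/
def endAct (X : YDStruct k H M) : H →ₐ[k] Module.End k (Module.End k M) :=
  (endActAux X).comp (Bialgebra.comulAlgHom k H)

variable [Module.Finite k M] [Module.Projective k M] [BijectiveAntipode k H]

/-- The coaction on `End(M)`: under the identification `End(M) ⊗ H = Hom(M, M ⊗ H)`,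
`χ(f)(m) = ∑ f(m₀)₀ ⊗ S⁻¹(m₁) f(m₀)₁`. -/
def endCoact (X : YDStruct k H M) : Module.End k M →ₗ[k] Module.End k M ⊗[k] H :=
  (rTensorHomEquivHomRTensor k M M H).symm.toLinearMap ∘ₗ
    twist X (LinearMap.mul k H ∘ₗ antipodeInv k H) ∘ₗ LinearMap.llcomp k M M (M ⊗[k] H) X.coact

/-- `Θ(f ⊗ q)(m) = ∑ f(m₀) ⊗ ρ(m₁) q` -/
def theta (X : YDStruct k H M) {Q : Type*} [AddCommGroup Q] [Module k Q]
    (ρ : H →ₐ[k] Module.End k Q) : Module.End k M ⊗[k] Q →ₗ[k] (M →ₗ[k] M ⊗[k] Q) :=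
  twist X ρ.toLinearMap ∘ₗ (rTensorHomEquivHomRTensor k M M Q).toLinearMap

lemma theta_injective (X : YDStruct k H M) {Q : Type*} [AddCommGroup Q] [Module k Q]
    (ρ : H →ₐ[k] Module.End k Q) : Function.Injective (theta X ρ) :=
  (Function.LeftInverse.injective (twist_left_inv X ρ)).comp
    (rTensorHomEquivHomRTensor k M M Q).injective

lemma theta_tmul (X : YDStruct k H M) {Q : Type*} [AddCommGroup Q] [Module k Q]
    (ρ : H →ₐ[k] Module.End k Q) (f : Module.End k M) (q : Q) (m : M) :
    theta X ρ (f ⊗ₜ q) m = TensorProduct.map f (ρ.toLinearMap.flip q) (X.coact m) := by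
  simp only [theta, LinearMap.comp_apply, LinearEquiv.coe_coe, twist_apply]
  generalize X.coact m = z
  induction z with
  | zero => simp
  | add x x' hx hx' => simp only [map_add, hx, hx']
  | tmul a b => simp

/-- left multiplication -/
abbrev lm (k : Type u) [CommRing k] (H : Type v) [Ring H] [HopfAlgebra k H] :
    H →ₐ[k] Module.End k H := Algebra.lmul k H

lemma theta_endCoact (X : YDStruct k H M) (f : Module.End k M) :
    theta X (lm k H) (endCoact X f) = X.coact ∘ₗ f := by
  simp only [theta, endCoact, LinearMap.comp_apply, LinearEquiv.coe_coe,
    LinearEquiv.apply_symm_apply]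
  exact twist_right_inv X (lm k H) _

/-- the diagonal left multiplication of `H` on `H ⊗ H` -/
abbrev lm2 (k : Type u) [CommRing k] (H : Type v) [Ring H] [HopfAlgebra k H] :
    H →ₐ[k] Module.End k (H ⊗[k] H) :=
  (Algebra.lmul k (H ⊗[k] H)).comp (Bialgebra.comulAlgHom k H)

lemma theta_comul (X : YDStruct k H M) (x : Module.End k M ⊗[k] H) (m : M) :
    theta X (lm2 k H) (comul.lTensor _ x) m = comul.lTensor M (theta X (lm k H) x m) := by
  induction x with
  | zero => simp
  | add x x' hx hx' => simp only [map_add, hx, hx', LinearMap.add_apply]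
  | tmul f g =>
    rw [LinearMap.lTensor_tmul, theta_tmul, theta_tmul]
    generalize X.coact m = z
    induction z with
    | zero => simp
    | add x x' hx hx' => simp only [map_add, hx, hx']
    | tmul a b => simp

lemma theta_assoc (X : YDStruct k H M) (z : Module.End k M ⊗[k] H) (g : H) (m : M) :
    theta X (lm2 k H) (TensorProduct.assoc k _ H H (z ⊗ₜ g)) m =
      TensorProduct.assoc k M H H
        (TensorProduct.map (theta X (lm k H) z) ((lm k H).toLinearMap.flip g) (X.coact m)) := by
  induction z with
  | zero => simp
  | add x x' hx hx' =>
    simp only [map_add, hx, hx', LinearMap.add_apply, add_tmul, TensorProduct.map_add_left]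
  | tmul f g0 =>
    rw [assoc_tmul, theta_tmul]
    have hl : ∀ z : M ⊗[k] H, TensorProduct.map f ((lm2 k H).toLinearMap.flip (g0 ⊗ₜ[k] g)) z =
        TensorProduct.map f (TensorProduct.map ((lm k H).toLinearMap.flip g0)
          ((lm k H).toLinearMap.flip g)) (comul.lTensor M z) := by
      intro z
      induction z with
      | zero => simp
      | add x x' hx hx' => simp only [map_add, hx, hx']
      | tmul a b =>
        simp only [map_tmul, LinearMap.lTensor_tmul, LinearMap.flip_apply,
          AlgHom.toLinearMap_apply, AlgHom.comp_apply, Bialgebra.comulAlgHom_apply]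
        congr 1
        generalize comul (R := k) b = z
        induction z with
        | zero => simp
        | add x x' hx hx' => simp only [map_add, hx, hx', LinearMap.add_apply]
        | tmul a b => simp
    have hr : ∀ z : M ⊗[k] H, TensorProduct.assoc k M H H
        (TensorProduct.map (theta X (lm k H) (f ⊗ₜ[k] g0)) ((lm k H).toLinearMap.flip g) z) =
        TensorProduct.map f (TensorProduct.map ((lm k H).toLinearMap.flip g0)
          ((lm k H).toLinearMap.flip g)) (TensorProduct.assoc k M H H (X.coact.rTensor H z)) := by
      intro z
      induction z with
      | zero => simp
      | add x x' hx hx' => simp only [map_add, hx, hx']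
      | tmul a b =>
        simp only [map_tmul, LinearMap.rTensor_tmul, theta_tmul]
        generalize X.coact a = z
        induction z with
        | zero => simp
        | add x x' hx hx' => simp only [map_add, hx, hx', add_tmul]
        | tmul a b => simp
    rw [hl, hr, X.coassoc]

lemma endCoact_coassoc (X : YDStruct k H M) (f : Module.End k M) :
    TensorProduct.assoc k _ H H ((endCoact X).rTensor H (endCoact X f)) =
      (comul (R := k) (A := H)).lTensor _ (endCoact X f) := by
  apply theta_injective X (lm2 k H)
  ext m
  have key : ∀ x : Module.End k M ⊗[k] H,
      theta X (lm2 k H) (TensorProduct.assoc k _ H H ((endCoact X).rTensor H x)) m =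
        TensorProduct.assoc k M H H (X.coact.rTensor H (theta X (lm k H) x m)) := by
    intro x
    induction x with
    | zero => simp
    | add x x' hx hx' => simp only [map_add, hx, hx', LinearMap.add_apply]
    | tmul f g =>
      rw [LinearMap.rTensor_tmul, theta_assoc, theta_endCoact, theta_tmul]
      congr 1
      generalize X.coact m = z
      induction z with
      | zero => simp
      | add x x' hx hx' => simp only [map_add, hx, hx']
      | tmul a b => simp
  rw [key, theta_comul, theta_endCoact, LinearMap.comp_apply, X.coassoc]

lemma endCoact_counit (X : YDStruct k H M) (f : Module.End k M) :
    TensorProduct.rid k _ ((counit (R := k) (A := H)).lTensor _ (endCoact X f)) = f := by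
  ext m
  have key : ∀ x : Module.End k M ⊗[k] H,
      (TensorProduct.rid k (Module.End k M) (counit.lTensor _ x)) m =
        TensorProduct.rid k M (counit.lTensor _ (theta X (lm k H) x m)) := by
    intro x
    induction x with
    | zero => simp
    | add x x' hx hx' => simp only [map_add, hx, hx', LinearMap.add_apply]
    | tmul f g =>
      rw [theta_tmul]
      conv_lhs => rw [← X.counit_coact m]
      generalize X.coact m = z
      induction z with
      | zero => simp
      | add x x' hx hx' => simp only [map_add, hx, hx']
      | tmul a b => simp [smul_smul, mul_comm]
  rw [key, theta_endCoact, LinearMap.comp_apply, X.counit_coact]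

end End

section cv

variable {M N P Q : Type*} [AddCommGroup M] [Module k M] [AddCommGroup N] [Module k N]
  [AddCommGroup P] [Module k P] [AddCommGroup Q] [Module k Q]

/-- `h ↦ ∑ A(h₁) ∘ σ(h₂)` -/
def cv (A : H →ₗ[k] N →ₗ[k] P) (σ : H →ₗ[k] M →ₗ[k] N) : H →ₗ[k] M →ₗ[k] P :=
  TensorProduct.lift ((LinearMap.llcomp k M N P).compl₁₂ A σ) ∘ₗ comul

lemma cv_apply (A : H →ₗ[k] N →ₗ[k] P) (σ : H →ₗ[k] M →ₗ[k] N) (h : H) :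
    cv A σ h = TensorProduct.lift ((LinearMap.llcomp k M N P).compl₁₂ A σ) (comul h) := rfl

lemma cv_assoc (A : H →ₗ[k] P →ₗ[k] Q) (σ : H →ₗ[k] N →ₗ[k] P) (τ : H →ₗ[k] M →ₗ[k] N) :
    cv (cv A σ) τ = cv A (cv σ τ) := by
  ext1 h
  have hl : ∀ x : H ⊗[k] H, TensorProduct.lift ((LinearMap.llcomp k M N Q).compl₁₂ (cv A σ) τ) x =
      TensorProduct.lift ((LinearMap.llcomp k M P Q).compl₁₂ A
        (TensorProduct.lift ((LinearMap.llcomp k M N P).compl₁₂ σ τ)))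
        (TensorProduct.assoc k H H H (comul.rTensor H x)) := by
    intro x
    induction x with
    | zero => simp
    | add x x' hx hx' => simp only [map_add, hx, hx']
    | tmul a b =>
      simp only [lift.tmul, LinearMap.compl₁₂_apply, LinearMap.rTensor_tmul, cv_apply]
      generalize comul (R := k) a = z
      induction z with
      | zero => simp
      | add x x' hx hx' => simp only [map_add, hx, hx', LinearMap.add_apply, add_tmul]
      | tmul a b => rfl
  have hr : ∀ x : H ⊗[k] H, TensorProduct.lift ((LinearMap.llcomp k M P Q).compl₁₂ A (cv σ τ)) x =
      TensorProduct.lift ((LinearMap.llcomp k M P Q).compl₁₂ A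
        (TensorProduct.lift ((LinearMap.llcomp k M N P).compl₁₂ σ τ)))
        (comul.lTensor H x) := by
    intro x
    induction x with
    | zero => simp
    | add x x' hx hx' => simp only [map_add, hx, hx']
    | tmul a b => rfl
  rw [cv_apply, cv_apply, hl, hr, coassoc_H]

variable (k H M) in
/-- `h ↦ ε(h) id` -/
abbrev cvOne : H →ₗ[k] M →ₗ[k] M := Algebra.linearMap k (Module.End k M) ∘ₗ counit

lemma cv_one (A : H →ₗ[k] M →ₗ[k] P) : cv A (cvOne k H M) = A := by
  ext1 h
  rw [cv_apply]
  conv_rhs => rw [show h = TensorProduct.rid k H (counit.lTensor H (comul h)) by simp]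
  generalize comul (R := k) h = z
  induction z with
  | zero => simp
  | add x x' hx hx' => simp only [map_add, hx, hx']
  | tmul a b => ext; simp

variable (X : YDStruct k H M)

/-- the action as a linear map -/
abbrev al : H →ₗ[k] M →ₗ[k] M := X.act.toLinearMap

/-- `h ↦ (S(h) · -)` -/
abbrev als : H →ₗ[k] M →ₗ[k] M := X.act.toLinearMap ∘ₗ antipode k

lemma cv_al_als : cv X.al X.als = cvOne k H M := by
  ext1 h
  rw [cv_apply]
  have : ∀ x : H ⊗[k] H, TensorProduct.lift ((LinearMap.llcomp k M M M).compl₁₂ X.al X.als) x =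
      X.act (LinearMap.mul' k H ((antipode k).lTensor H x)) := by
    intro x
    induction x with
    | zero => simp
    | add x x' hx hx' => simp only [map_add, hx, hx']
    | tmul a b => ext; simp
  rw [this, mul_antipode_lTensor_comul_apply]
  exact X.act.commutes _

lemma cv_als_al : cv X.als X.al = cvOne k H M := by
  ext1 h
  rw [cv_apply]
  have : ∀ x : H ⊗[k] H, TensorProduct.lift ((LinearMap.llcomp k M M M).compl₁₂ X.als X.al) x =
      X.act (LinearMap.mul' k H ((antipode k).rTensor H x)) := by
    intro x
    induction x with
    | zero => simp
    | add x x' hx hx' => simp only [map_add, hx, hx']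
    | tmul a b => ext; simp
  rw [this, mul_antipode_rTensor_comul_apply]
  exact X.act.commutes _

lemma cv_al_injective {A B : H →ₗ[k] M →ₗ[k] P} (h : cv A X.al = cv B X.al) : A = B := by
  rw [← cv_one A, ← cv_one B, ← cv_al_als X, ← cv_assoc, ← cv_assoc, h]

/-- `h ↦ h · f(-)` -/
def alf (f : Module.End k M) : H →ₗ[k] M →ₗ[k] M :=
  (LinearMap.llcomp k M M M).flip f ∘ₗ X.al

lemma cv_alf (A : H →ₗ[k] M →ₗ[k] P) (f : Module.End k M) :
    cv A (X.alf f) = (LinearMap.llcomp k M M P).flip f ∘ₗ cv A X.al := by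
  ext1 h
  rw [LinearMap.comp_apply, cv_apply, cv_apply]
  generalize comul (R := k) h = z
  induction z with
  | zero => simp
  | add x x' hx hx' => simp only [map_add, hx, hx']
  | tmul a b => rfl

lemma endAct_eq_cv (f : Module.End k M) :
    (endAct X).toLinearMap.flip f = cv (X.alf f) X.als := by
  ext1 h
  change endActAux X (comul h) f = _
  rw [cv_apply]
  generalize comul (R := k) h = z
  induction z with
  | zero => simp
  | add x x' hx hx' => simp only [map_add, hx, hx', LinearMap.add_apply]
  | tmul a b => ext; simp [alf]

lemma cv_endAct (f : Module.End k M) :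
    cv ((endAct X).toLinearMap.flip f) X.al = X.alf f := by
  rw [endAct_eq_cv, cv_assoc, cv_als_al, cv_one]

/-- `h ↦ (id ⊗ (- * h)) χ` -/
def beta : H →ₗ[k] M →ₗ[k] M ⊗[k] H :=
  (LinearMap.llcomp k M (M ⊗[k] H) (M ⊗[k] H)).flip X.coact ∘ₗ
    LinearMap.lTensorHom M ∘ₗ (LinearMap.mul k H).flip

lemma beta_apply (h : H) (m : M) :
    X.beta h m = (LinearMap.mulRight k h).lTensor M (X.coact m) := rfl

lemma cv_beta_al (h : H) (m : M) : cv X.beta X.al h m = X.cL m (comul h) := by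
  rw [cL_eq_cR, cv_apply]
  generalize comul (R := k) h = z
  induction z with
  | zero => simp
  | add x x' hx hx' => simp only [map_add, hx, hx', LinearMap.add_apply]
  | tmul a b => rfl

lemma cv_beta_endAct (h : H) (f : Module.End k M) [Module.Finite k M] [Module.Projective k M]
    [BijectiveAntipode k H] :
    theta X (lm k H) (TensorProduct.lift ((LinearMap.lTensorHom (Module.End k M) ∘ₗ
      (LinearMap.mul k H).flip).compl₂ (endCoact X ∘ₗ (endAct X).toLinearMap.flip f)) (comul h)) =
      cv X.beta ((endAct X).toLinearMap.flip f) h := by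
  rw [cv_apply]
  generalize comul (R := k) h = z
  induction z with
  | zero => simp
  | add x x' hx hx' => simp only [map_add, hx, hx']
  | tmul a b =>
    ext1 m
    change theta X (lm k H) ((LinearMap.mulRight k a).lTensor _ (endCoact X (endAct X b f))) m =
      (LinearMap.mulRight k a).lTensor M (X.coact (endAct X b f m))
    rw [← LinearMap.comp_apply X.coact, ← theta_endCoact]
    generalize endCoact X _ = z
    induction z with
    | zero => simp
    | add x x' hx hx' => simp only [map_add, hx, hx', LinearMap.add_apply]
    | tmul f g =>
      rw [LinearMap.lTensor_tmul, theta_tmul, theta_tmul]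
      generalize X.coact m = z
      induction z with
      | zero => simp
      | add x x' hx hx' => simp only [map_add, hx, hx']
      | tmul f g => simp [mul_assoc]

/-- `a ↦ (a · f) ⊗ (- * g)` -/
def gamma (f : Module.End k M) (g : H) : H →ₗ[k] (M ⊗[k] H) →ₗ[k] (M ⊗[k] H) :=
  (TensorProduct.mapBilinear (.id k) M H M H).flip (LinearMap.mulRight k g) ∘ₗ
    (endAct X).toLinearMap.flip f

lemma gamma_apply (f : Module.End k M) (g a : H) :
    X.gamma f g a = TensorProduct.map (endAct X a f) (LinearMap.mulRight k g) := rfl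

variable [Module.Finite k M] [Module.Projective k M] [BijectiveAntipode k H]

lemma theta_act (f : Module.End k M) (g h : H) :
    theta X (lm k H) (TensorProduct.map₂ (endAct X).toLinearMap (LinearMap.mul k H)
      (comul h) (f ⊗ₜ g)) = cv (X.gamma f g) X.beta h := by
  rw [cv_apply]
  generalize comul (R := k) h = z
  induction z with
  | zero => simp
  | add x x' hx hx' => simp only [map_add, hx, hx', LinearMap.add_apply]
  | tmul a b =>
    ext1 m
    change theta X (lm k H) (endAct X a f ⊗ₜ (b * g)) m =
      TensorProduct.map (endAct X a f) (LinearMap.mulRight k g)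
        ((LinearMap.mulRight k b).lTensor M (X.coact m))
    rw [theta_tmul]
    generalize X.coact m = z
    induction z with
    | zero => simp
    | add x x' hx hx' => simp only [map_add, hx, hx']
    | tmul f g => simp [mul_assoc]

lemma theta_act_al (f : Module.End k M) (g h : H) (m : M) :
    cv (cv (X.gamma f g) X.beta) X.al h m =
      TensorProduct.map₂ X.al (LinearMap.mul k H) (comul h) (theta X (lm k H) (f ⊗ₜ g) m) := by
  rw [cv_assoc, cv_apply]
  -- `Ω ((a ⊗ b) ⊗ c) = ((a · f) (b · -) ⊗ c - g) χ(m)`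
  let Ω : H ⊗[k] (H ⊗[k] H) →ₗ[k] M ⊗[k] H :=
    TensorProduct.lift ((X.gamma f g).compl₂ (X.cL m))
  have h1 : ∀ x : H ⊗[k] H, TensorProduct.lift ((LinearMap.llcomp k M (M ⊗[k] H)
      (M ⊗[k] H)).compl₁₂ (X.gamma f g) (cv X.beta X.al)) x m = Ω (comul.lTensor H x) := by
    intro x
    induction x with
    | zero => simp
    | add x x' hx hx' => simp only [map_add, hx, hx', LinearMap.add_apply]
    | tmul a b =>
      change X.gamma f g a (cv X.beta X.al b m) = _
      rw [cv_beta_al]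
      rfl
  have h2 : ∀ x : H ⊗[k] H, Ω (TensorProduct.assoc k H H H (comul.rTensor H x)) =
      TensorProduct.map₂ X.al (LinearMap.mul k H) x (theta X (lm k H) (f ⊗ₜ g) m) := by
    intro x
    rw [theta_tmul]
    induction x with
    | zero => simp
    | add x x' hx hx' => simp only [map_add, hx, hx', LinearMap.add_apply]
    | tmul a c =>
      have h3 : ∀ z : H ⊗[k] H, Ω (TensorProduct.assoc k H H H (z ⊗ₜ c)) =
          TensorProduct.map (TensorProduct.lift ((LinearMap.llcomp k M M M).compl₁₂
            ((endAct X).toLinearMap.flip f) X.al) z) (LinearMap.mulRight k g ∘ₗ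
              LinearMap.mulLeft k c) (X.coact m) := by
        intro z
        induction z with
        | zero => simp
        | add x x' hx hx' =>
          simp only [map_add, hx, hx', LinearMap.add_apply, add_tmul, TensorProduct.map_add_left]
        | tmul a b =>
          change X.gamma f g a (X.cL m (b ⊗ₜ c)) = _
          rw [cL_tmul, gamma_apply, ← LinearMap.comp_apply, ← TensorProduct.map_comp]
          rfl
      rw [LinearMap.rTensor_tmul, h3, ← cv_apply, cv_endAct]
      generalize X.coact m = z
      induction z with
      | zero => simp
      | add x x' hx hx' => simp only [map_add, hx, hx']
      | tmul p q => simp [alf, mul_assoc]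
  rw [h1, ← coassoc_H, h2]

lemma end_compat (h : H) (f : Module.End k M) :
    TensorProduct.map₂ (endAct X).toLinearMap (LinearMap.mul k H) (comul (R := k) h)
      (endCoact X f) =
    TensorProduct.lift ((LinearMap.lTensorHom (Module.End k M) ∘ₗ
      (LinearMap.mul k H).flip).compl₂ (endCoact X ∘ₗ (endAct X).toLinearMap.flip f))
      (comul (R := k) h) := by
  apply theta_injective X (lm k H)
  rw [cv_beta_endAct]
  -- both sides as functions of `h`
  let A (x : Module.End k M ⊗[k] H) : H →ₗ[k] M →ₗ[k] M ⊗[k] H :=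
    theta X (lm k H) ∘ₗ (TensorProduct.map₂ (endAct X).toLinearMap (LinearMap.mul k H)).flip x ∘ₗ
      comul
  have hA : ∀ x h m, cv (A x) X.al h m =
      TensorProduct.map₂ X.al (LinearMap.mul k H) (comul h) (theta X (lm k H) x m) := by
    intro x h m
    induction x with
    | zero =>
      have : A 0 = 0 := by ext1; simp [A]
      rw [this, cv_apply]
      generalize comul (R := k) h = z
      induction z with
      | zero => simp
      | add x x' hx hx' => simp only [map_add, hx, hx', LinearMap.add_apply]
      | tmul p q => simp
    | add x x' hx hx' =>
      have : A (x + x') = A x + A x' := by ext1; simp [A]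
      rw [map_add, LinearMap.add_apply, map_add, ← hx, ← hx', this, cv_apply, cv_apply, cv_apply]
      generalize comul (R := k) h = z
      induction z with
      | zero => simp
      | add x x' hx hx' =>
        simp only [map_add, hx, hx', LinearMap.add_apply]; abel
      | tmul p q => simp
    | tmul f g =>
      have : A (f ⊗ₜ g) = cv (X.gamma f g) X.beta := by
        ext1 h; exact theta_act X f g h
      rw [this, theta_act_al]
  have : A (endCoact X f) = cv X.beta ((endAct X).toLinearMap.flip f) := by
    apply cv_al_injective X
    ext1 h
    ext1 m
    rw [hA, theta_endCoact, cv_assoc, cv_endAct, cv_alf]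
    exact (cv_beta_al X h (f m)).symm
  exact congr($this h)

/-- The Yetter-Drinfel'd module `End(M)`. -/
def endStr : YDStruct k H (Module.End k M) where
  act := endAct X
  coact := endCoact X
  coassoc := endCoact_coassoc X
  counit_coact := endCoact_counit X
  compat := end_compat X

lemma isHom_endMul : IsHom ((endStr X).tensor (endStr X)) (endStr X)
    (LinearMap.mul' k (Module.End k M)) where
  act_comm h z := by
    change LinearMap.mul' k _ (tensorAct (endStr X) (endStr X) h z) = endAct X h _
    induction z with
    | zero => simp
    | add x x' hx hx' => simp only [map_add, hx, hx']
    | tmul f g =>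
      have key : cv ((endAct X).toLinearMap.flip f) ((endAct X).toLinearMap.flip g) =
          (endAct X).toLinearMap.flip (f * g) := by
        apply cv_al_injective X
        rw [cv_assoc, cv_endAct, cv_alf, cv_endAct, cv_endAct]
        rfl
      have := congr($key h)
      rw [cv_apply] at this
      rw [tensorAct_apply, LinearMap.mul'_apply]
      refine Eq.trans ?_ this
      generalize comul (R := k) h = z
      induction z with
      | zero => simp
      | add x x' hx hx' => simp only [map_add, hx, hx']
      | tmul p q => rfl
  coact_comm z := by
    change endCoact X _ = (LinearMap.mul' k _).rTensor H (tensorCoact (endStr X) (endStr X) z)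
    induction z with
    | zero => simp
    | add x x' hx hx' => simp only [map_add, hx, hx']
    | tmul f g =>
      rw [tensorCoact_tmul, LinearMap.mul'_apply]
      change endCoact X (f * g) = (LinearMap.mul' k _).rTensor H
        (mulOp k H _ _ (endCoact X f) (endCoact X g))
      apply theta_injective X (lm k H)
      ext1 m
      have key : ∀ x y : Module.End k M ⊗[k] H, theta X (lm k H)
          ((LinearMap.mul' k _).rTensor H (mulOp k H _ _ x y)) m =
          TensorProduct.lift ((LinearMap.lTensorHom M ∘ₗ (LinearMap.mul k H)).flip ∘ₗ
            (rTensorHomEquivHomRTensor k M M H x)) (theta X (lm k H) y m) := by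
        intro x y
        induction y with
        | zero => simp
        | add x x' hx hx' => simp only [map_add, hx, hx', LinearMap.add_apply]
        | tmul p q =>
        induction x with
        | zero =>
          simp only [map_zero, LinearMap.zero_apply, LinearMap.comp_zero]
          generalize theta X (lm k H) _ m = w
          induction w with
          | zero => simp
          | add x x' hx hx' => simp only [map_add, ← hx, ← hx', add_zero]
          | tmul p q => simp
        | add x x' hx hx' =>
          simp only [map_add, hx, hx', LinearMap.add_apply, LinearMap.comp_add]
          generalize theta X (lm k H) _ m = w
          induction w with
          | zero => simp
          | add x x' hx hx' => simp only [map_add, ← hx, ← hx']; abel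
          | tmul p q => simp
        | tmul p' q' =>
          rw [mulOp_tmul, LinearMap.rTensor_tmul, theta_tmul, theta_tmul]
          generalize X.coact m = z
          induction z with
          | zero => simp
          | add x x' hx hx' => simp only [map_add, hx, hx']
          | tmul p q => simp [mul_assoc]
      rw [key, theta_endCoact, theta_endCoact]
      change _ = theta X (lm k H) (endCoact X f) (g m)
      rw [theta_endCoact]
      rfl

lemma isHom_endOne : IsHom (unit k H) (endStr X) (Algebra.linearMap k (Module.End k M)) where
  act_comm h c := by
    have h1 : (endAct X).toLinearMap.flip 1 = cvOne k H M := by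
      rw [endAct_eq_cv, ← cv_al_als X]
      rfl
    have h2 : endAct X h 1 = algebraMap k _ (counit (R := k) h) := congr($h1 h)
    change algebraMap k _ (algebraMap k (Module.End k k) (counit h) c) =
      endAct X h (algebraMap k _ c)
    rw [Algebra.algebraMap_eq_smul_one c, map_smul, h2]
    simp [Algebra.algebraMap_eq_smul_one, smul_smul, mul_comm]
  coact_comm c := by
    change endCoact X (algebraMap k _ c) = (Algebra.linearMap k _).rTensor H (c ⊗ₜ 1)
    apply theta_injective X (lm k H)
    ext1 m
    rw [theta_endCoact, LinearMap.rTensor_tmul, theta_tmul, LinearMap.comp_apply]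
    simp only [Algebra.linearMap_apply, Module.algebraMap_end_apply, map_smul]
    generalize X.coact m = z
    induction z with
    | zero => simp
    | add x x' hx hx' => simp only [map_add, hx, hx', smul_add]
    | tmul p q => simp [smul_tmul']

end cv
end YDStruct

namespace YDMod

open YDStruct

variable [BijectiveAntipode k H]

/-- The Yetter-Drinfel'd module algebra `End(M)`, with the composition as product. -/
def endAlg (M : YDMod k H) [Module.Finite k M] [Module.Projective k M] : Mon (YDMod k H) where
  X := ⟨Module.End k M, M.str.endStr⟩
  mon :=
    { one := ⟨Algebra.linearMap k (Module.End k M), isHom_endOne M.str⟩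
      mul := ⟨LinearMap.mul' k (Module.End k M), isHom_endMul M.str⟩
      one_mul := hom_ext (TensorProduct.ext' fun (a : k) (f : Module.End k M) =>
        (Algebra.smul_def a f).symm)
      mul_one := hom_ext (TensorProduct.ext' fun (f : Module.End k M) (a : k) => by
        change f * algebraMap k _ a = a • f
        rw [← Algebra.commutes, Algebra.smul_def])
      mul_assoc := hom_ext (TensorProduct.ext_threefold
        fun (f g h : Module.End k M) => mul_assoc f g h) }

end YDMod
end YD3

section YD4

variable {k : Type u} [CommRing k] {H : Type v} [Ring H] [HopfAlgebra k H]

namespace HopfDual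

section
variable {X : Type*} [AddCommGroup X] [Module k X]

/-- Evaluation of the last tensor factor at `a`: the map `id ⊗ ⟨-, a⟩`. -/
def evalR (a : H) : X ⊗[k] HopfDual k H →ₗ[k] X :=
  TensorProduct.rid k X ∘ₗ (LinearMap.applyₗ a ∘ₗ (lin k H).toLinearMap).lTensor X

@[simp]
lemma evalR_tmul (a : H) (x : X) (ξ : HopfDual k H) : evalR a (x ⊗ₜ[k] ξ) = ξ a • x := by
  simp [evalR]

lemma evalR_rTensor {Y : Type*} [AddCommGroup Y] [Module k Y] (f : X →ₗ[k] Y) (a : H)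
    (z : X ⊗[k] HopfDual k H) : evalR a (f.rTensor _ z) = f (evalR a z) := by
  induction z with
  | zero => simp
  | add x x' hx hx' => simp only [map_add, hx, hx']
  | tmul p q => simp

variable [Module.Finite k H] [Module.Projective k H]

variable (k H X) in
/-- The canonical isomorphism `X ⊗ H^* ≃ Hom(H, X)`. -/
def homEquiv : X ⊗[k] HopfDual k H ≃ₗ[k] (H →ₗ[k] X) :=
  TensorProduct.comm k X (HopfDual k H) ≪≫ₗ
    TensorProduct.congr (lin k H) (LinearEquiv.refl k X) ≪≫ₗ dualTensorHomEquiv k H X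

lemma homEquiv_apply (z : X ⊗[k] HopfDual k H) (a : H) : homEquiv k H X z a = evalR a z := by
  induction z with
  | zero => simp
  | add x y hx hy => simp [hx, hy]
  | tmul x ξ => simp [homEquiv, dualTensorHomEquiv]

lemma evalR_ext {x y : X ⊗[k] HopfDual k H} (h : ∀ a : H, evalR a x = evalR a y) : x = y := by
  apply (homEquiv k H X).injective
  ext a
  rw [homEquiv_apply, homEquiv_apply, h]

end
end HopfDual

namespace YDStruct

open HopfDual

section dual

variable {M : Type*} [AddCommGroup M] [Module k M] {N : Type*} [AddCommGroup N] [Module k N]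

/-- `m ⊗ g ↦ ξ(g) m` -/
def slice (k : Type u) [CommRing k] (H : Type v) [Ring H] [HopfAlgebra k H]
    (M : Type*) [AddCommGroup M] [Module k M] : HopfDual k H →ₗ[k] M ⊗[k] H →ₗ[k] M :=
  LinearMap.llcomp k (M ⊗[k] H) (M ⊗[k] k) M (TensorProduct.rid k M).toLinearMap ∘ₗ
    LinearMap.lTensorHom M ∘ₗ (lin k H).toLinearMap

@[simp]
lemma slice_tmul (ξ : HopfDual k H) (m : M) (g : H) : slice k H M ξ (m ⊗ₜ g) = ξ g • m := by
  simp [slice]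

lemma slice_rTensor (f : M →ₗ[k] N) (ξ : HopfDual k H) (z : M ⊗[k] H) :
    slice k H N ξ (f.rTensor H z) = f (slice k H M ξ z) := by
  induction z with
  | zero => simp
  | add x x' hx hx' => simp only [map_add, hx, hx']
  | tmul p q => simp

/-- The left `H^*`-action `ξ ⇀ m = ∑ ξ(m₁) m₀`. -/
def dualAct (X : YDStruct k H M) : HopfDual k H →ₐ[k] Module.End k M :=
  AlgHom.ofLinearMap ((LinearMap.llcomp k M (M ⊗[k] H) M).flip X.coact ∘ₗ slice k H M)
    (by
      ext m
      change slice k H M 1 (X.coact m) = m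
      conv_rhs => rw [← X.counit_coact m]
      rfl)
    (by
      intro ξ η
      ext m
      change slice k H M (ξ * η) (X.coact m) =
        slice k H M ξ (X.coact (slice k H M η (X.coact m)))
      have hl : ∀ z : M ⊗[k] H, slice k H M (ξ * η) z =
          TensorProduct.rid k M ((LinearMap.mul' k k ∘ₗ
            TensorProduct.map (lin k H ξ) (lin k H η)).lTensor M (comul.lTensor M z)) := by
        intro z
        induction z with
        | zero => simp
        | add x x' hx hx' => simp only [map_add, hx, hx']
        | tmul p q => simp [mul_apply]
      have hr : ∀ z : M ⊗[k] H, slice k H M ξ (X.coact (slice k H M η z)) =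
          TensorProduct.rid k M ((LinearMap.mul' k k ∘ₗ
            TensorProduct.map (lin k H ξ) (lin k H η)).lTensor M
            (TensorProduct.assoc k M H H (X.coact.rTensor H z))) := by
        intro z
        induction z with
        | zero => simp
        | add x x' hx hx' => simp only [map_add, hx, hx']
        | tmul p q =>
          simp only [slice_tmul, LinearMap.rTensor_tmul, map_smul]
          generalize X.coact p = z
          induction z with
          | zero => simp
          | add x x' hx hx' => simp only [map_add, hx, hx', add_tmul, smul_add]
          | tmul p q => simp [smul_smul, mul_comm]
      rw [hl, hr, X.coassoc])

lemma dualAct_apply (X : YDStruct k H M) (ξ : HopfDual k H) (m : M) :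
    dualAct X ξ m = slice k H M ξ (X.coact m) := rfl

variable [Module.Finite k H] [Module.Projective k H]

/-- The right `H^*`-coaction `ρ` determined by `(id ⊗ ⟨-, l⟩) ρ(m) = l · m` for all `l ∈ H`. -/
def dualCoact (X : YDStruct k H M) : M →ₗ[k] M ⊗[k] HopfDual k H :=
  (homEquiv k H M).symm.toLinearMap ∘ₗ X.act.toLinearMap.flip

@[simp]
lemma evalR_dualCoact (X : YDStruct k H M) (l : H) (m : M) :
    evalR l (dualCoact X m) = X.act l m := by
  rw [← homEquiv_apply, dualCoact, LinearMap.comp_apply, LinearEquiv.coe_coe,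
    LinearEquiv.apply_symm_apply]
  rfl

lemma dual_coassoc (X : YDStruct k H M) (m : M) :
    TensorProduct.assoc k M _ _ ((dualCoact X).rTensor (HopfDual k H) (dualCoact X m)) =
      (comul (R := k) (A := HopfDual k H)).lTensor M (dualCoact X m) := by
  apply (TensorProduct.assoc k M _ _).symm.injective
  apply evalR_ext
  intro b
  apply evalR_ext
  intro a
  have h1 : ∀ z : M ⊗[k] HopfDual k H, evalR a (evalR b ((TensorProduct.assoc k M _ _).symm
      ((comul (R := k) (A := HopfDual k H)).lTensor M z))) = evalR (a * b) z := by
    intro z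
    induction z with
    | zero => simp
    | add x x' hx hx' => simp only [map_add, hx, hx']
    | tmul p q =>
      rw [evalR_tmul, ← pairing_comul_tmul, LinearMap.lTensor_tmul]
      generalize comul (R := k) q = z
      induction z with
      | zero => simp
      | add x x' hx hx' => simp only [map_add, hx, hx', tmul_add, LinearMap.add_apply, add_smul]
      | tmul p q => simp [smul_smul, mul_comm]
  rw [h1, LinearEquiv.symm_apply_apply, evalR_rTensor, evalR_dualCoact, evalR_dualCoact,
    evalR_dualCoact, map_mul]
  rfl

lemma evalR_mul (l : H) (f : M →ₗ[k] N) (β : HopfDual k H) (z : M ⊗[k] HopfDual k H) :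
    evalR l (TensorProduct.map f (LinearMap.mulLeft k β) z) =
      f (TensorProduct.lid k M (TensorProduct.map (lin k H β) (homEquiv k H M z) (comul l))) := by
  induction z with
  | zero => simp
  | add x x' hx hx' =>
    simp only [map_add, hx, hx', TensorProduct.map_add_right, LinearMap.add_apply]
  | tmul p q =>
    simp only [map_tmul, evalR_tmul, LinearMap.mulLeft_apply, mul_apply]
    generalize comul (R := k) l = z
    induction z with
    | zero => simp
    | add x x' hx hx' => simp only [map_add, hx, hx', add_smul]
    | tmul a b => simp [homEquiv_apply, smul_smul, mul_comm]

lemma evalR_mul' (l : H) (α : HopfDual k H) (z : M ⊗[k] HopfDual k H) :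
    evalR l ((LinearMap.mulRight k α).lTensor M z) =
      TensorProduct.rid k M (TensorProduct.map (homEquiv k H M z) (lin k H α) (comul l)) := by
  induction z with
  | zero => simp
  | add x x' hx hx' =>
    simp only [map_add, hx, hx', TensorProduct.map_add_left, LinearMap.add_apply]
  | tmul p q =>
    simp only [LinearMap.lTensor_tmul, evalR_tmul, LinearMap.mulRight_apply, mul_apply]
    generalize comul (R := k) l = z
    induction z with
    | zero => simp
    | add x x' hx hx' => simp only [map_add, hx, hx', add_smul]
    | tmul a b => simp [homEquiv_apply, smul_smul, mul_comm]

lemma homEquiv_dualCoact (X : YDStruct k H M) (m : M) :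
    homEquiv k H M (dualCoact X m) = X.act.toLinearMap.flip m :=
  (homEquiv k H M).apply_symm_apply _

/-- `ξ ⊗ h ↦ ξ(h)` -/
abbrev dualEv (k : Type u) [CommRing k] (H : Type v) [Ring H] [HopfAlgebra k H] :
    HopfDual k H →ₗ[k] H →ₗ[k] k := (lin k H).toLinearMap

/-- `ξ ⊗ h ↦ ξ ⇀ (h · m)` -/
abbrev dualP (X : YDStruct k H M) (m : M) : HopfDual k H →ₗ[k] H →ₗ[k] M :=
  ((dualAct X).toLinearMap).compl₂ (X.act.toLinearMap.flip m)

/-- `ξ ⊗ h ↦ h · (ξ ⇀ m)` -/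
abbrev dualQ (X : YDStruct k H M) (m : M) : HopfDual k H →ₗ[k] H →ₗ[k] M :=
  (X.act.toLinearMap.compl₂ ((dualAct X).toLinearMap.flip m)).flip

lemma dual_compat_left1 (X : YDStruct k H M) (m : M) (l : H)
    (x : HopfDual k H ⊗[k] HopfDual k H) :
    evalR l (TensorProduct.map₂ (dualAct X).toLinearMap (LinearMap.mul k (HopfDual k H)) x
        (dualCoact X m)) = TensorProduct.lid k M
      (TensorProduct.map₂ (dualEv k H) (dualP X m) (TensorProduct.comm k _ _ x) (comul l)) := by
  induction x with
  | zero => simp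
  | add x x' hx hx' => simp only [map_add, hx, hx', LinearMap.add_apply]
  | tmul α β =>
    change evalR l (TensorProduct.map (dualAct X α) (LinearMap.mulLeft k β) _) = _
    rw [evalR_mul, homEquiv_dualCoact]
    generalize comul (R := k) l = z
    induction z with
    | zero => simp
    | add x x' hx hx' => simp only [map_add, hx, hx']
    | tmul a b => simp

lemma dual_compat_left2 (X : YDStruct k H M) (m : M) (a b : H)
    (x : HopfDual k H ⊗[k] HopfDual k H) :
    TensorProduct.lid k M
      (TensorProduct.map₂ (dualEv k H) (dualP X m) (TensorProduct.comm k _ _ x) (a ⊗ₜ b)) =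
    TensorProduct.rid k M ((pairing k H x ∘ₗ (TensorProduct.mk k H H).flip a).lTensor M
      (X.coact (X.act b m))) := by
  induction x with
  | zero => simp
  | add x x' hx hx' =>
    simp only [map_add, hx, hx', LinearMap.add_apply, LinearMap.add_comp, LinearMap.lTensor_add]
  | tmul α β =>
    change TensorProduct.lid k M (β a ⊗ₜ slice k H M α (X.coact (X.act b m))) = _
    generalize X.coact _ = z
    induction z with
    | zero => simp
    | add x x' hx hx' => simp only [map_add, hx, hx', tmul_add]
    | tmul a b => simp [smul_smul]

lemma dual_compat_left3 (X : YDStruct k H M) (m : M) (ξ : HopfDual k H) (z : H ⊗[k] H) :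
    TensorProduct.lid k M
      (TensorProduct.map₂ (dualEv k H) (dualP X m) (TensorProduct.comm k _ _ (comul ξ)) z) =
    slice k H M ξ (X.cR m z) := by
  induction z with
  | zero => simp
  | add x x' hx hx' => simp only [map_add, hx, hx']
  | tmul a b =>
    rw [dual_compat_left2, cR_tmul, pairing_comul]
    generalize X.coact _ = z
    induction z with
    | zero => simp
    | add x x' hx hx' => simp only [map_add, hx, hx']
    | tmul a b => simp

lemma dual_compat_right1 (X : YDStruct k H M) (m : M) (l : H)
    (x : HopfDual k H ⊗[k] HopfDual k H) :
    evalR l (TensorProduct.lift ((LinearMap.lTensorHom M ∘ₗ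
        (LinearMap.mul k (HopfDual k H)).flip).compl₂
        (dualCoact X ∘ₗ (dualAct X).toLinearMap.flip m)) x) = TensorProduct.rid k M
      (TensorProduct.map₂ (dualQ X m) (dualEv k H) (TensorProduct.comm k _ _ x) (comul l)) := by
  induction x with
  | zero => simp
  | add x x' hx hx' => simp only [map_add, hx, hx', LinearMap.add_apply]
  | tmul α β =>
    change evalR l ((LinearMap.mulRight k α).lTensor M (dualCoact X (dualAct X β m))) = _
    rw [evalR_mul', homEquiv_dualCoact]
    generalize comul (R := k) l = z
    induction z with
    | zero => simp
    | add x x' hx hx' => simp only [map_add, hx, hx']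
    | tmul a b => simp

lemma dual_compat_right2 (X : YDStruct k H M) (m : M) (a b : H)
    (x : HopfDual k H ⊗[k] HopfDual k H) :
    TensorProduct.rid k M
      (TensorProduct.map₂ (dualQ X m) (dualEv k H) (TensorProduct.comm k _ _ x) (a ⊗ₜ b)) =
    TensorProduct.rid k M (TensorProduct.map (X.act a)
      (pairing k H x ∘ₗ TensorProduct.mk k H H b) (X.coact m)) := by
  induction x with
  | zero => simp
  | add x x' hx hx' =>
    simp only [map_add, hx, hx', LinearMap.add_apply, LinearMap.add_comp,
      TensorProduct.map_add_right]
  | tmul α β =>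
    change TensorProduct.rid k M (X.act a (slice k H M β (X.coact m)) ⊗ₜ α b) = _
    generalize X.coact _ = z
    induction z with
    | zero => simp
    | add x x' hx hx' => simp only [map_add, hx, hx', add_tmul]
    | tmul a b => simp [smul_smul]

lemma dual_compat_right3 (X : YDStruct k H M) (m : M) (ξ : HopfDual k H) (z : H ⊗[k] H) :
    TensorProduct.rid k M
      (TensorProduct.map₂ (dualQ X m) (dualEv k H) (TensorProduct.comm k _ _ (comul ξ)) z) =
    slice k H M ξ (X.cL m z) := by
  induction z with
  | zero => simp
  | add x x' hx hx' => simp only [map_add, hx, hx']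
  | tmul a b =>
    rw [dual_compat_right2, cL_tmul, pairing_comul]
    generalize X.coact _ = z
    induction z with
    | zero => simp
    | add x x' hx hx' => simp only [map_add, hx, hx']
    | tmul a b => simp

/-- The Yetter-Drinfel'd `H^*`-module structure on a Yetter-Drinfel'd `H`-module. -/
def dual (X : YDStruct k H M) : YDStruct k (HopfDual k H) M where
  act := dualAct X
  coact := dualCoact X
  coassoc := dual_coassoc X
  counit_coact m := by
    have : ∀ z : M ⊗[k] HopfDual k H, TensorProduct.rid k M (counit.lTensor M z) =
        evalR (1 : H) z := by
      intro z
      induction z with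
      | zero => simp
      | add x x' hx hx' => simp only [map_add, hx, hx']
      | tmul a b => simp
    rw [this, evalR_dualCoact, map_one]
    rfl
  compat ξ m := by
    apply evalR_ext
    intro l
    rw [dual_compat_left1, dual_compat_left3, dual_compat_right1, dual_compat_right3, cL_eq_cR]

lemma IsHom.dual {X : YDStruct k H M} {Y : YDStruct k H N} {f : M →ₗ[k] N} (hf : IsHom X Y f) :
    IsHom X.dual Y.dual f where
  act_comm ξ m := by
    change f (dualAct X ξ m) = dualAct Y ξ (f m)
    rw [dualAct_apply, dualAct_apply, hf.coact_comm, slice_rTensor]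
  coact_comm m := by
    change dualCoact Y (f m) = f.rTensor _ (dualCoact X m)
    apply evalR_ext
    intro l
    rw [evalR_rTensor, evalR_dualCoact, evalR_dualCoact, hf.act_comm]

/-- The flip `D(N) ⊗ D(M) → D(M ⊗ N)` is a morphism of Yetter-Drinfel'd `H^*`-modules. -/
lemma isHom_dualFlip (X : YDStruct k H M) (Y : YDStruct k H N) :
    IsHom (Y.dual.tensor X.dual) (X.tensor Y).dual (TensorProduct.comm k N M).toLinearMap where
  act_comm ξ z := by
    change TensorProduct.comm k N M (tensorAct Y.dual X.dual ξ z) =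
      dualAct (X.tensor Y) ξ (TensorProduct.comm k N M z)
    induction z with
    | zero => simp
    | add x x' hx hx' => simp only [map_add, hx, hx']
    | tmul n m =>
      rw [tensorAct_eq, dualAct_apply, comm_tmul]
      change _ = slice k H _ ξ (tensorCoact X Y (m ⊗ₜ n))
      rw [tensorCoact_tmul]
      have hl : ∀ x : HopfDual k H ⊗[k] HopfDual k H, TensorProduct.comm k N M
          (tensorActAux Y.dual X.dual x (n ⊗ₜ m)) =
          TensorProduct.rid k _ (TensorProduct.map₂ (TensorProduct.mk k M N)
            (TensorProduct.curry (pairing k H x)).flip (X.coact m) (Y.coact n)) := by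
        intro x
        induction x with
        | zero =>
          simp only [map_zero, LinearMap.zero_apply]
          generalize X.coact m = z
          induction z with
          | zero => simp
          | add x x' hx hx' => simp only [map_add, ← hx, ← hx', add_zero, LinearMap.add_apply]
          | tmul a b =>
          generalize Y.coact n = z
          induction z with
          | zero => simp
          | add x x' hx hx' => simp only [map_add, ← hx, ← hx', add_zero]
          | tmul a b => simp
        | add x x' hx hx' =>
          simp only [map_add, hx, hx', LinearMap.add_apply]
          clear hx hx'
          generalize X.coact m = z
          induction z with
          | zero => simp
          | add x x' hx hx' => simp only [map_add, ← hx, ← hx', LinearMap.add_apply]; abel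
          | tmul a b =>
          generalize Y.coact n = z
          induction z with
          | zero => simp
          | add x x' hx hx' => simp only [map_add, ← hx, ← hx']; abel
          | tmul a b => simp [tmul_add]
        | tmul α β =>
          change TensorProduct.comm k N M (dualAct Y α n ⊗ₜ dualAct X β m) = _
          rw [dualAct_apply, dualAct_apply]
          generalize X.coact m = z
          induction z with
          | zero => simp
          | add x x' hx hx' =>
            simp only [map_add, hx, hx', LinearMap.add_apply, tmul_add]
          | tmul a b =>
          generalize Y.coact n = z
          induction z with
          | zero => simp
          | add x x' hx hx' => simp only [map_add, hx, hx', add_tmul]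
          | tmul a b => simp [smul_tmul', smul_smul, mul_comm]
      rw [hl, mulOp]
      generalize X.coact m = z
      induction z with
      | zero => simp
      | add x x' hx hx' => simp only [map_add, hx, hx', LinearMap.add_apply]
      | tmul a b =>
      generalize Y.coact n = z
      induction z with
      | zero => simp
      | add x x' hx hx' => simp only [map_add, hx, hx']
      | tmul a b => simp
  coact_comm z := by
    change dualCoact (X.tensor Y) (TensorProduct.comm k N M z) =
      (TensorProduct.comm k N M).toLinearMap.rTensor _ (tensorCoact Y.dual X.dual z)
    apply evalR_ext
    intro l
    rw [evalR_dualCoact, evalR_rTensor]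
    induction z with
    | zero => simp
    | add x x' hx hx' => simp only [map_add, hx, hx']
    | tmul n m =>
      change tensorAct X Y l (m ⊗ₜ n) = TensorProduct.comm k N M _
      rw [tensorAct_apply, tensorCoact_tmul]
      change _ = TensorProduct.comm k N M (evalR l
        (mulOp k (HopfDual k H) N M (dualCoact Y n) (dualCoact X m)))
      have key : ∀ (y : N ⊗[k] HopfDual k H) (x : M ⊗[k] HopfDual k H),
          TensorProduct.comm k N M (evalR l (mulOp k (HopfDual k H) N M y x)) =
          TensorProduct.map (homEquiv k H M x) (homEquiv k H N y) (comul l) := by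
        intro y x
        induction x with
        | zero => simp
        | add x x' hx hx' =>
          simp only [map_add, hx, hx', LinearMap.add_apply, TensorProduct.map_add_left]
        | tmul p α =>
        induction y with
        | zero => simp
        | add x x' hx hx' =>
          simp only [map_add, hx, hx', LinearMap.add_apply, TensorProduct.map_add_right]
        | tmul q β =>
          rw [mulOp_tmul, evalR_tmul, mul_apply]
          generalize comul (R := k) l = z
          induction z with
          | zero => simp
          | add x x' hx hx' => simp only [map_add, ← hx, ← hx', add_smul]
          | tmul a b => simp [homEquiv_apply, smul_tmul', smul_smul, mul_comm]
      rw [key, homEquiv_dualCoact, homEquiv_dualCoact]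

lemma isHom_dualUnit :
    IsHom (unit k (HopfDual k H)) (unit k H).dual (LinearEquiv.refl k k).toLinearMap where
  act_comm ξ c := by
    change algebraMap k (Module.End k k) (ξ 1) c = slice k H k ξ (c ⊗ₜ 1)
    simp
  coact_comm c := by
    change dualCoact (unit k H) c = LinearMap.rTensor _ LinearMap.id (c ⊗ₜ 1)
    apply evalR_ext
    intro l
    rw [evalR_dualCoact, evalR_rTensor]
    change algebraMap k (Module.End k k) (counit l) c = _
    simp

end dual

end YDStruct

namespace YDMod

open YDStruct MonoidalCategory

section functor

variable (k H) [Module.Finite k H] [Module.Projective k H]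

/-- The functor `D` which sends `(M, ·, χ)` to `(M, ⇀, ρ)` and a morphism to itself, with values in
the category `YD(H^*)` with the reversed tensor product `M ⊗ᵒᵖ N = N ⊗ M`. -/
def dualFunctor : YDMod k H ⥤ (YDMod k (HopfDual k H))ᴹᵒᵖ where
  obj M := ⟨⟨M, M.str.dual⟩⟩
  map f := ⟨⟨f.lin, f.isHom.dual⟩⟩

/-- The structure of a monoidal functor on `D`, given by the flips
`D(M) ⊗ᵒᵖ D(N) = D(N) ⊗ D(M) → D(M ⊗ N)`. -/
def dualCoreMonoidal : (dualFunctor k H).CoreMonoidal where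
  εIso := (isoMk (M := unitObj k (HopfDual k H)) (N := ⟨k, (YDStruct.unit k H).dual⟩)
    (LinearEquiv.refl k k) isHom_dualUnit).mop
  μIso M N := (isoMk (M := tensorObj ⟨N, N.str.dual⟩ ⟨M, M.str.dual⟩)
    (N := ⟨M ⊗[k] N, (M.str.tensor N.str).dual⟩)
    (TensorProduct.comm k N M) (isHom_dualFlip M.str N.str)).mop
  μIso_hom_natural_left f M := Quiver.Hom.unmop_inj (hom_ext (TensorProduct.ext' fun _ _ => rfl))
  μIso_hom_natural_right M f := Quiver.Hom.unmop_inj (hom_ext (TensorProduct.ext' fun _ _ => rfl))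
  associativity M N P := Quiver.Hom.unmop_inj (hom_ext (by
    apply LinearMap.cancel_right (TensorProduct.assoc k P N M).surjective |>.1
    exact TensorProduct.ext_threefold fun _ _ _ => rfl))
  left_unitality M := Quiver.Hom.unmop_inj (hom_ext (TensorProduct.ext' fun _ (_ : k) => rfl))
  right_unitality M := Quiver.Hom.unmop_inj (hom_ext (TensorProduct.ext' fun (_ : k) _ => rfl))

instance : (dualFunctor k H).Monoidal := (dualCoreMonoidal k H).toMonoidal

variable {k H} in
/-- The `H^*`-module algebra `D(A)` of a Yetter-Drinfel'd `H`-module algebra `A`; its product is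
`D(m_A) ∘ τ`, i.e. the opposite of the product of `A`. -/
def dualAlg (A : Mon (YDMod k H)) : Mon (YDMod k (HopfDual k H)) :=
  (MonObj.mopEquiv _).inverse.obj ((dualFunctor k H).mapMon.obj A)

end functor

end YDMod

section Brauer

open YDStruct YDMod MonoidalCategory

/-- A `k`-module is faithfully projective (a progenerator) if it is finitely generated, projective
and `∑ f_j(m_j) = 1` for finitely many `m_j ∈ M` and `f_j ∈ M^*`. -/
class FaithfullyProjective (k : Type*) [CommRing k] (M : Type*) [AddCommGroup M] [Module k M] :
    Prop where
  finite : Module.Finite k M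
  projective : Module.Projective k M
  generator : ∃ (n : ℕ) (f : Fin n → Module.Dual k M) (m : Fin n → M), ∑ j, f j (m j) = 1

attribute [instance] FaithfullyProjective.finite FaithfullyProjective.projective

/-- The underlying linear map `A ⊗ A → A` of the product of a Yetter-Drinfel'd module algebra. -/
def YDMod.mulLin (A : Mon (YDMod k H)) : A.X ⊗[k] A.X →ₗ[k] A.X :=
  Hom.lin (MonObj.mul (X := A.X))

/-- The canonical map `F(a # b)(c) = ∑ a c₀ (c₁ · b)`, i.e. `m (a ⊗ m φ(b ⊗ c))`. -/
def YDMod.azF (A : Mon (YDMod k H)) : A.X ⊗[k] A.X →ₗ[k] Module.End k A.X :=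
  TensorProduct.curry (mulLin A ∘ₗ (mulLin A ∘ₗ braid A.X.str A.X.str).lTensor A.X ∘ₗ
    (TensorProduct.assoc k A.X A.X A.X).toLinearMap)

/-- The canonical map `G(a # b)(c) = ∑ a₀ (a₁ · c) b`, i.e. `m (m φ(c ⊗ a) ⊗ b)`. -/
def YDMod.azG (A : Mon (YDMod k H)) : A.X ⊗[k] A.X →ₗ[k] Module.End k A.X :=
  (TensorProduct.curry (mulLin A ∘ₗ (mulLin A ∘ₗ braid A.X.str A.X.str).rTensor A.X ∘ₗ
    (TensorProduct.assoc k A.X A.X A.X).symm.toLinearMap)).flip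

/-- A Yetter-Drinfel'd `H`-module algebra `A` is `H`-Azumaya if it is faithfully projective and the
canonical maps `F : A # Ā → End(A)` and `G : Ā # A → End(A)ᵒᵖ` are isomorphisms. -/
structure IsHAzumaya (A : Mon (YDMod k H)) : Prop where
  faithfullyProjective : FaithfullyProjective k A.X
  bijective_F : Function.Bijective (azF A)
  bijective_G : Function.Bijective (azG A)

variable (k H) in
/-- The `H`-Azumaya algebras. -/
abbrev AzumayaAlg := {A : Mon (YDMod k H) // IsHAzumaya A}

variable [BijectiveAntipode k H]

/-- `A ∼ B` if `A # End(M) ≃ B # End(N)` as Yetter-Drinfel'd module algebras for some faithfully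
projective Yetter-Drinfel'd modules `M` and `N`; the product `#` is the tensor product of
monoids in the braided category of Yetter-Drinfel'd modules. -/
def BrauerEquiv (A B : Mon (YDMod k H)) : Prop :=
  ∃ (M N : YDMod k H) (_ : FaithfullyProjective k M) (_ : FaithfullyProjective k N),
    Nonempty (A ⊗ M.endAlg ≅ B ⊗ N.endAlg)

variable (k H) in
/-- The set of equivalence classes of `H`-Azumaya algebras. -/
def BQ : Type (max (u + 1) v) := Quot fun A B : AzumayaAlg k H => BrauerEquiv A.1 B.1

/-- The class of an `H`-Azumaya algebra. -/
def BQ.mk (A : Mon (YDMod k H)) (hA : IsHAzumaya A) : BQ k H := Quot.mk _ ⟨A, hA⟩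

/-- `BQ(k, H)` is the Brauer group: `∼` is an equivalence relation on `H`-Azumaya algebras, `A # B`
is `H`-Azumaya if `A` and `B` are, and the group law is `[A][B] = [A # B]`. -/
structure IsBrauerGroup (G : Group (BQ k H)) : Prop where
  equivalence : Equivalence fun A B : AzumayaAlg k H => BrauerEquiv A.1 B.1
  mul_mk : ∀ (A B : Mon (YDMod k H)) (hA : IsHAzumaya A) (hB : IsHAzumaya B),
    ∃ hAB : IsHAzumaya (A ⊗ B), BQ.mk A hA * BQ.mk B hB = BQ.mk (A ⊗ B) hAB

end Brauer
end YD4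

end


noncomputable section

attribute [local instance] zeroHomClass_linearMap zeroHomClass_linearEquiv addHomClass_linearMap
  addHomClass_linearEquiv

section Ext

variable {k : Type u} [CommRing k] {H : Type v} [Ring H] [HopfAlgebra k H]
  {M : Type*} [AddCommGroup M] [Module k M]

lemma YDStruct.ext_act_coact {X Y : YDStruct k H M} (h₁ : ∀ h m, X.act h m = Y.act h m)
    (h₂ : ∀ m, X.coact m = Y.coact m) : X = Y := by
  obtain ⟨a, c, _, _, _⟩ := X
  obtain ⟨a', c', _, _, _⟩ := Y
  obtain rfl : a = a' := AlgHom.ext fun h => LinearMap.ext (h₁ h)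
  obtain rfl : c = c' := LinearMap.ext h₂
  rfl

end Ext

section Bidual

variable {k : Type u} [CommRing k] {H : Type v} [Ring H] [HopfAlgebra k H]
  [Module.Finite k H] [Module.Projective k H]

namespace HopfDual

variable (k H) in
/-- The canonical isomorphism `H ≃ H^{**}`. -/
def bidual : H ≃ₗ[k] HopfDual k (HopfDual k H) :=
  Module.evalEquiv k H ≪≫ₗ (lin k H).dualMap ≪≫ₗ (lin k (HopfDual k H)).symm

@[simp]
lemma bidual_apply (a : H) (ξ : HopfDual k H) : bidual k H a ξ = ξ a := rfl

lemma bidual_mul (a b : H) : bidual k H (a * b) = bidual k H a * bidual k H b := by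
  ext ξ
  rw [bidual_apply, ← pairing_comul_tmul, mul_apply]
  generalize comul (R := k) ξ = z
  induction z with
  | zero => simp
  | add x y hx hy => simp only [map_add, LinearMap.add_apply, hx, hy]
  | tmul α β => simp

lemma bidual_one : bidual k H 1 = 1 := by
  ext ξ
  simp

lemma pairing_map_bidual (z : H ⊗[k] H) (ξ η : HopfDual k H) :
    pairing k (HopfDual k H) (TensorProduct.map (bidual k H).toLinearMap
      (bidual k H).toLinearMap z) (ξ ⊗ₜ η) =
      LinearMap.mul' k k (TensorProduct.map (lin k H ξ) (lin k H η) z) := by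
  induction z with
  | zero => simp
  | add x y hx hy => simp only [map_add, LinearMap.add_apply, hx, hy]
  | tmul a b => simp

lemma comul_bidual (a : H) : comul (R := k) (bidual k H a) =
    TensorProduct.map (bidual k H).toLinearMap (bidual k H).toLinearMap (comul a) := by
  apply (pairing k (HopfDual k H)).injective
  ext ξ η
  simp only [AlgebraTensorModule.curry_apply, curry_apply, LinearMap.coe_restrictScalars]
  rw [pairing_comul_tmul, bidual_apply, mul_apply, pairing_map_bidual]

variable (k H) in
/-- `H → H^{**}` as an algebra map. -/
def bidualAlgHom : H →ₐ[k] HopfDual k (HopfDual k H) :=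
  AlgHom.ofLinearMap (bidual k H).toLinearMap bidual_one bidual_mul

lemma bidualAlgHom_apply (a : H) : bidualAlgHom k H a = bidual k H a := rfl

end HopfDual

namespace YDStruct

open HopfDual

variable {M : Type*} [AddCommGroup M] [Module k M] {N : Type*} [AddCommGroup N] [Module k N]

lemma evalR_lTensor_bidual (ξ : HopfDual k H) (z : M ⊗[k] H) :
    evalR ξ ((bidual k H).toLinearMap.lTensor M z) = slice k H M ξ z := by
  induction z with
  | zero => simp
  | add x y hx hy => simp only [map_add, hx, hy]
  | tmul m a => simp

lemma slice_lTensor_bidual_symm (ξ : HopfDual k H)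
    (z : M ⊗[k] HopfDual k (HopfDual k H)) :
    slice k H M ξ ((bidual k H).symm.toLinearMap.lTensor M z) = evalR ξ z := by
  rw [← evalR_lTensor_bidual, ← LinearMap.lTensor_comp_apply]
  simp

lemma slice_bidual (a : H) (z : M ⊗[k] HopfDual k H) :
    slice k (HopfDual k H) M (bidual k H a) z = evalR a z := by
  induction z with
  | zero => simp
  | add x y hx hy => simp only [map_add, hx, hy]
  | tmul m ξ => simp

lemma lTensor_bidual_injective : Function.Injective ((bidual k H).toLinearMap.lTensor M) := by
  apply Function.LeftInverse.injective (g := (bidual k H).symm.toLinearMap.lTensor M)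
  intro z
  rw [← LinearMap.lTensor_comp_apply]
  simp

/-- Elements of `M ⊗ H` are separated by the linear forms on `H`. -/
lemma slice_ext {x y : M ⊗[k] H} (h : ∀ ξ : HopfDual k H, slice k H M ξ x = slice k H M ξ y) :
    x = y := by
  apply lTensor_bidual_injective
  apply evalR_ext
  intro ξ
  rw [evalR_lTensor_bidual, evalR_lTensor_bidual, h]

lemma IsHom.of_dualAct {X : YDStruct k H M} {Y : YDStruct k H N} {f : M →ₗ[k] N}
    (h₁ : ∀ h m, f (X.act h m) = Y.act h (f m))
    (h₂ : ∀ ξ m, f (X.dual.act ξ m) = Y.dual.act ξ (f m)) : IsHom X Y f where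
  act_comm := h₁
  coact_comm m := by
    apply slice_ext
    intro ξ
    rw [slice_rTensor]
    exact (h₂ ξ m).symm

lemma IsHom.of_dual {X : YDStruct k H M} {Y : YDStruct k H N} {f : M →ₗ[k] N}
    (hf : IsHom X.dual Y.dual f) : IsHom X Y f := by
  refine .of_dualAct (fun h m => ?_) hf.act_comm
  have := congrArg (evalR h) (hf.coact_comm m)
  rw [evalR_rTensor] at this
  change evalR h (dualCoact Y (f m)) = f (evalR h (dualCoact X m)) at this
  rw [evalR_dualCoact, evalR_dualCoact] at this
  exact this.symm

lemma lTensor_bidual_symm (z : M ⊗[k] HopfDual k (HopfDual k H)) :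
    (bidual k H).toLinearMap.lTensor M ((bidual k H).symm.toLinearMap.lTensor M z) = z := by
  rw [← LinearMap.lTensor_comp_apply]
  simp

/-- Restriction of a Yetter-Drinfel'd `H^{**}`-module along `H ≃ H^{**}`. -/
def restrictBidual (X : YDStruct k (HopfDual k (HopfDual k H)) M) : YDStruct k H M where
  act := X.act.comp (bidualAlgHom k H)
  coact := (bidual k H).symm.toLinearMap.lTensor M ∘ₗ X.coact
  coassoc m := by
    have hinj : Function.Injective ((TensorProduct.map (bidual k H).toLinearMap
        (bidual k H).toLinearMap).lTensor M) := by
      apply Function.LeftInverse.injective (g := (TensorProduct.map (bidual k H).symm.toLinearMap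
        (bidual k H).symm.toLinearMap).lTensor M)
      intro z
      rw [← LinearMap.lTensor_comp_apply, ← TensorProduct.map_comp]
      simp
    apply hinj
    have h1 : ∀ z : M ⊗[k] H, (TensorProduct.map (bidual k H).toLinearMap
        (bidual k H).toLinearMap).lTensor M (comul.lTensor M z) =
        comul.lTensor M ((bidual k H).toLinearMap.lTensor M z) := by
      intro z
      induction z with
      | zero => simp
      | add x y hx hy => simp only [map_add, hx, hy]
      | tmul m a => simp [comul_bidual]
    have h2 : ∀ z : M ⊗[k] H, (TensorProduct.map (bidual k H).toLinearMap
        (bidual k H).toLinearMap).lTensor M (TensorProduct.assoc k M H H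
          (((bidual k H).symm.toLinearMap.lTensor M ∘ₗ X.coact).rTensor H z)) =
        TensorProduct.assoc k M _ _ (X.coact.rTensor _ ((bidual k H).toLinearMap.lTensor M z)) := by
      intro z
      induction z with
      | zero => simp
      | add x y hx hy => simp only [map_add, hx, hy]
      | tmul m a =>
        simp only [LinearMap.rTensor_tmul, LinearMap.lTensor_tmul, LinearMap.comp_apply]
        generalize X.coact m = w
        induction w with
        | zero => simp
        | add x y hx hy => simp only [map_add, hx, hy, add_tmul]
        | tmul m a => simp
    rw [h1, h2, LinearMap.comp_apply, lTensor_bidual_symm, X.coassoc]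
  counit_coact m := by
    conv_rhs => rw [← X.counit_coact m]
    rw [LinearMap.comp_apply]
    generalize X.coact m = w
    induction w with
    | zero => simp
    | add x y hx hy => simp only [map_add, hx, hy]
    | tmul m a =>
      obtain ⟨a, rfl⟩ := (bidual k H).surjective a
      simp
  compat h m := by
    apply lTensor_bidual_injective
    have h1 : ∀ (x : H ⊗[k] H) (z : M ⊗[k] H), (bidual k H).toLinearMap.lTensor M
        (TensorProduct.map₂ (X.act.comp (bidualAlgHom k H)).toLinearMap (LinearMap.mul k H) x z) =
        TensorProduct.map₂ X.act.toLinearMap (LinearMap.mul k _)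
          (TensorProduct.map (bidual k H).toLinearMap (bidual k H).toLinearMap x)
          ((bidual k H).toLinearMap.lTensor M z) := by
      intro x z
      induction x with
      | zero => simp
      | add x y hx hy => simp only [map_add, LinearMap.add_apply, hx, hy]
      | tmul a b =>
      induction z with
      | zero => simp
      | add x y hx hy => simp only [map_add, hx, hy]
      | tmul m g => simp [bidual_mul, bidualAlgHom_apply]
    have h2 : ∀ x : H ⊗[k] H, (bidual k H).toLinearMap.lTensor M
        (TensorProduct.lift ((LinearMap.lTensorHom M ∘ₗ (LinearMap.mul k H).flip).compl₂
        (((bidual k H).symm.toLinearMap.lTensor M ∘ₗ X.coact) ∘ₗ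
          (X.act.comp (bidualAlgHom k H)).toLinearMap.flip m)) x) =
        X.cR m (TensorProduct.map (bidual k H).toLinearMap (bidual k H).toLinearMap x) := by
      intro x
      induction x with
      | zero => simp
      | add x y hx hy => simp only [map_add, hx, hy]
      | tmul a b =>
        rw [map_tmul, cR_tmul]
        change (bidual k H).toLinearMap.lTensor M ((LinearMap.mulRight k a).lTensor M
          ((bidual k H).symm.toLinearMap.lTensor M (X.coact (X.act (bidual k H b) m)))) = _
        simp only [LinearEquiv.coe_coe]
        generalize X.coact _ = w
        induction w with
        | zero => simp
        | add x y hx hy => simp only [map_add, hx, hy]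
        | tmul m g => simp [bidual_mul]
    rw [h1, h2, LinearMap.comp_apply, lTensor_bidual_symm, ← comul_bidual]
    exact X.cL_eq_cR _ m

/-- The Yetter-Drinfel'd `H`-module structure with a given dual. -/
def undual (X : YDStruct k (HopfDual k H) M) : YDStruct k H M := restrictBidual X.dual

lemma dual_undual (X : YDStruct k (HopfDual k H) M) : X.undual.dual = X := by
  apply ext_act_coact
  · intro ξ m
    change slice k H M ξ ((bidual k H).symm.toLinearMap.lTensor M (dualCoact X m)) = _
    rw [slice_lTensor_bidual_symm, evalR_dualCoact]
  · intro m
    apply evalR_ext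
    intro a
    change evalR a (dualCoact X.undual m) = _
    rw [evalR_dualCoact]
    change dualAct X (bidual k H a) m = _
    rw [dualAct_apply, slice_bidual]

end YDStruct

end Bidual

end

noncomputable section

attribute [local instance] zeroHomClass_linearMap zeroHomClass_linearEquiv addHomClass_linearMap
  addHomClass_linearEquiv

section Calculus

variable {k : Type u} [CommRing k] {H : Type v} [Ring H] [HopfAlgebra k H]

namespace YDStruct

section OnFactors

variable {M N P Q : Type*} [AddCommGroup M] [Module k M] [AddCommGroup N] [Module k N]
  [AddCommGroup P] [Module k P] [AddCommGroup Q] [Module k Q]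

/-- `(n ⊗ m, p) ↦ n ⊗ T(m ⊗ p)` -/
def onR (T : M ⊗[k] P →ₗ[k] Q) : N ⊗[k] M →ₗ[k] P →ₗ[k] N ⊗[k] Q :=
  TensorProduct.curry (T.lTensor N ∘ₗ (TensorProduct.assoc k N M P).toLinearMap)

@[simp]
lemma onR_tmul (T : M ⊗[k] P →ₗ[k] Q) (n : N) (m : M) (p : P) :
    onR T (n ⊗ₜ m) p = n ⊗ₜ T (m ⊗ₜ p) := rfl

/-- `(p, m ⊗ n) ↦ T(p ⊗ m) ⊗ n` -/
def onL (T : P ⊗[k] M →ₗ[k] Q) : P →ₗ[k] M ⊗[k] N →ₗ[k] Q ⊗[k] N :=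
  TensorProduct.curry (T.rTensor N ∘ₗ (TensorProduct.assoc k P M N).symm.toLinearMap)

@[simp]
lemma onL_tmul (T : P ⊗[k] M →ₗ[k] Q) (p : P) (m : M) (n : N) :
    onL T p (m ⊗ₜ n) = T (p ⊗ₜ m) ⊗ₜ n := rfl

lemma rTensor_assoc_symm_tmul (T : P ⊗[k] M →ₗ[k] Q) (p : P) (w : M ⊗[k] N) :
    T.rTensor N ((TensorProduct.assoc k P M N).symm (p ⊗ₜ w)) = onL T p w := rfl

end OnFactors

section Hexagon

variable {M N P Q : Type*} [AddCommGroup M] [Module k M] [AddCommGroup N] [Module k N]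
  [AddCommGroup P] [Module k P] [AddCommGroup Q] [Module k Q]
  {M' N' : Type*} [AddCommGroup M'] [Module k M'] [AddCommGroup N'] [Module k N']
  {X : YDStruct k H M} {Y : YDStruct k H N} {Z : YDStruct k H P} {V : YDStruct k H Q}
  {X' : YDStruct k H M'} {Y' : YDStruct k H N'}

lemma braid_tensor_right (m : M) (n : N) (p : P) :
    braid X (Y.tensor Z) (m ⊗ₜ (n ⊗ₜ p)) =
      (TensorProduct.assoc k N P M).symm (onR (braid X Z) (braid X Y (m ⊗ₜ n)) p) := by
  rw [LinearEquiv.eq_symm_apply]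
  exact congr($(braid_hexagon_forward X Y Z) ((m ⊗ₜ n) ⊗ₜ p))

lemma braid_tensor_left (m : M) (n : N) (p : P) :
    braid (X.tensor Y) Z ((m ⊗ₜ n) ⊗ₜ p) =
      TensorProduct.assoc k P M N (onL (braid X Z) m (braid Y Z (n ⊗ₜ p))) := by
  rw [← LinearEquiv.symm_apply_eq]
  exact congr($(braid_hexagon_reverse X Y Z) (m ⊗ₜ (n ⊗ₜ p)))

lemma IsHom.braid_map {f : M →ₗ[k] M'} {g : N →ₗ[k] N'} (hf : IsHom X X' f) (hg : IsHom Y Y' g)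
    (m : M) (n : N) :
    braid X' Y' (f m ⊗ₜ g n) = TensorProduct.map g f (braid X Y (m ⊗ₜ n)) :=
  congr($(braid_natural hf hg) (m ⊗ₜ n))

lemma IsHom.braid_map_left {f : M →ₗ[k] M'} (hf : IsHom X X' f) (m : M) (n : N) :
    braid X' Y (f m ⊗ₜ n) = f.lTensor N (braid X Y (m ⊗ₜ n)) :=
  congr($(braid_natural hf (isHom_id Y)) (m ⊗ₜ n))

lemma IsHom.braid_map_right {g : N →ₗ[k] N'} (hg : IsHom Y Y' g) (m : M) (n : N) :
    braid X Y' (m ⊗ₜ g n) = g.rTensor M (braid X Y (m ⊗ₜ n)) :=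
  congr($(braid_natural (isHom_id X) hg) (m ⊗ₜ n))

/-- Naturality of the braiding in its second argument, for a morphism `T : Y ⊗ Z → V`. -/
lemma IsHom.braid_right {T : N ⊗[k] P →ₗ[k] Q} (hT : IsHom (Y.tensor Z) V T)
    (m : M) (n : N) (p : P) :
    braid X V (m ⊗ₜ T (n ⊗ₜ p)) = T.rTensor M
      ((TensorProduct.assoc k N P M).symm (onR (braid X Z) (braid X Y (m ⊗ₜ n)) p)) := by
  rw [hT.braid_map_right, braid_tensor_right]

/-- Naturality of the braiding in its first argument, for a morphism `T : X ⊗ Y → V`. -/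
lemma IsHom.braid_left {T : M ⊗[k] N →ₗ[k] Q} (hT : IsHom (X.tensor Y) V T)
    (m : M) (n : N) (p : P) :
    braid V Z (T (m ⊗ₜ n) ⊗ₜ p) = T.lTensor P
      (TensorProduct.assoc k P M N (onL (braid X Z) m (braid Y Z (n ⊗ₜ p)))) := by
  rw [hT.braid_map_left, braid_tensor_left]

lemma braid_tmul_smul_one {e : N} (he : IsHom (unit k H) Y (LinearMap.toSpanSingleton k N e))
    (m : M) : braid X Y (m ⊗ₜ e) = e ⊗ₜ m := by
  have h : Y.coact e = e ⊗ₜ 1 := by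
    have := he.coact_comm 1
    rw [LinearMap.toSpanSingleton_apply, one_smul] at this
    rw [this]
    change LinearMap.rTensor H _ ((1 : k) ⊗ₜ 1) = _
    simp
  rw [braid_tmul, h]
  simp

lemma braid_one_tmul {e : M} (he : IsHom (unit k H) X (LinearMap.toSpanSingleton k M e))
    (n : N) : braid X Y (e ⊗ₜ n) = n ⊗ₜ e := by
  have h : ∀ a, X.act a e = counit (R := k) a • e := by
    intro a
    have := he.act_comm a 1
    simp only [LinearMap.toSpanSingleton_apply, one_smul] at this
    rw [← this]
    change (algebraMap k (Module.End k k) (counit a) 1) • e = _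
    simp
  rw [braid_tmul]
  conv_rhs => rw [← Y.counit_coact n]
  generalize Y.coact n = w
  induction w with
  | zero => simp
  | add x y hx hy => simp only [map_add, hx, hy, add_tmul]
  | tmul a b => simp [h, smul_tmul']

lemma braid_bijective : Function.Bijective (braid X Y) := (braidEquiv X Y).bijective

end Hexagon

section RightConvolution

variable {M N P Q : Type*} [AddCommGroup M] [Module k M] [AddCommGroup N] [Module k N]
  [AddCommGroup P] [Module k P] [AddCommGroup Q] [Module k Q]

/-- `h ↦ ∑ A(h₂) ∘ σ(h₁)` -/
def cvr (A : H →ₗ[k] N →ₗ[k] P) (σ : H →ₗ[k] M →ₗ[k] N) : H →ₗ[k] M →ₗ[k] P :=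
  TensorProduct.lift ((LinearMap.llcomp k M N P).compl₁₂ A σ).flip ∘ₗ comul

lemma cvr_apply (A : H →ₗ[k] N →ₗ[k] P) (σ : H →ₗ[k] M →ₗ[k] N) (h : H) :
    cvr A σ h = TensorProduct.lift ((LinearMap.llcomp k M N P).compl₁₂ A σ).flip (comul h) := rfl

lemma cvr_assoc (A : H →ₗ[k] P →ₗ[k] Q) (σ : H →ₗ[k] N →ₗ[k] P) (τ : H →ₗ[k] M →ₗ[k] N) :
    cvr (cvr A σ) τ = cvr A (cvr σ τ) := by
  ext1 h
  let B : H ⊗[k] (H ⊗[k] H) →ₗ[k] M →ₗ[k] Q := TensorProduct.lift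
    (((LinearMap.llcomp k M N Q).compl₁₂ (TensorProduct.lift
      ((LinearMap.llcomp k N P Q).compl₁₂ A σ).flip) τ).flip)
  have hl : ∀ x : H ⊗[k] H, TensorProduct.lift
      ((LinearMap.llcomp k M N Q).compl₁₂ (cvr A σ) τ).flip x = B (comul.lTensor H x) := by
    intro x
    induction x with
    | zero => simp
    | add x x' hx hx' => simp only [map_add, hx, hx']
    | tmul a b => rfl
  have hr : ∀ x : H ⊗[k] H, TensorProduct.lift
      ((LinearMap.llcomp k M P Q).compl₁₂ A (cvr σ τ)).flip x =
      B (TensorProduct.assoc k H H H (comul.rTensor H x)) := by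
    intro x
    induction x with
    | zero => simp
    | add x x' hx hx' => simp only [map_add, hx, hx']
    | tmul a b =>
      simp only [lift.tmul, LinearMap.compl₁₂_apply, LinearMap.rTensor_tmul, cvr_apply,
        LinearMap.flip_apply]
      generalize comul (R := k) a = z
      induction z with
      | zero => simp
      | add x x' hx hx' => simp only [map_add, hx, hx', add_tmul]
      | tmul a b => rfl
  rw [cvr_apply, cvr_apply, hl, hr, coassoc_H]

lemma cvr_one (A : H →ₗ[k] M →ₗ[k] P) : cvr A (cvOne k H M) = A := by
  ext1 h
  rw [cvr_apply]
  conv_rhs => rw [show h = TensorProduct.lid k H (counit.rTensor H (comul h)) by simp]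
  generalize comul (R := k) h = z
  induction z with
  | zero => simp
  | add x x' hx hx' => simp only [map_add, hx, hx']
  | tmul a b => ext; simp

lemma cvr_al_antipodeInv [BijectiveAntipode k H] (X : YDStruct k H M) :
    cvr X.al (X.al ∘ₗ antipodeInv k H) = cvOne k H M := by
  ext1 h
  rw [cvr_apply]
  have : ∀ x : H ⊗[k] H, TensorProduct.lift ((LinearMap.llcomp k M M M).compl₁₂ X.al
      (X.al ∘ₗ antipodeInv k H)).flip x = X.act (TensorProduct.lift
      ((LinearMap.mul k H).flip.compl₁₂ (antipodeInv k H) LinearMap.id) x) := by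
    intro x
    induction x with
    | zero => simp
    | add x x' hx hx' => simp only [map_add, hx, hx']
    | tmul a b => ext; simp
  rw [this, ← LinearMap.comp_apply, mul_antipodeInv_comul]
  exact X.act.commutes _

end RightConvolution

section Universal

variable {M N P Q : Type*} [AddCommGroup M] [Module k M] [AddCommGroup N] [Module k N]
  [AddCommGroup P] [Module k P] [AddCommGroup Q] [Module k Q]
  {X : YDStruct k H M} {Y : YDStruct k H N} {Z : YDStruct k H P} {W : YDStruct k H Q}

/-- An `H`-linear map `T : Z ⊗ X → Y` satisfies `T(h z ⊗ m) = ∑ h₁ T(z ⊗ S(h₂) m)`. -/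
lemma act_left_eq {T : P ⊗[k] M →ₗ[k] N}
    (hT : ∀ h z, T ((Z.tensor X).act h z) = Y.act h (T z)) (z : P) (h : H) (m : M) :
    T (Z.act h z ⊗ₜ m) =
      cv ((LinearMap.llcomp k M N N).flip (TensorProduct.curry T z) ∘ₗ Y.al) X.als h m := by
  let A : H →ₗ[k] M →ₗ[k] N := TensorProduct.curry T ∘ₗ Z.act.toLinearMap.flip z
  have hA : cv A X.al = (LinearMap.llcomp k M N N).flip (TensorProduct.curry T z) ∘ₗ Y.al := by
    ext1 h
    ext1 m
    change _ = Y.act h (T (z ⊗ₜ m))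
    rw [← hT, cv_apply]
    change _ = T (tensorAct Z X h (z ⊗ₜ m))
    rw [tensorAct_apply]
    generalize comul (R := k) h = w
    induction w with
    | zero => simp
    | add x x' hx hx' => simp only [map_add, hx, hx', LinearMap.add_apply]
    | tmul a b => rfl
  rw [← hA, cv_assoc, cv_al_als, cv_one]
  rfl

/-- An `H`-linear map `T : X ⊗ Z → Y` satisfies `T(m ⊗ h z) = ∑ h₂ T(S⁻¹(h₁) m ⊗ z)`. -/
lemma act_right_eq [BijectiveAntipode k H] {T : M ⊗[k] P →ₗ[k] N}
    (hT : ∀ h z, T ((X.tensor Z).act h z) = Y.act h (T z)) (z : P) (h : H) (m : M) :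
    T (m ⊗ₜ Z.act h z) =
      cvr ((LinearMap.llcomp k M N N).flip ((TensorProduct.curry T).flip z) ∘ₗ Y.al)
        (X.al ∘ₗ antipodeInv k H) h m := by
  let A : H →ₗ[k] M →ₗ[k] N := (TensorProduct.curry T).flip ∘ₗ Z.act.toLinearMap.flip z
  have hA : cvr A X.al =
      (LinearMap.llcomp k M N N).flip ((TensorProduct.curry T).flip z) ∘ₗ Y.al := by
    ext1 h
    ext1 m
    change _ = Y.act h (T (m ⊗ₜ z))
    rw [← hT, cvr_apply]
    change _ = T (tensorAct X Z h (m ⊗ₜ z))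
    rw [tensorAct_apply]
    generalize comul (R := k) h = w
    induction w with
    | zero => simp
    | add x x' hx hx' => simp only [map_add, hx, hx', LinearMap.add_apply]
    | tmul a b => rfl
  rw [← hA, cvr_assoc, cvr_al_antipodeInv, cvr_one]
  rfl

lemma act_comm_of_pairing_left {S : Q ⊗[k] M →ₗ[k] N} {T : P ⊗[k] M →ₗ[k] N} {f : P →ₗ[k] Q}
    (hS : ∀ h z, S ((W.tensor X).act h z) = Y.act h (S z))
    (hT : ∀ h z, T ((Z.tensor X).act h z) = Y.act h (T z))
    (hinj : ∀ w w', (∀ m, S (w ⊗ₜ m) = S (w' ⊗ₜ m)) → w = w')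
    (hf : ∀ z m, S (f z ⊗ₜ m) = T (z ⊗ₜ m)) (h : H) (z : P) :
    f (Z.act h z) = W.act h (f z) := by
  apply hinj
  intro m
  have : TensorProduct.curry S (f z) = TensorProduct.curry T z := LinearMap.ext (hf z)
  rw [hf, act_left_eq hT, act_left_eq hS, this]

lemma act_comm_of_pairing_right [BijectiveAntipode k H]
    {S : M ⊗[k] Q →ₗ[k] N} {T : M ⊗[k] P →ₗ[k] N} {f : P →ₗ[k] Q}
    (hS : ∀ h z, S ((X.tensor W).act h z) = Y.act h (S z))
    (hT : ∀ h z, T ((X.tensor Z).act h z) = Y.act h (T z))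
    (hinj : ∀ w w', (∀ m, S (m ⊗ₜ w) = S (m ⊗ₜ w')) → w = w')
    (hf : ∀ z m, S (m ⊗ₜ f z) = T (m ⊗ₜ z)) (h : H) (z : P) :
    f (Z.act h z) = W.act h (f z) := by
  apply hinj
  intro m
  have : (TensorProduct.curry S).flip (f z) = (TensorProduct.curry T).flip z :=
    LinearMap.ext (hf z)
  rw [hf, act_right_eq hT, act_right_eq hS, this]

variable [Module.Finite k H] [Module.Projective k H]

lemma IsHom.dual_flip {T : M ⊗[k] P →ₗ[k] N} (hT : IsHom (X.tensor Z) Y T) :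
    IsHom (Z.dual.tensor X.dual) Y.dual (T ∘ₗ (TensorProduct.comm k P M).toLinearMap) :=
  hT.dual.comp (isHom_dualFlip X Z)

lemma IsHom.of_dual_flip {T : M ⊗[k] P →ₗ[k] N}
    (hT : IsHom (Z.dual.tensor X.dual) Y.dual (T ∘ₗ (TensorProduct.comm k P M).toLinearMap)) :
    IsHom (X.tensor Z) Y T := by
  apply IsHom.of_dual
  have h := hT.comp (isHom_dualFlip X Z).symm
  convert h using 1
  ext
  rfl

variable [BijectiveAntipode k H]

/-- A linear map `f : Z → W` is a morphism if it is compatible with morphisms `Z ⊗ X → Y` and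
`W ⊗ X → Y`, the second of which is nondegenerate. -/
lemma IsHom.of_pairing_left {S : Q ⊗[k] M →ₗ[k] N} {T : P ⊗[k] M →ₗ[k] N} {f : P →ₗ[k] Q}
    (hS : IsHom (W.tensor X) Y S) (hT : IsHom (Z.tensor X) Y T)
    (hinj : ∀ w w', (∀ m, S (w ⊗ₜ m) = S (w' ⊗ₜ m)) → w = w')
    (hf : ∀ z m, S (f z ⊗ₜ m) = T (z ⊗ₜ m)) : IsHom Z W f :=
  .of_dualAct (act_comm_of_pairing_left hS.act_comm hT.act_comm hinj hf)
    (act_comm_of_pairing_right hS.dual_flip.act_comm hT.dual_flip.act_comm hinj hf)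

/-- A linear map `f : Z → W` is a morphism if it is compatible with morphisms `X ⊗ Z → Y` and
`X ⊗ W → Y`, the second of which is nondegenerate. -/
lemma IsHom.of_pairing_right {S : M ⊗[k] Q →ₗ[k] N} {T : M ⊗[k] P →ₗ[k] N} {f : P →ₗ[k] Q}
    (hS : IsHom (X.tensor W) Y S) (hT : IsHom (X.tensor Z) Y T)
    (hinj : ∀ w w', (∀ m, S (m ⊗ₜ w) = S (m ⊗ₜ w')) → w = w')
    (hf : ∀ z m, S (m ⊗ₜ f z) = T (m ⊗ₜ z)) : IsHom Z W f :=
  .of_dualAct (act_comm_of_pairing_right hS.act_comm hT.act_comm hinj hf)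
    (act_comm_of_pairing_left hS.dual_flip.act_comm hT.dual_flip.act_comm hinj hf)

end Universal

section Evaluation

variable {M N : Type*} [AddCommGroup M] [Module k M] [AddCommGroup N] [Module k N]

variable (k M) in
/-- The evaluation `End(M) ⊗ M → M`. -/
def endEval : Module.End k M ⊗[k] M →ₗ[k] M := TensorProduct.lift LinearMap.id

@[simp]
lemma endEval_tmul (f : Module.End k M) (m : M) : endEval k M (f ⊗ₜ m) = f m := rfl

variable [Module.Finite k M] [Module.Projective k M] [BijectiveAntipode k H]

lemma isHom_endEval (X : YDStruct k H M) : IsHom (X.endStr.tensor X) X (endEval k M) where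
  act_comm h z := by
    change endEval k M (tensorAct X.endStr X h z) = _
    induction z with
    | zero => simp
    | add x x' hx hx' => simp only [map_add, hx, hx']
    | tmul f m =>
      have h1 := congr($(cv_endAct X f) h m)
      rw [cv_apply] at h1
      change _ = X.alf f h m
      rw [← h1, tensorAct_apply]
      generalize comul (R := k) h = w
      induction w with
      | zero => simp
      | add x x' hx hx' => simp only [map_add, hx, hx', LinearMap.add_apply]
      | tmul a b => rfl
  coact_comm z := by
    change _ = (endEval k M).rTensor H (tensorCoact X.endStr X z)
    induction z with
    | zero => simp
    | add x x' hx hx' => simp only [map_add, hx, hx']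
    | tmul f m =>
      rw [tensorCoact_tmul, endEval_tmul]
      have h1 := congr($(theta_endCoact X f) m)
      rw [LinearMap.comp_apply] at h1
      rw [← h1]
      change theta X (lm k H) (endCoact X f) m =
        (endEval k M).rTensor H (mulOp k H _ _ (endCoact X f) (X.coact m))
      generalize endCoact X f = w
      induction w with
      | zero => simp
      | add x x' hx hx' => simp only [map_add, hx, hx', LinearMap.add_apply]
      | tmul f g =>
        rw [theta_tmul]
        generalize X.coact m = w
        induction w with
        | zero => simp
        | add x x' hx hx' => simp only [map_add, hx, hx']
        | tmul a b => simp

variable [Module.Finite k H] [Module.Projective k H]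

/-- The linear map `Z → End(M)` given by a morphism `Z ⊗ M → M` is a morphism. -/
lemma IsHom.curry {X : YDStruct k H M} {Z : YDStruct k H N} {T : N ⊗[k] M →ₗ[k] M}
    (hT : IsHom (Z.tensor X) X T) : IsHom Z X.endStr (TensorProduct.curry T) :=
  .of_pairing_left (isHom_endEval X) hT (fun _ _ h => LinearMap.ext h) fun _ _ => rfl

end Evaluation

end YDStruct

end Calculus

end

noncomputable section

attribute [local instance] zeroHomClass_linearMap zeroHomClass_linearEquiv addHomClass_linearMap
  addHomClass_linearEquiv

section Algebras

variable {k : Type u} [CommRing k] {H : Type v} [Ring H] [HopfAlgebra k H]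

namespace YDMod

open YDStruct MonoidalCategory

/-- The unit element of a Yetter-Drinfel'd module algebra. -/
def oneEl (A : Mon (YDMod k H)) : A.X := Hom.lin (MonObj.one (X := A.X)) (1 : k)

lemma isHom_mulLin (A : Mon (YDMod k H)) :
    IsHom (A.X.str.tensor A.X.str) A.X.str (mulLin A) :=
  Hom.isHom (MonObj.mul (X := A.X))

lemma one_lin (A : Mon (YDMod k H)) :
    Hom.lin (MonObj.one (X := A.X)) = LinearMap.toSpanSingleton k A.X (oneEl A) := by
  refine LinearMap.ext_ring ?_
  rw [LinearMap.toSpanSingleton_apply, one_smul]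
  rfl

lemma isHom_oneEl (A : Mon (YDMod k H)) :
    IsHom (YDStruct.unit k H) A.X.str (LinearMap.toSpanSingleton k A.X (oneEl A)) := by
  rw [← one_lin]
  exact Hom.isHom (MonObj.one (X := A.X))

@[simp]
lemma oneEl_mulLin (A : Mon (YDMod k H)) (a : A.X) : mulLin A (oneEl A ⊗ₜ a) = a := by
  have h : mulLin A (oneEl A ⊗ₜ a) = (1 : k) • a :=
    congr(Hom.lin $(MonObj.one_mul A.X) ((1 : k) ⊗ₜ a))
  rw [h, one_smul]

@[simp]
lemma mulLin_oneEl (A : Mon (YDMod k H)) (a : A.X) : mulLin A (a ⊗ₜ oneEl A) = a := by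
  have h : mulLin A (a ⊗ₜ oneEl A) = (1 : k) • a :=
    congr(Hom.lin $(MonObj.mul_one A.X) (a ⊗ₜ (1 : k)))
  rw [h, one_smul]

lemma mulLin_assoc (A : Mon (YDMod k H)) (a b c : A.X) :
    mulLin A (mulLin A (a ⊗ₜ b) ⊗ₜ c) = mulLin A (a ⊗ₜ mulLin A (b ⊗ₜ c)) :=
  congr(Hom.lin $(MonObj.mul_assoc A.X) ((a ⊗ₜ b) ⊗ₜ c))

/-- The product of `A # B` as a map on `A ⊗ B`. -/
def smashMul (A B : Mon (YDMod k H)) :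
    (A.X ⊗[k] B.X) ⊗[k] (A.X ⊗[k] B.X) →ₗ[k] A.X ⊗[k] B.X := mulLin (A ⊗ B)

/-- `(a # b)(a' # b') = ∑ a a'₀ # (a'₁ · b) b'` -/
lemma smashMul_tmul (A B : Mon (YDMod k H)) (a a' : A.X) (b b' : B.X) :
    smashMul A B ((a ⊗ₜ b) ⊗ₜ (a' ⊗ₜ b')) =
      TensorProduct.map (TensorProduct.curry (mulLin A) a)
        ((TensorProduct.curry (mulLin B)).flip b') (braid B.X.str A.X.str (b ⊗ₜ a')) := by
  change TensorProduct.map (mulLin A) (mulLin B) ((TensorProduct.assoc k A.X A.X _).symm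
    ((TensorProduct.assoc k A.X B.X B.X).toLinearMap.lTensor A.X
    (a ⊗ₜ (braid B.X.str A.X.str (b ⊗ₜ a') ⊗ₜ b')))) = _
  generalize braid B.X.str A.X.str (b ⊗ₜ a') = w
  induction w with
  | zero => simp
  | add x y hx hy => simp only [map_add, hx, hy, add_tmul, tmul_add]
  | tmul x y => rfl

/-- A multiplicative isomorphism of Yetter-Drinfel'd modules is an isomorphism of algebras. -/
def monIso {A B : Mon (YDMod k H)} (e : A.X ≃ₗ[k] B.X) (he : IsHom A.X.str B.X.str e.toLinearMap)
    (h1 : e (oneEl A) = oneEl B)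
    (hmul : ∀ a a', e (mulLin A (a ⊗ₜ a')) = mulLin B (e a ⊗ₜ e a')) : A ≅ B :=
  haveI : IsMonHom (isoMk e he).hom :=
    { one_hom := hom_ext (LinearMap.ext_ring h1)
      mul_hom := hom_ext (TensorProduct.ext' hmul) }
  Mon.mkIso' (isoMk e he)

/-- The underlying linear isomorphism of an isomorphism of algebras. -/
def isoEquiv {A B : Mon (YDMod k H)} (e : A ≅ B) : A.X ≃ₗ[k] B.X :=
  LinearEquiv.ofLinearMap e.hom.hom.lin e.inv.hom.lin
    congr(Hom.lin (Mon.Hom.hom $(e.inv_hom_id))) congr(Hom.lin (Mon.Hom.hom $(e.hom_inv_id)))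

lemma isHom_isoEquiv {A B : Mon (YDMod k H)} (e : A ≅ B) :
    IsHom A.X.str B.X.str (isoEquiv e).toLinearMap := e.hom.hom.isHom

lemma isoEquiv_mulLin {A B : Mon (YDMod k H)} (e : A ≅ B) (a a' : A.X) :
    isoEquiv e (mulLin A (a ⊗ₜ a')) = mulLin B (isoEquiv e a ⊗ₜ isoEquiv e a') :=
  congr(Hom.lin $(IsMonHom.mul_hom e.hom.hom) (a ⊗ₜ a'))

/-- A Yetter-Drinfel'd module algebra from its unit and its product. -/
def mkMon (M : YDMod k H) (mul : M ⊗[k] M →ₗ[k] M) (one : M)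
    (hmul : IsHom (M.str.tensor M.str) M.str mul)
    (hone : IsHom (YDStruct.unit k H) M.str (LinearMap.toSpanSingleton k M one))
    (one_mul : ∀ a, mul (one ⊗ₜ a) = a) (mul_one : ∀ a, mul (a ⊗ₜ one) = a)
    (mul_assoc : ∀ a b c, mul (mul (a ⊗ₜ b) ⊗ₜ c) = mul (a ⊗ₜ mul (b ⊗ₜ c))) :
    Mon (YDMod k H) where
  X := M
  mon :=
    { one := ⟨LinearMap.toSpanSingleton k M one, hone⟩
      mul := ⟨mul, hmul⟩
      one_mul := hom_ext (TensorProduct.ext' fun (c : k) (a : M) => by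
        change mul ((c • one) ⊗ₜ a) = c • a
        rw [← smul_tmul', map_smul, one_mul])
      mul_one := hom_ext (TensorProduct.ext' fun (a : M) (c : k) => by
        change mul (a ⊗ₜ (c • one)) = c • a
        rw [tmul_smul, map_smul, mul_one])
      mul_assoc := hom_ext (TensorProduct.ext_threefold mul_assoc) }

lemma oneEl_mkMon {M : YDMod k H} {mul : M ⊗[k] M →ₗ[k] M} {one : M}
    {hmul : IsHom (M.str.tensor M.str) M.str mul}
    {hone : IsHom (YDStruct.unit k H) M.str (LinearMap.toSpanSingleton k M one)}
    {one_mul : ∀ a, mul (one ⊗ₜ a) = a} {mul_one : ∀ a, mul (a ⊗ₜ one) = a}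
    {mul_assoc : ∀ a b c, mul (mul (a ⊗ₜ b) ⊗ₜ c) = mul (a ⊗ₜ mul (b ⊗ₜ c))} :
    oneEl (mkMon M mul one hmul hone one_mul mul_one mul_assoc) = one := by
  change LinearMap.toSpanSingleton k M one 1 = one
  simp

/-- If `i : A → R` and `j : B → R` are multiplicative and `j(b) i(a) = ∑ i(a₀) j(a₁ · b)` then
`a # b ↦ i(a) j(b)` is multiplicative. -/
lemma map_smashMul {A B : Mon (YDMod k H)} {R : Type*} [Ring R] [Algebra k R]
    (i : A.X →ₗ[k] R) (j : B.X →ₗ[k] R)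
    (hi : ∀ a a', i (mulLin A (a ⊗ₜ a')) = i a * i a')
    (hj : ∀ b b', j (mulLin B (b ⊗ₜ b')) = j b * j b')
    (hij : ∀ a b, j b * i a =
      LinearMap.mul' k R (TensorProduct.map i j (braid B.X.str A.X.str (b ⊗ₜ a))))
    (x y : A.X ⊗[k] B.X) :
    LinearMap.mul' k R (TensorProduct.map i j (smashMul A B (x ⊗ₜ y))) =
      LinearMap.mul' k R (TensorProduct.map i j x) *
        LinearMap.mul' k R (TensorProduct.map i j y) := by
  induction x with
  | zero => simp
  | add x x' hx hx' => simp only [add_tmul, map_add, hx, hx', add_mul]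
  | tmul a b =>
  induction y with
  | zero => simp
  | add x x' hx hx' => simp only [tmul_add, map_add, hx, hx', mul_add]
  | tmul a' b' =>
    have h := hij a' b
    rw [smashMul_tmul]
    simp only [map_tmul, LinearMap.mul'_apply]
    rw [mul_assoc (i a), ← mul_assoc (j b), h]
    generalize braid B.X.str A.X.str (b ⊗ₜ a') = w
    induction w with
    | zero => simp
    | add x y hx hy => simp only [map_add, hx, hy, add_mul, mul_add]
    | tmul x y => simp [hi, hj, mul_assoc]

end YDMod

end Algebras

end

noncomputable section

attribute [local instance] zeroHomClass_linearMap zeroHomClass_linearEquiv addHomClass_linearMap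
  addHomClass_linearEquiv

section Actions

variable {k : Type u} [CommRing k] {H : Type v} [Ring H] [HopfAlgebra k H]

namespace YDStruct

variable {M N P Q R : Type*} [AddCommGroup M] [Module k M] [AddCommGroup N] [Module k N]
  [AddCommGroup P] [Module k P] [AddCommGroup Q] [Module k Q] [AddCommGroup R] [Module k R]

/-- The map `Z ⊗ (X ⊗ N) → X ⊗ Q` which braids `Z` past `X` and then applies `T : Z ⊗ N → Q`. -/
def cross (Z : YDStruct k H P) (X : YDStruct k H M) (T : P ⊗[k] N →ₗ[k] Q) :
    P ⊗[k] (M ⊗[k] N) →ₗ[k] M ⊗[k] Q :=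
  T.lTensor M ∘ₗ (TensorProduct.assoc k M P N).toLinearMap ∘ₗ (braid Z X).rTensor N ∘ₗ
    (TensorProduct.assoc k P M N).symm.toLinearMap

lemma cross_tmul (Z : YDStruct k H P) (X : YDStruct k H M) (T : P ⊗[k] N →ₗ[k] Q)
    (p : P) (m : M) (n : N) :
    cross Z X T (p ⊗ₜ (m ⊗ₜ n)) = onR T (braid Z X (p ⊗ₜ m)) n := rfl

variable {X : YDStruct k H M} {Y : YDStruct k H N} {Z : YDStruct k H P} {V : YDStruct k H Q}
  {W : YDStruct k H R}

lemma isHom_cross {T : P ⊗[k] N →ₗ[k] Q} (hT : IsHom (Z.tensor Y) V T) :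
    IsHom (Z.tensor (X.tensor Y)) (X.tensor V) (cross Z X T) :=
  (((isHom_id X).tensor hT).comp (isHom_assoc X Z Y)).comp
    (((isHom_braid Z X).tensor (isHom_id Y)).comp (isHom_assoc Z X Y).symm)

lemma cross_map {S : R ⊗[k] N →ₗ[k] Q} {T : P ⊗[k] N →ₗ[k] Q} {f : P →ₗ[k] R} (hf : IsHom Z W f)
    (h : ∀ z n, S (f z ⊗ₜ n) = T (z ⊗ₜ n)) (z : P) (w : M ⊗[k] N) :
    cross W X S (f z ⊗ₜ w) = cross Z X T (z ⊗ₜ w) := by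
  induction w with
  | zero => simp
  | add x y hx hy => simp only [tmul_add, map_add, hx, hy]
  | tmul m n =>
    rw [cross_tmul, cross_tmul, hf.braid_map_left]
    generalize braid Z X (z ⊗ₜ m) = w
    induction w with
    | zero => simp
    | add x y hx hy => simp only [map_add, LinearMap.add_apply, hx, hy]
    | tmul a b => simp [h]

lemma cross_braid {T : P ⊗[k] N →ₗ[k] Q} (hT : IsHom (Z.tensor Y) V T) (z : P) (n : N) (m : M) :
    cross Z X T (z ⊗ₜ braid Y X (n ⊗ₜ m)) = braid V X (T (z ⊗ₜ n) ⊗ₜ m) := by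
  rw [hT.braid_left]
  generalize braid Y X (n ⊗ₜ m) = w
  induction w with
  | zero => simp
  | add x y hx hy => simp only [tmul_add, map_add, hx, hy]
  | tmul a b => rfl

/-- `(Z ⊗ V) ⊗ X → X` built from `S : Z ⊗ X → X` and `T : V ⊗ X → X`. -/
def actComp (S : P ⊗[k] M →ₗ[k] M) (T : Q ⊗[k] M →ₗ[k] M) : (P ⊗[k] Q) ⊗[k] M →ₗ[k] M :=
  S ∘ₗ T.lTensor P ∘ₗ (TensorProduct.assoc k P Q M).toLinearMap

lemma isHom_actComp {S : P ⊗[k] M →ₗ[k] M} {T : Q ⊗[k] M →ₗ[k] M}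
    (hS : IsHom (Z.tensor X) X S) (hT : IsHom (V.tensor X) X T) :
    IsHom ((Z.tensor V).tensor X) X (actComp S T) :=
  hS.comp (((isHom_id Z).tensor hT).comp (isHom_assoc Z V X))

lemma curry_actComp (S : P ⊗[k] M →ₗ[k] M) (T : Q ⊗[k] M →ₗ[k] M) :
    TensorProduct.curry (actComp S T) = LinearMap.mul' k (Module.End k M) ∘ₗ
      TensorProduct.map (TensorProduct.curry S) (TensorProduct.curry T) := by
  ext p q m
  rfl

/-- The action on `M ⊗ N` through the first factor. -/
def actL (N : Type*) [AddCommGroup N] [Module k N] (S : P ⊗[k] M →ₗ[k] M) :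
    P ⊗[k] (M ⊗[k] N) →ₗ[k] M ⊗[k] N :=
  S.rTensor N ∘ₗ (TensorProduct.assoc k P M N).symm.toLinearMap

lemma isHom_actL {S : P ⊗[k] M →ₗ[k] M} (hS : IsHom (Z.tensor X) X S) :
    IsHom (Z.tensor (X.tensor Y)) (X.tensor Y) (actL N S) :=
  (hS.tensor (isHom_id Y)).comp (isHom_assoc Z X Y).symm

section Finite

variable [Module.Finite k M] [Module.Projective k M] [BijectiveAntipode k H]

lemma theta_bijective (X : YDStruct k H M) (ρ : H →ₐ[k] Module.End k Q) :
    Function.Bijective (theta X ρ) := by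
  refine ⟨theta_injective X ρ, fun y => ?_⟩
  obtain ⟨z, hz⟩ := (rTensorHomEquivHomRTensor k M M Q).surjective
    (twist X (ρ.toLinearMap ∘ₗ antipodeInv k H) y)
  refine ⟨z, ?_⟩
  rw [theta, LinearMap.comp_apply, LinearEquiv.coe_coe, hz, twist_right_inv]

lemma theta_tmul_eq_braid (f : Module.End k M) (p : P) (m : M) :
    theta X Z.act (f ⊗ₜ p) m = f.rTensor P (braid Z X (p ⊗ₜ m)) := by
  rw [theta_tmul, braid_tmul]
  generalize X.coact m = w
  induction w with
  | zero => simp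
  | add x y hx hy => simp only [map_add, hx, hy]
  | tmul a b => rfl

/-- The isomorphism `P ⊗ End(M) ≃ End(M) ⊗ P` for which the maps
`b ⊗ f ↦ (m ↦ φ⁻¹(b ⊗ f(m)))` and `f ⊗ b ↦ (m ↦ (f ⊗ id) φ(b ⊗ m))` to `Hom(M, M ⊗ P)`
correspond to each other. -/
def swapEnd (X : YDStruct k H M) (Z : YDStruct k H P) :
    P ⊗[k] Module.End k M ≃ₗ[k] Module.End k M ⊗[k] P :=
  lTensorHomEquivHomLTensor k M P M ≪≫ₗ
    LinearEquiv.arrowCongr (LinearEquiv.refl k M) (braidEquiv X Z).symm ≪≫ₗ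
    (LinearEquiv.ofBijective (theta X Z.act) (theta_bijective X Z.act)).symm

lemma theta_swapEnd (y : P ⊗[k] Module.End k M) (m : M) :
    braid X Z (theta X Z.act (swapEnd X Z y) m) = lTensorHomEquivHomLTensor k M P M y m := by
  have h : theta X Z.act (swapEnd X Z y) = LinearEquiv.arrowCongr (LinearEquiv.refl k M)
      (braidEquiv X Z).symm (lTensorHomEquivHomLTensor k M P M y) :=
    LinearEquiv.apply_symm_apply (LinearEquiv.ofBijective (theta X Z.act)
      (theta_bijective X Z.act)) _
  rw [h]
  exact (braidEquiv X Z).apply_symm_apply _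

/-- `(End(M) ⊗ P) ⊗ M → M ⊗ P`, `(f ⊗ b) ⊗ m ↦ (f ⊗ id) φ(b ⊗ m)` -/
def thetaEval (X : YDStruct k H M) (Z : YDStruct k H P) :
    (Module.End k M ⊗[k] P) ⊗[k] M →ₗ[k] M ⊗[k] P :=
  actL P (endEval k M) ∘ₗ (braid Z X).lTensor _ ∘ₗ
    (TensorProduct.assoc k (Module.End k M) P M).toLinearMap

lemma isHom_thetaEval :
    IsHom ((X.endStr.tensor Z).tensor X) (X.tensor Z) (thetaEval X Z) :=
  (isHom_actL (isHom_endEval X)).comp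
    (((isHom_id X.endStr).tensor (isHom_braid Z X)).comp (isHom_assoc X.endStr Z X))

lemma thetaEval_tmul (z : Module.End k M ⊗[k] P) (m : M) :
    thetaEval X Z (z ⊗ₜ m) = theta X Z.act z m := by
  induction z with
  | zero => simp
  | add x y hx hy => simp only [add_tmul, map_add, hx, hy, LinearMap.add_apply]
  | tmul f p =>
    rw [theta_tmul_eq_braid]
    change onL (endEval k M) f (braid Z X (p ⊗ₜ m)) = _
    generalize braid Z X (p ⊗ₜ m) = w
    induction w with
    | zero => simp
    | add x y hx hy => simp only [map_add, hx, hy]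
    | tmul a b => rfl

lemma isHom_swapEnd [Module.Finite k H] [Module.Projective k H] :
    IsHom (Z.tensor X.endStr) (X.endStr.tensor Z) (swapEnd X Z).toLinearMap := by
  have hT : IsHom ((Z.tensor X.endStr).tensor X) (X.tensor Z)
      ((braidEquiv X Z).symm.toLinearMap ∘ₗ (endEval k M).lTensor P ∘ₗ
        (TensorProduct.assoc k P (Module.End k M) M).toLinearMap) :=
    (IsHom.symm (e := braidEquiv X Z) (isHom_braid X Z)).comp
      (((isHom_id Z).tensor (isHom_endEval X)).comp (isHom_assoc Z X.endStr X))
  refine .of_pairing_left isHom_thetaEval hT (fun z z' h => ?_) fun y m => ?_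
  · apply theta_injective X Z.act
    ext1 m
    rw [← thetaEval_tmul, h, thetaEval_tmul]
  · apply (braidEquiv X Z).injective
    rw [thetaEval_tmul]
    refine (theta_swapEnd y m).trans ?_
    simp only [LinearMap.comp_apply, LinearEquiv.coe_coe, LinearEquiv.apply_symm_apply]
    induction y with
    | zero => simp
    | add x y hx hy => simp only [add_tmul, map_add, hx, hy, LinearMap.add_apply]
    | tmul p f => simp

variable [Module.Finite k N] [Module.Projective k N]

/-- The map `End(M) ⊗ End(N) → End(M ⊗ N)`, `(f ⊗ g)(m ⊗ n) = ∑ f(m₀) ⊗ (m₁ · g)(n)`. -/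
def tensorEnd (X : YDStruct k H M) (Y : YDStruct k H N) :
    Module.End k M ⊗[k] Module.End k N →ₗ[k] Module.End k (M ⊗[k] N) :=
  LinearMap.mul' k _ ∘ₗ TensorProduct.map (TensorProduct.curry (actL N (endEval k M)))
    (TensorProduct.curry (cross Y.endStr X (endEval k N)))

lemma tensorEnd_bijective : Function.Bijective (tensorEnd X Y) := by
  let e : Module.End k M ⊗[k] Module.End k N ≃ₗ[k] Module.End k (M ⊗[k] N) :=
    LinearEquiv.ofBijective (theta X Y.endStr.act) (theta_bijective X _) ≪≫ₗ
      LinearEquiv.arrowCongr (LinearEquiv.refl k M) (lTensorHomEquivHomLTensor k N M N) ≪≫ₗ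
      TensorProduct.lift.equiv (.id k) M N (M ⊗[k] N)
  have h : tensorEnd X Y = e.toLinearMap := by
    apply TensorProduct.ext'
    intro f g
    apply TensorProduct.ext'
    intro m n
    change onL (endEval k M) f (onR (endEval k N) (braid Y.endStr X (g ⊗ₜ m)) n) =
      lTensorHomEquivHomLTensor k N M N (theta X Y.endStr.act (f ⊗ₜ g) m) n
    rw [theta_tmul_eq_braid]
    generalize braid Y.endStr X (g ⊗ₜ m) = w
    induction w with
    | zero => simp
    | add x y hx hy => simp only [map_add, hx, hy, LinearMap.add_apply]
    | tmul a b => simp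
  rw [h]
  exact e.bijective

lemma isHom_tensorEnd [Module.Finite k H] [Module.Projective k H] :
    IsHom (X.endStr.tensor Y.endStr) (X.tensor Y).endStr (tensorEnd X Y) := by
  rw [tensorEnd, ← curry_actComp]
  exact (isHom_actComp (isHom_actL (isHom_endEval X)) (isHom_cross (isHom_endEval Y))).curry

end Finite

end YDStruct

namespace YDMod

open YDStruct MonoidalCategory

lemma curry_actL_mul {A : Mon (YDMod k H)} {M N : Type*} [AddCommGroup M] [Module k M]
    [AddCommGroup N] [Module k N] {S : A.X ⊗[k] M →ₗ[k] M}
    (hS : ∀ a a' m, S (mulLin A (a ⊗ₜ a') ⊗ₜ m) = S (a ⊗ₜ S (a' ⊗ₜ m))) (a a' : A.X) :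
    TensorProduct.curry (actL N S) (mulLin A (a ⊗ₜ a')) =
      TensorProduct.curry (actL N S) a * TensorProduct.curry (actL N S) a' := by
  apply TensorProduct.ext'
  intro m n
  exact congrArg (· ⊗ₜ n) (hS a a' m)

lemma curry_cross_mul {B : Mon (YDMod k H)} {M N : Type*} [AddCommGroup M] [Module k M]
    [AddCommGroup N] [Module k N] {X : YDStruct k H M} {T : B.X ⊗[k] N →ₗ[k] N}
    (hT : ∀ b b' n, T (mulLin B (b ⊗ₜ b') ⊗ₜ n) = T (b ⊗ₜ T (b' ⊗ₜ n))) (b b' : B.X) :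
    TensorProduct.curry (cross B.X.str X T) (mulLin B (b ⊗ₜ b')) =
      TensorProduct.curry (cross B.X.str X T) b * TensorProduct.curry (cross B.X.str X T) b' := by
  apply TensorProduct.ext'
  intro m n
  change onR T (braid B.X.str X (mulLin B (b ⊗ₜ b') ⊗ₜ m)) n =
    cross B.X.str X T (b ⊗ₜ onR T (braid B.X.str X (b' ⊗ₜ m)) n)
  rw [(isHom_mulLin B).braid_left]
  generalize braid B.X.str X (b' ⊗ₜ m) = w
  induction w with
  | zero => simp
  | add x y hx hy => simp only [tmul_add, map_add, hx, hy, LinearMap.add_apply]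
  | tmul x y =>
    rw [onL_tmul, onR_tmul, cross_tmul]
    generalize braid B.X.str X (b ⊗ₜ x) = w
    induction w with
    | zero => simp
    | add x y hx hy => simp only [add_tmul, map_add, hx, hy, LinearMap.add_apply]
    | tmul x' y' => simp [hT]

/-- If `A` acts on `M` and `B` acts on `N` then `A # B` acts on `M ⊗ N`. -/
lemma mul_map_actL_cross {A B : Mon (YDMod k H)} {M N : Type*} [AddCommGroup M] [Module k M]
    [AddCommGroup N] [Module k N] {X : YDStruct k H M} {S : A.X ⊗[k] M →ₗ[k] M}
    {T : B.X ⊗[k] N →ₗ[k] N} (hS' : IsHom (A.X.str.tensor X) X S)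
    (hS : ∀ a a' m, S (mulLin A (a ⊗ₜ a') ⊗ₜ m) = S (a ⊗ₜ S (a' ⊗ₜ m)))
    (hT : ∀ b b' n, T (mulLin B (b ⊗ₜ b') ⊗ₜ n) = T (b ⊗ₜ T (b' ⊗ₜ n))) (x y : A.X ⊗[k] B.X) :
    LinearMap.mul' k _ (TensorProduct.map (TensorProduct.curry (actL N S))
      (TensorProduct.curry (cross B.X.str X T)) (smashMul A B (x ⊗ₜ y))) =
    LinearMap.mul' k _ (TensorProduct.map (TensorProduct.curry (actL N S))
      (TensorProduct.curry (cross B.X.str X T)) x) *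
    LinearMap.mul' k _ (TensorProduct.map (TensorProduct.curry (actL N S))
      (TensorProduct.curry (cross B.X.str X T)) y) := by
  refine map_smashMul _ _ (curry_actL_mul hS) (curry_cross_mul hT) (fun a b => ?_) x y
  apply TensorProduct.ext'
  intro m n
  change cross B.X.str X T (b ⊗ₜ (S (a ⊗ₜ m) ⊗ₜ n)) = _
  rw [cross_tmul, hS'.braid_right]
  generalize braid B.X.str A.X.str (b ⊗ₜ a) = w
  induction w with
  | zero => simp
  | add x y hx hy => simp only [map_add, hx, hy, LinearMap.add_apply]
  | tmul x y =>
    change _ = onL S x (onR T (braid B.X.str X (y ⊗ₜ m)) n)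
    rw [onR_tmul]
    generalize braid B.X.str X (y ⊗ₜ m) = w
    induction w with
    | zero => simp
    | add x y hx hy => simp only [tmul_add, map_add, hx, hy, LinearMap.add_apply]
    | tmul x' y' => simp

end YDMod

end Actions

end

noncomputable section

attribute [local instance] zeroHomClass_linearMap zeroHomClass_linearEquiv addHomClass_linearMap
  addHomClass_linearEquiv

set_option linter.unusedSectionVars false

section AlgebraIsos

variable {k : Type u} [CommRing k] {H : Type v} [Ring H] [HopfAlgebra k H]

namespace YDMod

open YDStruct MonoidalCategory

variable (A : Mon (YDMod k H))

/-- The product `m ∘ φ`. -/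
def barMul : A.X ⊗[k] A.X →ₗ[k] A.X := mulLin A ∘ₗ braid A.X.str A.X.str

lemma barMul_apply (z : A.X ⊗[k] A.X) : barMul A z = mulLin A (braid A.X.str A.X.str z) := rfl

lemma isHom_barMul : IsHom (A.X.str.tensor A.X.str) A.X.str (barMul A) :=
  (isHom_mulLin A).comp (isHom_braid _ _)

lemma barMul_assoc (a b c : A.X) :
    barMul A (barMul A (a ⊗ₜ b) ⊗ₜ c) = barMul A (a ⊗ₜ barMul A (b ⊗ₜ c)) := by
  have hr : braid A.X.str A.X.str (a ⊗ₜ barMul A (b ⊗ₜ c)) = (barMul A).rTensor A.X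
      ((TensorProduct.assoc k A.X A.X A.X).symm (onR (braid A.X.str A.X.str)
        (braid A.X.str A.X.str (a ⊗ₜ b)) c)) := (isHom_barMul A).braid_right a b c
  rw [barMul_apply A (a ⊗ₜ barMul A (b ⊗ₜ c)), hr, barMul_apply A (barMul A (a ⊗ₜ b) ⊗ₜ c),
    barMul_apply A (a ⊗ₜ b)]
  generalize braid A.X.str A.X.str (a ⊗ₜ b) = w
  induction w with
  | zero => simp
  | add x y hx hy => simp only [add_tmul, map_add, hx, hy, LinearMap.add_apply]
  | tmul x y =>
    rw [(isHom_mulLin A).braid_left, onR_tmul]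
    generalize braid A.X.str A.X.str (y ⊗ₜ c) = w
    induction w with
    | zero => simp
    | add x y hx hy => simp only [tmul_add, map_add, hx, hy]
    | tmul y' c' =>
      rw [onL_tmul, assoc_symm_tmul, LinearMap.rTensor_tmul, barMul_apply]
      generalize braid A.X.str A.X.str (x ⊗ₜ y') = w
      induction w with
      | zero => simp
      | add x y hx hy => simp only [add_tmul, map_add, hx, hy]
      | tmul u v => simp [mulLin_assoc]

/-- The braided opposite algebra `Ā`, with the product `m ∘ φ`. -/
def barAlg : Mon (YDMod k H) :=
  mkMon A.X (barMul A) (oneEl A) (isHom_barMul A) (isHom_oneEl A)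
    (fun a => by rw [barMul_apply, braid_one_tmul (isHom_oneEl A), mulLin_oneEl])
    (fun a => by rw [barMul_apply, braid_tmul_smul_one (isHom_oneEl A), oneEl_mulLin])
    (barMul_assoc A)

lemma azF_eq : azF A = LinearMap.mul' k (Module.End k A.X) ∘ₗ
    TensorProduct.map (TensorProduct.curry (mulLin A)) (TensorProduct.curry (barMul A)) :=
  curry_actComp (mulLin A) (barMul A)

lemma azF_tmul (a b c : A.X) : azF A (a ⊗ₜ b) c = mulLin A (a ⊗ₜ barMul A (b ⊗ₜ c)) := rfl

lemma azG_tmul (a b c : A.X) : azG A (a ⊗ₜ b) c = mulLin A (barMul A (c ⊗ₜ a) ⊗ₜ b) := rfl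

lemma curry_mulLin_mul (a a' : A.X) : TensorProduct.curry (mulLin A) (mulLin A (a ⊗ₜ a')) =
    TensorProduct.curry (mulLin A) a * TensorProduct.curry (mulLin A) a' :=
  LinearMap.ext (mulLin_assoc A a a')

lemma curry_barMul_mul (a a' : A.X) : TensorProduct.curry (barMul A) (barMul A (a ⊗ₜ a')) =
    TensorProduct.curry (barMul A) a * TensorProduct.curry (barMul A) a' :=
  LinearMap.ext (barMul_assoc A a a')

lemma curry_barMul_mul_curry_mulLin (a b : A.X) :
    TensorProduct.curry (barMul A) b * TensorProduct.curry (mulLin A) a =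
      LinearMap.mul' k (Module.End k A.X) (TensorProduct.map (TensorProduct.curry (mulLin A))
        (TensorProduct.curry (barMul A)) (braid A.X.str A.X.str (b ⊗ₜ a))) := by
  ext1 c
  change barMul A (b ⊗ₜ mulLin A (a ⊗ₜ c)) = _
  rw [barMul_apply, (isHom_mulLin A).braid_right]
  generalize braid A.X.str A.X.str (b ⊗ₜ a) = w
  induction w with
  | zero => simp
  | add x y hx hy => simp only [map_add, hx, hy, LinearMap.add_apply]
  | tmul x y =>
    change _ = mulLin A (x ⊗ₜ barMul A (y ⊗ₜ c))
    rw [onR_tmul, barMul_apply]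
    generalize braid A.X.str A.X.str (y ⊗ₜ c) = w
    induction w with
    | zero => simp
    | add x y hx hy => simp only [tmul_add, map_add, hx, hy]
    | tmul x' y' => simp [mulLin_assoc]

lemma azF_smashMul (x y : A.X ⊗[k] A.X) :
    azF A (smashMul A (barAlg A) (x ⊗ₜ y)) = azF A x * azF A y := by
  rw [azF_eq]
  exact map_smashMul (A := A) (B := barAlg A) (TensorProduct.curry (mulLin A))
    (TensorProduct.curry (barMul A)) (curry_mulLin_mul A) (curry_barMul_mul A)
    (curry_barMul_mul_curry_mulLin A) x y

lemma azF_one : azF A (oneEl A ⊗ₜ oneEl A) = 1 := by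
  ext1 c
  rw [azF_tmul, oneEl_mulLin, barMul_apply, braid_one_tmul (isHom_oneEl A), mulLin_oneEl]
  rfl

variable [BijectiveAntipode k H]

lemma oneEl_endAlg (M : YDMod k H) [Module.Finite k M] [Module.Projective k M] :
    oneEl M.endAlg = (1 : Module.End k M) := by
  change algebraMap k (Module.End k M) 1 = 1
  simp

variable [Module.Finite k H] [Module.Projective k H]

lemma isHom_azF [Module.Finite k A.X] [Module.Projective k A.X] :
    IsHom (A.X.str.tensor A.X.str) A.X.str.endStr (azF A) :=
  (isHom_actComp (isHom_mulLin A) (isHom_barMul A)).curry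

/-- `A # Ā ≃ End(A)` if the canonical map `F` is bijective. -/
def azFIso [Module.Finite k A.X] [Module.Projective k A.X] (h : Function.Bijective (azF A)) :
    A ⊗ barAlg A ≅ A.X.endAlg :=
  monIso (A := A ⊗ barAlg A) (B := A.X.endAlg) (LinearEquiv.ofBijective (azF A) h) (isHom_azF A)
    (by
      rw [oneEl_endAlg]
      refine Eq.trans ?_ (azF_one A)
      exact congrArg (fun x : A.X => azF A (oneEl A ⊗ₜ x)) oneEl_mkMon)
    (azF_smashMul A)

section EndTensor

variable (M N : YDMod k H) [Module.Finite k M] [Module.Projective k M]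
  [Module.Finite k N] [Module.Projective k N]

instance : Module.Finite k (tensorObj M N) := inferInstanceAs (Module.Finite k (M ⊗[k] N))

instance : Module.Projective k (tensorObj M N) := inferInstanceAs (Module.Projective k (M ⊗[k] N))

lemma tensorEnd_smashMul (x y : Module.End k M ⊗[k] Module.End k N) :
    tensorEnd M.str N.str (smashMul M.endAlg N.endAlg (x ⊗ₜ y)) =
      tensorEnd M.str N.str x * tensorEnd M.str N.str y :=
  mul_map_actL_cross (A := M.endAlg) (B := N.endAlg) (isHom_endEval M.str)
    (fun _ _ _ => rfl) (fun _ _ _ => rfl) x y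

lemma tensorEnd_one : tensorEnd M.str N.str (1 ⊗ₜ 1) = 1 := by
  apply TensorProduct.ext'
  intro m n
  change onL (endEval k M) 1 (onR (endEval k N) (braid N.str.endStr M.str (1 ⊗ₜ m)) n) = m ⊗ₜ n
  have h : IsHom (YDStruct.unit k H) N.str.endStr
      (LinearMap.toSpanSingleton k (Module.End k N) 1) := by
    have := isHom_oneEl N.endAlg
    rwa [oneEl_endAlg] at this
  rw [braid_one_tmul h]
  rfl

/-- `End(M) # End(N) ≃ End(M ⊗ N)` -/
def endTensorIso : M.endAlg ⊗ N.endAlg ≅ (tensorObj M N).endAlg :=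
  monIso (A := M.endAlg ⊗ N.endAlg) (B := (tensorObj M N).endAlg)
    (LinearEquiv.ofBijective (tensorEnd M.str N.str) tensorEnd_bijective) isHom_tensorEnd
    (by
      rw [oneEl_endAlg]
      change tensorEnd M.str N.str (oneEl M.endAlg ⊗ₜ oneEl N.endAlg) = 1
      rw [oneEl_endAlg, oneEl_endAlg, tensorEnd_one])
    (tensorEnd_smashMul M N)

end EndTensor

section EndComm

variable (B : Mon (YDMod k H)) (M : YDMod k H) [Module.Finite k M] [Module.Projective k M]

/-- The representation of `End(M) # B` on `M ⊗ B`. -/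
def endSmashRep : Module.End k M ⊗[k] B.X →ₗ[k] Module.End k (M ⊗[k] B.X) :=
  LinearMap.mul' k _ ∘ₗ TensorProduct.map (TensorProduct.curry (actL B.X (endEval k M)))
    (TensorProduct.curry (cross B.X.str M.str (mulLin B)))

/-- The representation of `B # End(M)` on `B ⊗ M`. -/
def smashEndRep : B.X ⊗[k] Module.End k M →ₗ[k] Module.End k (B.X ⊗[k] M) :=
  LinearMap.mul' k _ ∘ₗ TensorProduct.map (TensorProduct.curry (actL M (mulLin B)))
    (TensorProduct.curry (cross M.str.endStr B.X.str (endEval k M)))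

lemma endSmashRep_tmul (z : Module.End k M ⊗[k] B.X) (m : M) (c : B.X) :
    endSmashRep B M z (m ⊗ₜ c) = onR (mulLin B) (theta M.str B.X.str.act z m) c := by
  induction z with
  | zero => simp
  | add x y hx hy => simp only [map_add, hx, hy, LinearMap.add_apply]
  | tmul f b =>
    rw [theta_tmul_eq_braid]
    change onL (endEval k M) f (onR (mulLin B) (braid B.X.str M.str (b ⊗ₜ m)) c) = _
    generalize braid B.X.str M.str (b ⊗ₜ m) = w
    induction w with
    | zero => simp
    | add x y hx hy => simp only [map_add, hx, hy, LinearMap.add_apply]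
    | tmul x y => simp

lemma onR_mulLin_one (w : M ⊗[k] B.X) : onR (mulLin B) w (oneEl B) = w := by
  induction w with
  | zero => simp
  | add x y hx hy => simp only [map_add, hx, hy, LinearMap.add_apply]
  | tmul x y => simp

lemma endSmashRep_injective : Function.Injective (endSmashRep B M) := by
  intro z z' h
  apply theta_injective M.str B.X.str.act
  ext1 m
  have := congr($h (m ⊗ₜ oneEl B))
  rwa [endSmashRep_tmul, endSmashRep_tmul, onR_mulLin_one, onR_mulLin_one] at this

lemma braid_onR_mulLin (w : M ⊗[k] B.X) (c : B.X) :
    braid M.str B.X.str (onR (mulLin B) w c) = (mulLin B).rTensor M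
      ((TensorProduct.assoc k B.X B.X M).symm (onR (braid M.str B.X.str)
        (braid M.str B.X.str w) c)) := by
  induction w with
  | zero => simp
  | add x y hx hy => simp only [map_add, hx, hy, LinearMap.add_apply]
  | tmul x y => rw [onR_tmul, (isHom_mulLin B).braid_right]

lemma braid_endSmashRep (y : B.X ⊗[k] Module.End k M) :
    braid M.str B.X.str ∘ₗ endSmashRep B M (swapEnd M.str B.X.str y) =
      smashEndRep B M y ∘ₗ braid M.str B.X.str := by
  apply TensorProduct.ext'
  intro m c
  rw [LinearMap.comp_apply, LinearMap.comp_apply, endSmashRep_tmul, braid_onR_mulLin,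
    theta_swapEnd]
  induction y with
  | zero => simp
  | add x y hx hy => simp only [map_add, hx, hy, LinearMap.add_apply]
  | tmul b f =>
    change _ = onL (mulLin B) b
      (cross M.str.endStr B.X.str (endEval k M) (f ⊗ₜ braid M.str B.X.str (m ⊗ₜ c)))
    rw [cross_braid (isHom_endEval M.str)]
    simp [rTensor_assoc_symm_tmul]

lemma swapEnd_mul
    (μ₁ : (B.X ⊗[k] Module.End k M) ⊗[k] (B.X ⊗[k] Module.End k M) →ₗ[k] B.X ⊗[k] Module.End k M)
    (μ₂ : (Module.End k M ⊗[k] B.X) ⊗[k] (Module.End k M ⊗[k] B.X) →ₗ[k] Module.End k M ⊗[k] B.X)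
    (h₁ : ∀ x y, smashEndRep B M (μ₁ (x ⊗ₜ y)) = smashEndRep B M x * smashEndRep B M y)
    (h₂ : ∀ x y, endSmashRep B M (μ₂ (x ⊗ₜ y)) = endSmashRep B M x * endSmashRep B M y)
    (x y : B.X ⊗[k] Module.End k M) :
    swapEnd M.str B.X.str (μ₁ (x ⊗ₜ y)) =
      μ₂ (swapEnd M.str B.X.str x ⊗ₜ swapEnd M.str B.X.str y) := by
  apply endSmashRep_injective B M
  apply LinearMap.cancel_left (f := braid M.str B.X.str) braid_bijective.1 |>.1
  rw [braid_endSmashRep, h₁, h₂, Module.End.mul_eq_comp, Module.End.mul_eq_comp,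
    ← LinearMap.comp_assoc, braid_endSmashRep, LinearMap.comp_assoc, LinearMap.comp_assoc,
    braid_endSmashRep]

lemma swapEnd_smashMul (x y : B.X ⊗[k] Module.End k M) :
    swapEnd M.str B.X.str (smashMul B M.endAlg (x ⊗ₜ y)) =
      smashMul M.endAlg B (swapEnd M.str B.X.str x ⊗ₜ swapEnd M.str B.X.str y) :=
  swapEnd_mul B M (smashMul B M.endAlg) (smashMul M.endAlg B)
    (mul_map_actL_cross (A := B) (B := M.endAlg) (isHom_mulLin B) (mulLin_assoc B)
      (fun _ _ _ => rfl))
    (mul_map_actL_cross (A := M.endAlg) (B := B) (isHom_endEval M.str)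
      (fun _ _ _ => rfl) (mulLin_assoc B)) x y

lemma swapEnd_one : swapEnd M.str B.X.str (oneEl B ⊗ₜ 1) = 1 ⊗ₜ oneEl B := by
  apply theta_injective M.str B.X.str.act
  ext1 m
  apply (braid_bijective (X := M.str) (Y := B.X.str)).1
  rw [theta_swapEnd, theta_tmul_eq_braid, braid_one_tmul (isHom_oneEl B), LinearMap.rTensor_tmul,
    Module.End.one_apply, braid_tmul_smul_one (isHom_oneEl B)]
  simp

/-- `B # End(M) ≃ End(M) # B` -/
def endCommIso : B ⊗ M.endAlg ≅ M.endAlg ⊗ B :=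
  monIso (A := B ⊗ M.endAlg) (B := M.endAlg ⊗ B) (swapEnd M.str B.X.str) isHom_swapEnd
    (by
      change swapEnd M.str B.X.str (oneEl B ⊗ₜ oneEl M.endAlg) = oneEl M.endAlg ⊗ₜ oneEl B
      rw [oneEl_endAlg]
      exact swapEnd_one B M)
    (swapEnd_smashMul B M)

end EndComm

end YDMod

end AlgebraIsos

end

noncomputable section

attribute [local instance] zeroHomClass_linearMap zeroHomClass_linearEquiv addHomClass_linearMap
  addHomClass_linearEquiv

set_option linter.unusedSectionVars false

section SmashAzumaya

variable {k : Type u} [CommRing k] {H : Type v} [Ring H] [HopfAlgebra k H]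

namespace YDMod

open YDStruct MonoidalCategory

variable (A B : Mon (YDMod k H))

/-- The embedding `a ↦ a # 1`. -/
def smashInl : A.X →ₗ[k] A.X ⊗[k] B.X := (TensorProduct.mk k A.X B.X).flip (oneEl B)

/-- The embedding `b ↦ 1 # b`. -/
def smashInr : B.X →ₗ[k] A.X ⊗[k] B.X := TensorProduct.mk k A.X B.X (oneEl A)

lemma isHom_smashInl : IsHom A.X.str (A.X.str.tensor B.X.str) (smashInl A B) := by
  have h := ((isHom_id A.X.str).tensor (isHom_oneEl B)).comp (isHom_rid A.X.str).symm
  convert h using 1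
  ext a
  simp [smashInl]

lemma isHom_smashInr : IsHom B.X.str (A.X.str.tensor B.X.str) (smashInr A B) := by
  have h := ((isHom_oneEl A).tensor (isHom_id B.X.str)).comp (isHom_lid B.X.str).symm
  convert h using 1
  ext a
  simp [smashInr]

/-- The product `m ∘ φ` of `A # B` as a map on `A ⊗ B`. -/
def smashBarMul : (A.X ⊗[k] B.X) ⊗[k] (A.X ⊗[k] B.X) →ₗ[k] A.X ⊗[k] B.X := barMul (A ⊗ B)

lemma smashBarMul_apply (z : (A.X ⊗[k] B.X) ⊗[k] (A.X ⊗[k] B.X)) :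
    smashBarMul A B z =
      smashMul A B (braid (A.X.str.tensor B.X.str) (A.X.str.tensor B.X.str) z) := rfl

lemma smashMul_inl (a : A.X) (w : A.X ⊗[k] B.X) :
    smashMul A B (smashInl A B a ⊗ₜ w) = onL (mulLin A) a w := by
  induction w with
  | zero => simp
  | add x y hx hy => simp only [tmul_add, map_add, hx, hy]
  | tmul c d =>
    refine (smashMul_tmul A B a c (oneEl B) d).trans ?_
    rw [braid_one_tmul (isHom_oneEl B)]
    simp

lemma smashMul_inr (b : B.X) (w : A.X ⊗[k] B.X) :
    smashMul A B (smashInr A B b ⊗ₜ w) = cross B.X.str A.X.str (mulLin B) (b ⊗ₜ w) := by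
  induction w with
  | zero => simp
  | add x y hx hy => simp only [tmul_add, map_add, hx, hy]
  | tmul c d =>
    refine (smashMul_tmul A B (oneEl A) c b d).trans ?_
    rw [cross_tmul]
    generalize braid B.X.str A.X.str (b ⊗ₜ c) = w
    induction w with
    | zero => simp
    | add x y hx hy => simp only [map_add, LinearMap.add_apply, hx, hy]
    | tmul x y => simp

lemma smashMul_tmul_inr (c : A.X) (d b : B.X) :
    smashMul A B ((c ⊗ₜ d) ⊗ₜ smashInr A B b) = c ⊗ₜ mulLin B (d ⊗ₜ b) := by
  refine (smashMul_tmul A B c (oneEl A) d b).trans ?_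
  rw [braid_tmul_smul_one (isHom_oneEl A)]
  simp

lemma smashMul_tmul_inl (c a : A.X) (d : B.X) :
    smashMul A B ((c ⊗ₜ d) ⊗ₜ smashInl A B a) =
      onL (mulLin A) c (braid B.X.str A.X.str (d ⊗ₜ a)) := by
  refine (smashMul_tmul A B c a d (oneEl B)).trans ?_
  generalize braid B.X.str A.X.str (d ⊗ₜ a) = w
  induction w with
  | zero => simp
  | add x y hx hy => simp only [map_add, hx, hy]
  | tmul x y => simp

lemma smashMul_inl_inr (a : A.X) (b : B.X) :
    smashMul A B (smashInl A B a ⊗ₜ smashInr A B b) = a ⊗ₜ b := by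
  rw [smashMul_inl]
  change onL (mulLin A) a (oneEl A ⊗ₜ b) = _
  simp

lemma smashBarMul_inr_inl (a : A.X) (b : B.X) :
    smashBarMul A B (smashInr A B b ⊗ₜ smashInl A B a) = braid B.X.str A.X.str (b ⊗ₜ a) := by
  rw [smashBarMul_apply, (isHom_smashInr A B).braid_map (isHom_smashInl A B)]
  generalize braid B.X.str A.X.str (b ⊗ₜ a) = w
  induction w with
  | zero => simp
  | add x y hx hy => simp only [map_add, hx, hy]
  | tmul x y => rw [map_tmul, smashMul_inl_inr]

lemma smashBarMul_inr (b : B.X) (w : A.X ⊗[k] B.X) :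
    smashBarMul A B (smashInr A B b ⊗ₜ w) = cross B.X.str A.X.str (barMul B) (b ⊗ₜ w) := by
  induction w with
  | zero => simp
  | add x y hx hy => simp only [tmul_add, map_add, hx, hy]
  | tmul c d =>
    rw [smashBarMul_apply, (isHom_smashInr A B).braid_map_left, braid_tensor_right, cross_tmul]
    generalize braid B.X.str A.X.str (b ⊗ₜ c) = w
    induction w with
    | zero => simp
    | add x y hx hy => simp only [map_add, LinearMap.add_apply, hx, hy]
    | tmul x y =>
      rw [onR_tmul, onR_tmul, barMul_apply]
      generalize braid B.X.str B.X.str (y ⊗ₜ d) = w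
      induction w with
      | zero => simp
      | add x y hx hy => simp only [tmul_add, map_add, hx, hy]
      | tmul x' y' => rw [assoc_symm_tmul, LinearMap.lTensor_tmul, smashMul_tmul_inr]

/-- The map `W ⊗ (A ⊗ B) → A ⊗ B` which braids `W` past `A`, applies `Λ : W ⊗ B → A ⊗ B` and
multiplies in `A`. -/
def crossMul {P : Type*} [AddCommGroup P] [Module k P] (W : YDStruct k H P)
    (Λ : P ⊗[k] B.X →ₗ[k] A.X ⊗[k] B.X) : P ⊗[k] (A.X ⊗[k] B.X) →ₗ[k] A.X ⊗[k] B.X :=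
  (mulLin A).rTensor B.X ∘ₗ (TensorProduct.assoc k A.X A.X B.X).symm.toLinearMap ∘ₗ
    cross W A.X.str Λ

lemma crossMul_tmul {P : Type*} [AddCommGroup P] [Module k P] (W : YDStruct k H P)
    (Λ : P ⊗[k] B.X →ₗ[k] A.X ⊗[k] B.X) (p : P) (c : A.X) (d : B.X) :
    crossMul A B W Λ (p ⊗ₜ (c ⊗ₜ d)) = (mulLin A).rTensor B.X
      ((TensorProduct.assoc k A.X A.X B.X).symm (onR Λ (braid W A.X.str (p ⊗ₜ c)) d)) := rfl

lemma smashBarMul_inl (a : A.X) (w : A.X ⊗[k] B.X) :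
    smashBarMul A B (smashInl A B a ⊗ₜ w) =
      crossMul A B A.X.str (braid B.X.str A.X.str ∘ₗ braid A.X.str B.X.str) (a ⊗ₜ w) := by
  induction w with
  | zero => simp
  | add x y hx hy => simp only [tmul_add, map_add, hx, hy]
  | tmul c d =>
    rw [smashBarMul_apply, (isHom_smashInl A B).braid_map_left, braid_tensor_right, crossMul_tmul]
    generalize braid A.X.str A.X.str (a ⊗ₜ c) = w
    induction w with
    | zero => simp
    | add x y hx hy => simp only [map_add, LinearMap.add_apply, hx, hy]
    | tmul x y =>
      rw [onR_tmul, onR_tmul, LinearMap.comp_apply]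
      generalize braid A.X.str B.X.str (y ⊗ₜ d) = w
      induction w with
      | zero => simp
      | add x y hx hy => simp only [tmul_add, map_add, hx, hy]
      | tmul x' y' =>
        rw [assoc_symm_tmul, LinearMap.lTensor_tmul, smashMul_tmul_inl, rTensor_assoc_symm_tmul]

variable [BijectiveAntipode k H] [Module.Finite k H] [Module.Projective k H]
  [Module.Finite k A.X] [Module.Projective k A.X] [Module.Finite k B.X] [Module.Projective k B.X]

lemma cross_azF (b b' : B.X) (w : A.X ⊗[k] B.X) :
    smashMul A B (smashInr A B b ⊗ₜ smashBarMul A B (smashInr A B b' ⊗ₜ w)) =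
      cross B.X.str.endStr A.X.str (endEval k B.X) (azF B (b ⊗ₜ b') ⊗ₜ w) := by
  rw [smashMul_inr, smashBarMul_inr, azF_eq]
  have h₁ : cross B.X.str A.X.str (barMul B) (b' ⊗ₜ w) =
      cross B.X.str.endStr A.X.str (endEval k B.X) (TensorProduct.curry (barMul B) b' ⊗ₜ w) :=
    (cross_map (isHom_barMul B).curry (fun _ _ => rfl) _ _).symm
  rw [h₁, ← cross_map (S := endEval k B.X) (T := mulLin B) (isHom_mulLin B).curry (fun _ _ => rfl) b]
  exact congr($(curry_cross_mul (B := B.X.endAlg) (X := A.X.str) (T := endEval k B.X)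
    (fun _ _ _ => rfl) (TensorProduct.curry (mulLin B) b)
    (TensorProduct.curry (barMul B) b')) w).symm

lemma cross_crossMul (g : Module.End k B.X) (a : A.X) (w : A.X ⊗[k] B.X) :
    cross B.X.str.endStr A.X.str (endEval k B.X) (g ⊗ₜ
      crossMul A B A.X.str (braid B.X.str A.X.str ∘ₗ braid A.X.str B.X.str) (a ⊗ₜ w)) =
    crossMul A B (B.X.str.endStr.tensor A.X.str)
      (braid B.X.str A.X.str ∘ₗ thetaEval B.X.str A.X.str) ((g ⊗ₜ a) ⊗ₜ w) := by
  induction w with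
  | zero => simp
  | add x y hx hy => simp only [tmul_add, map_add, hx, hy]
  | tmul c d =>
    rw [crossMul_tmul, crossMul_tmul, braid_tensor_left]
    generalize braid A.X.str A.X.str (a ⊗ₜ c) = w
    induction w with
    | zero => simp
    | add x y hx hy => simp only [tmul_add, map_add, LinearMap.add_apply, hx, hy]
    | tmul x y =>
      rw [onR_tmul, onL_tmul, LinearMap.comp_apply]
      have hΛ : ∀ g' : Module.End k B.X,
          (braid B.X.str A.X.str ∘ₗ thetaEval B.X.str A.X.str) ((g' ⊗ₜ y) ⊗ₜ d) =
            cross B.X.str.endStr A.X.str (endEval k B.X)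
              (g' ⊗ₜ braid B.X.str A.X.str (braid A.X.str B.X.str (y ⊗ₜ d))) := by
        intro g'
        change braid B.X.str A.X.str
          (onL (endEval k B.X) g' (braid A.X.str B.X.str (y ⊗ₜ d))) = _
        generalize braid A.X.str B.X.str (y ⊗ₜ d) = w
        induction w with
        | zero => simp
        | add x y hx hy => simp only [tmul_add, map_add, hx, hy]
        | tmul x y => rw [cross_braid (isHom_endEval B.X.str), onL_tmul]
      have hL : ∀ v : A.X ⊗[k] Module.End k B.X,
          onR (braid B.X.str A.X.str ∘ₗ thetaEval B.X.str A.X.str)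
            (TensorProduct.assoc k A.X (Module.End k B.X) A.X (v ⊗ₜ y)) d =
          onR (cross B.X.str.endStr A.X.str (endEval k B.X)) v
            (braid B.X.str A.X.str (braid A.X.str B.X.str (y ⊗ₜ d))) := by
        intro v
        induction v with
        | zero => simp
        | add x y hx hy => simp only [add_tmul, map_add, LinearMap.add_apply, hx, hy]
        | tmul c' g' => rw [assoc_tmul, onR_tmul, hΛ, onR_tmul]
      rw [hL]
      generalize braid B.X.str A.X.str (braid A.X.str B.X.str (y ⊗ₜ d)) = w
      induction w with
      | zero => simp
      | add x y hx hy => simp only [tmul_add, map_add, hx, hy]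
      | tmul x' d' =>
        rw [rTensor_assoc_symm_tmul, onL_tmul, cross_tmul, (isHom_mulLin A).braid_right]
        generalize braid B.X.str.endStr A.X.str (g ⊗ₜ x) = w
        induction w with
        | zero => simp
        | add x y hx hy => simp only [map_add, LinearMap.add_apply, hx, hy]
        | tmul c' g' =>
          rw [onR_tmul, onR_tmul, cross_tmul]
          generalize braid B.X.str.endStr A.X.str (g' ⊗ₜ x') = w
          induction w with
          | zero => simp
          | add x y hx hy => simp only [tmul_add, map_add, LinearMap.add_apply, hx, hy]
          | tmul x y => simp

lemma crossMul_swapEnd (y : A.X ⊗[k] Module.End k B.X) (w : A.X ⊗[k] B.X) :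
    crossMul A B (B.X.str.endStr.tensor A.X.str)
      (braid B.X.str A.X.str ∘ₗ thetaEval B.X.str A.X.str)
      (swapEnd B.X.str A.X.str y ⊗ₜ w) =
    crossMul A B (A.X.str.tensor B.X.str.endStr)
      ((endEval k B.X).lTensor A.X ∘ₗ
        (TensorProduct.assoc k A.X (Module.End k B.X) B.X).toLinearMap) (y ⊗ₜ w) := by
  refine congrArg ((mulLin A).rTensor B.X ∘ₗ
    (TensorProduct.assoc k A.X A.X B.X).symm.toLinearMap) (cross_map isHom_swapEnd ?_ y w)
  intro y d
  rw [LinearMap.comp_apply, thetaEval_tmul]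
  refine (theta_swapEnd y d).trans ?_
  induction y with
  | zero => simp
  | add x y hx hy => simp only [add_tmul, map_add, LinearMap.add_apply, hx, hy]
  | tmul x y => simp

lemma crossMul_tmul_end (a : A.X) (g : Module.End k B.X) (w : A.X ⊗[k] B.X) :
    crossMul A B (A.X.str.tensor B.X.str.endStr)
      ((endEval k B.X).lTensor A.X ∘ₗ
        (TensorProduct.assoc k A.X (Module.End k B.X) B.X).toLinearMap) ((a ⊗ₜ g) ⊗ₜ w) =
    onL (barMul A) a (cross B.X.str.endStr A.X.str (endEval k B.X) (g ⊗ₜ w)) := by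
  induction w with
  | zero => simp
  | add x y hx hy => simp only [tmul_add, map_add, hx, hy]
  | tmul c d =>
    rw [crossMul_tmul, braid_tensor_left, cross_tmul]
    generalize braid B.X.str.endStr A.X.str (g ⊗ₜ c) = w
    induction w with
    | zero => simp
    | add x y hx hy => simp only [map_add, LinearMap.add_apply, hx, hy]
    | tmul x y =>
      rw [onL_tmul, onR_tmul, onL_tmul, barMul_apply]
      generalize braid A.X.str A.X.str (a ⊗ₜ x) = w
      induction w with
      | zero => simp
      | add x y hx hy => simp only [add_tmul, map_add, LinearMap.add_apply, hx, hy]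
      | tmul x y => simp

lemma tensorEnd_azF (a : A.X) (y : A.X ⊗[k] Module.End k B.X) (w : A.X ⊗[k] B.X) :
    tensorEnd A.X.str B.X.str ((azF A).rTensor (Module.End k B.X)
      ((TensorProduct.assoc k A.X A.X (Module.End k B.X)).symm (a ⊗ₜ y))) w =
    onL (mulLin A) a (crossMul A B (B.X.str.endStr.tensor A.X.str)
      (braid B.X.str A.X.str ∘ₗ thetaEval B.X.str A.X.str)
      (swapEnd B.X.str A.X.str y ⊗ₜ w)) := by
  rw [crossMul_swapEnd]
  induction y with
  | zero => simp
  | add x y hx hy => simp only [add_tmul, tmul_add, map_add, LinearMap.add_apply, hx, hy]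
  | tmul a' g =>
    rw [crossMul_tmul_end]
    change onL (endEval k A.X) (azF A (a ⊗ₜ a'))
      (cross B.X.str.endStr A.X.str (endEval k B.X) (g ⊗ₜ w)) = _
    generalize cross B.X.str.endStr A.X.str (endEval k B.X) (g ⊗ₜ w) = v
    induction v with
    | zero => simp
    | add x y hx hy => simp only [map_add, hx, hy]
    | tmul x y => simp [azF_tmul]

/-- The canonical map `F` of `A # B` as a map on `A ⊗ B`. -/
def smashAzF : (A.X ⊗[k] B.X) ⊗[k] (A.X ⊗[k] B.X) →ₗ[k] Module.End k (A.X ⊗[k] B.X) :=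
  azF (A ⊗ B)

lemma smashAzF_tmul (x y w : A.X ⊗[k] B.X) :
    smashAzF A B (x ⊗ₜ y) w = smashMul A B (x ⊗ₜ smashBarMul A B (y ⊗ₜ w)) := rfl

lemma smashMul_assoc (x y w : A.X ⊗[k] B.X) :
    smashMul A B (smashMul A B (x ⊗ₜ y) ⊗ₜ w) = smashMul A B (x ⊗ₜ smashMul A B (y ⊗ₜ w)) :=
  mulLin_assoc (A ⊗ B) x y w

lemma smashBarMul_assoc (x y w : A.X ⊗[k] B.X) :
    smashBarMul A B (smashBarMul A B (x ⊗ₜ y) ⊗ₜ w) =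
      smashBarMul A B (x ⊗ₜ smashBarMul A B (y ⊗ₜ w)) :=
  barMul_assoc (A ⊗ B) x y w

lemma smashAzF_tmul_braid (a a' : A.X) (b b' : B.X) (w : A.X ⊗[k] B.X) :
    smashAzF A B ((a ⊗ₜ b) ⊗ₜ braid B.X.str A.X.str (b' ⊗ₜ a')) w =
      onL (mulLin A) a (crossMul A B (B.X.str.endStr.tensor A.X.str)
        (braid B.X.str A.X.str ∘ₗ thetaEval B.X.str A.X.str)
        ((azF B (b ⊗ₜ b') ⊗ₜ a') ⊗ₜ w)) := by
  rw [← smashBarMul_inr_inl, ← smashMul_inl_inr, smashAzF_tmul, smashMul_assoc,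
    smashBarMul_assoc, cross_azF, smashBarMul_inl, cross_crossMul, smashMul_inl]

lemma smashAzF_bijective (hA : Function.Bijective (azF A)) (hB : Function.Bijective (azF B)) :
    Function.Bijective (smashAzF A B) := by
  let F := LinearEquiv.ofBijective (azF A) hA
  let F' := LinearEquiv.ofBijective (azF B) hB
  let Ψ := swapEnd B.X.str A.X.str
  let e₁ : (A.X ⊗[k] B.X) ⊗[k] (B.X ⊗[k] A.X) ≃ₗ[k] A.X ⊗[k] (Module.End k B.X ⊗[k] A.X) :=
    TensorProduct.assoc k A.X B.X (B.X ⊗[k] A.X) ≪≫ₗ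
      LinearEquiv.lTensor A.X ((TensorProduct.assoc k B.X B.X A.X).symm ≪≫ₗ
        LinearEquiv.rTensor A.X F')
  let e₂ : A.X ⊗[k] (Module.End k B.X ⊗[k] A.X) ≃ₗ[k] Module.End k A.X ⊗[k] Module.End k B.X :=
    LinearEquiv.lTensor A.X Ψ.symm ≪≫ₗ
      (TensorProduct.assoc k A.X A.X (Module.End k B.X)).symm ≪≫ₗ
      LinearEquiv.rTensor (Module.End k B.X) F
  let e₃ := e₁ ≪≫ₗ e₂ ≪≫ₗ
    LinearEquiv.ofBijective (tensorEnd A.X.str B.X.str) tensorEnd_bijective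
  let e₀ := LinearEquiv.lTensor (A.X ⊗[k] B.X) (braidEquiv B.X.str A.X.str)
  have h : smashAzF A B ∘ₗ e₀.toLinearMap = e₃.toLinearMap := by
    apply TensorProduct.ext_fourfold'
    intro a b b' a'
    refine LinearMap.ext fun w => ?_
    have h₁ : e₁ ((a ⊗ₜ b) ⊗ₜ (b' ⊗ₜ a')) = a ⊗ₜ (azF B (b ⊗ₜ b') ⊗ₜ a') := rfl
    have h₂ : ∀ z, e₂ (a ⊗ₜ z) = (azF A).rTensor (Module.End k B.X)
      ((TensorProduct.assoc k A.X A.X (Module.End k B.X)).symm (a ⊗ₜ Ψ.symm z)) := fun _ => rfl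
    have h₃ : e₀ ((a ⊗ₜ b) ⊗ₜ (b' ⊗ₜ a')) =
      (a ⊗ₜ b) ⊗ₜ braid B.X.str A.X.str (b' ⊗ₜ a') := rfl
    rw [LinearMap.comp_apply, LinearEquiv.coe_coe, LinearEquiv.coe_coe, h₃, smashAzF_tmul_braid,
      LinearEquiv.trans_apply, LinearEquiv.trans_apply, h₁, h₂, LinearEquiv.ofBijective_apply,
      tensorEnd_azF, LinearEquiv.apply_symm_apply]
  have h' : smashAzF A B = e₃.toLinearMap ∘ₗ e₀.symm.toLinearMap := by
    rw [← h, LinearMap.comp_assoc]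
    simp
  rw [h']
  exact (e₀.symm ≪≫ₗ e₃).bijective

end YDMod

end SmashAzumaya

end

noncomputable section

attribute [local instance] zeroHomClass_linearMap zeroHomClass_linearEquiv addHomClass_linearMap
  addHomClass_linearEquiv

set_option linter.unusedSectionVars false

section DualAlgebras

variable {k : Type u} [CommRing k] {H : Type v} [Ring H] [HopfAlgebra k H]
  [Module.Finite k H] [Module.Projective k H]

namespace YDStruct

open HopfDual

variable {M N : Type*} [AddCommGroup M] [Module k M] [AddCommGroup N] [Module k N]

lemma braid_dual (X : YDStruct k H M) (Y : YDStruct k H N) (m : M) (n : N) :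
    braid X.dual Y.dual (m ⊗ₜ n) = TensorProduct.comm k M N (braid Y X (n ⊗ₜ m)) := by
  have h : ∀ (z : N ⊗[k] HopfDual k H) (w : M ⊗[k] H),
      ((slice k H M).flip w).lTensor N z = TensorProduct.comm k M N
        ((homEquiv k H N z).lTensor M w) := by
    intro z w
    induction z with
    | zero => simp
    | add x y hx hy => simp only [map_add, hx, hy, LinearMap.lTensor_add, LinearMap.add_apply]
    | tmul n ξ =>
      induction w with
      | zero => simp
      | add x y hx hy => simp only [map_add, hx, hy, LinearMap.lTensor_add, LinearMap.add_apply]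
      | tmul m a => simp [homEquiv_apply, tmul_smul]
  refine (h (dualCoact Y n) (X.coact m)).trans ?_
  rw [homEquiv_dualCoact]
  rfl

end YDStruct

namespace YDMod

open YDStruct MonoidalCategory

lemma dualFunctor_full : (dualFunctor k H).Full where
  map_surjective f := ⟨⟨f.unmop.lin, f.unmop.isHom.of_dual⟩, rfl⟩

lemma dualFunctor_faithful : (dualFunctor k H).Faithful where
  map_injective {M N} _ _ h := hom_ext
    (congrArg (fun f => Hom.lin (M := ⟨M, M.str.dual⟩) (N := ⟨N, N.str.dual⟩) f.unmop) h)

lemma dualFunctor_essSurj : (dualFunctor k H).EssSurj where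
  mem_essImage N := ⟨⟨N.unmop, N.unmop.str.undual⟩, ⟨(isoMk
    (M := ⟨N.unmop, N.unmop.str.undual.dual⟩) (N := N.unmop) (LinearEquiv.refl k N.unmop)
    (by rw [dual_undual]; exact isHom_id _)).mop⟩⟩

lemma dualFunctor_isEquivalence : (dualFunctor k H).IsEquivalence where
  faithful := dualFunctor_faithful
  full := dualFunctor_full
  essSurj := dualFunctor_essSurj

lemma dualFunctor_braided (M N : YDMod k H) :
    Functor.LaxMonoidal.μ (dualFunctor k H) M N ≫ (dualFunctor k H).map (β_ M N).hom =
      (β_ ((dualFunctor k H).obj M) ((dualFunctor k H).obj N)).hom ≫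
        Functor.LaxMonoidal.μ (dualFunctor k H) N M := by
  apply Quiver.Hom.unmop_inj
  apply hom_ext
  apply TensorProduct.ext'
  have h : ∀ (n : N) (m : M), braid M.str N.str (m ⊗ₜ n) =
      TensorProduct.comm k M N (braid N.str.dual M.str.dual (n ⊗ₜ m)) := by
    intro n m
    rw [braid_dual]
    exact ((TensorProduct.comm k M N).apply_symm_apply _).symm
  exact h

variable (A B : Mon (YDMod k H))

lemma mulLin_dualAlg (a b : A.X) : mulLin (dualAlg A) (a ⊗ₜ b) = mulLin A (b ⊗ₜ a) := rfl

lemma mulLin_dualAlg_eq : (mulLin (dualAlg A) : A.X ⊗[k] A.X →ₗ[k] A.X) =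
    mulLin A ∘ₗ (TensorProduct.comm k A.X A.X).toLinearMap :=
  TensorProduct.ext' (mulLin_dualAlg A)

lemma barMul_dualAlg (a b : A.X) : barMul (dualAlg A) (a ⊗ₜ b) = barMul A (b ⊗ₜ a) := by
  refine (congr($(mulLin_dualAlg_eq A) (braid A.X.str.dual A.X.str.dual (a ⊗ₜ b)))).trans ?_
  rw [braid_dual, LinearMap.comp_apply]
  exact congrArg (mulLin A) ((TensorProduct.comm k A.X A.X).apply_symm_apply _)

lemma azF_dualAlg (a b : A.X) : azF (dualAlg A) (a ⊗ₜ b) = azG A (b ⊗ₜ a) :=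
  LinearMap.ext fun (c : A.X) =>
    congrArg (fun x => mulLin A (x ⊗ₜ a)) (barMul_dualAlg A b c)

lemma azG_dualAlg (a b : A.X) : azG (dualAlg A) (a ⊗ₜ b) = azF A (b ⊗ₜ a) :=
  LinearMap.ext fun (c : A.X) =>
    congrArg (fun x => mulLin A (b ⊗ₜ x)) (barMul_dualAlg A c a)

lemma azF_dualAlg_eq : (azF (dualAlg A) : A.X ⊗[k] A.X →ₗ[k] Module.End k A.X) =
    azG A ∘ₗ (TensorProduct.comm k A.X A.X).toLinearMap :=
  TensorProduct.ext' (azF_dualAlg A)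

lemma azG_dualAlg_eq : (azG (dualAlg A) : A.X ⊗[k] A.X →ₗ[k] Module.End k A.X) =
    azF A ∘ₗ (TensorProduct.comm k A.X A.X).toLinearMap :=
  TensorProduct.ext' (azG_dualAlg A)

lemma azF_dualAlg_bijective : Function.Bijective (azF (dualAlg A)) ↔
    Function.Bijective (azG A) := by
  have h := Function.Bijective.of_comp_iff (f := azG A) (TensorProduct.comm k A.X A.X).bijective
  rw [← h]
  have h' : (azG A) ∘ (TensorProduct.comm k A.X A.X) =
    (azF (dualAlg A) : A.X ⊗[k] A.X →ₗ[k] Module.End k A.X) := by rw [azF_dualAlg_eq]; rfl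
  rw [h']
  rfl

lemma azG_dualAlg_bijective : Function.Bijective (azG (dualAlg A)) ↔
    Function.Bijective (azF A) := by
  have h := Function.Bijective.of_comp_iff (f := azF A) (TensorProduct.comm k A.X A.X).bijective
  rw [← h]
  have h' : (azF A) ∘ (TensorProduct.comm k A.X A.X) =
    (azG (dualAlg A) : A.X ⊗[k] A.X →ₗ[k] Module.End k A.X) := by rw [azG_dualAlg_eq]; rfl
  rw [h']
  rfl

lemma isHAzumaya_dualAlg_iff : IsHAzumaya (dualAlg A) ↔ IsHAzumaya A :=
  ⟨fun h => ⟨h.1, (azG_dualAlg_bijective A).1 h.3, (azF_dualAlg_bijective A).1 h.2⟩,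
    fun h => ⟨h.1, (azF_dualAlg_bijective A).2 h.3, (azG_dualAlg_bijective A).2 h.2⟩⟩

variable {A B}

lemma isoEquiv_oneEl {k : Type u} [CommRing k] {H : Type v} [Ring H] [HopfAlgebra k H]
    {A B : Mon (YDMod k H)} (e : A ≅ B) : isoEquiv e (oneEl A) = oneEl B :=
  congr(Hom.lin $(IsMonHom.one_hom e.hom.hom) (1 : k))

/-- `D` on isomorphisms of algebras. -/
def dualAlgIso (e : A ≅ B) : dualAlg A ≅ dualAlg B :=
  monIso (A := dualAlg A) (B := dualAlg B) (isoEquiv e : A.X ≃ₗ[k] B.X) (isHom_isoEquiv e).dual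
    (isoEquiv_oneEl (A := A) (B := B) e)
    (fun (a a' : A.X) => isoEquiv_mulLin (A := A) (B := B) e a' a)

/-- `D` reflects isomorphisms of algebras. -/
def ofDualAlgIso (e : dualAlg A ≅ dualAlg B) : A ≅ B :=
  monIso (A := A) (B := B) (isoEquiv e : (dualAlg A).X ≃ₗ[k] (dualAlg B).X)
    (IsHom.of_dual (X := A.X.str) (Y := B.X.str) (isHom_isoEquiv e))
    (isoEquiv_oneEl (A := dualAlg A) (B := dualAlg B) e)
    (fun (a a' : A.X) => isoEquiv_mulLin (A := dualAlg A) (B := dualAlg B) e a' a)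

variable (A B) in
/-- The product of `D(B) # D(A)` as a map on `B ⊗ A`. -/
def dualSmashMul : (B.X ⊗[k] A.X) ⊗[k] (B.X ⊗[k] A.X) →ₗ[k] B.X ⊗[k] A.X :=
  smashMul (dualAlg B) (dualAlg A)

lemma dualSmashMul_tmul (a a' : A.X) (b b' : B.X) :
    dualSmashMul A B ((b ⊗ₜ a) ⊗ₜ (b' ⊗ₜ a')) =
      TensorProduct.map ((TensorProduct.curry (mulLin B)).flip b)
        (TensorProduct.curry (mulLin A) a') (braid A.X.str.dual B.X.str.dual (a ⊗ₜ b')) :=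
  smashMul_tmul (dualAlg B) (dualAlg A) b b' a a'

lemma comm_dualSmashMul (x y : B.X ⊗[k] A.X) :
    TensorProduct.comm k B.X A.X (dualSmashMul A B (x ⊗ₜ y)) =
      smashMul A B (TensorProduct.comm k B.X A.X y ⊗ₜ TensorProduct.comm k B.X A.X x) := by
  induction x with
  | zero => simp
  | add x x' hx hx' => simp only [add_tmul, tmul_add, map_add, hx, hx']
  | tmul b a =>
  induction y with
  | zero => simp
  | add x x' hx hx' => simp only [add_tmul, tmul_add, map_add, hx, hx']
  | tmul b' a' =>
    rw [comm_tmul, comm_tmul, smashMul_tmul, dualSmashMul_tmul, braid_dual]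
    generalize braid B.X.str A.X.str (b' ⊗ₜ a) = w
    induction w with
    | zero => simp
    | add x y hx hy => simp only [map_add, hx, hy]
    | tmul x y => rfl

variable (A B) in
/-- `D(B) # D(A) ≃ D(A # B)` -/
def dualAlgTensorIso : dualAlg B ⊗ dualAlg A ≅ dualAlg (A ⊗ B) :=
  monIso (A := dualAlg B ⊗ dualAlg A) (B := dualAlg (A ⊗ B)) (TensorProduct.comm k B.X A.X)
    (isHom_dualFlip A.X.str B.X.str) (comm_tmul k B.X A.X (oneEl B) (oneEl A))
    (fun x y => (comm_dualSmashMul (A := A) (B := B) x y).trans (mulLin_dualAlg (A ⊗ B)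
      (TensorProduct.comm k B.X A.X x) (TensorProduct.comm k B.X A.X y)).symm)

/-- The algebra `B` over `H^*` as an algebra over `H`. -/
def undualAlg (B : Mon (YDMod k (HopfDual k H))) : Mon (YDMod k H) :=
  mkMon ⟨B.X, B.X.str.undual⟩ (mulLin B ∘ₗ (TensorProduct.comm k B.X B.X).toLinearMap) (oneEl B)
    (.of_dual_flip (by
      rw [dual_undual]
      convert isHom_mulLin B using 1
      exact TensorProduct.ext' fun _ _ => rfl))
    (.of_dual (by
      rw [dual_undual]
      exact (isHom_oneEl B).comp isHom_dualUnit.symm))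
    (mulLin_oneEl B) (oneEl_mulLin B) (fun a b c => (mulLin_assoc B c b a).symm)

/-- `D` is essentially surjective on algebras. -/
def dualAlgUndualAlg (B : Mon (YDMod k (HopfDual k H))) : dualAlg (undualAlg B) ≅ B :=
  monIso (A := dualAlg (undualAlg B)) (B := B) (LinearEquiv.refl k B.X)
    (by
      change IsHom B.X.str.undual.dual B.X.str _
      rw [dual_undual]
      exact isHom_id _)
    (one_smul k (oneEl B))
    (fun _ _ => rfl)

lemma azF_bijective_of_iso {k : Type u} [CommRing k] {H : Type v} [Ring H] [HopfAlgebra k H]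
    {A B : Mon (YDMod k H)} (e : A ≅ B) (h : Function.Bijective (azF A)) :
    Function.Bijective (azF B) := by
  have hb : ∀ a b, isoEquiv e (barMul A (a ⊗ₜ b)) = barMul B (isoEquiv e a ⊗ₜ isoEquiv e b) := by
    intro a b
    have := (isHom_isoEquiv e).braid_map (isHom_isoEquiv e) a b
    rw [LinearEquiv.coe_coe] at this
    rw [barMul_apply, barMul_apply, this]
    generalize braid A.X.str A.X.str (a ⊗ₜ b) = w
    induction w with
    | zero => simp
    | add x y hx hy => simp only [map_add, hx, hy]
    | tmul x y => exact isoEquiv_mulLin e x y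
  let c : Module.End k A.X ≃ₗ[k] Module.End k B.X := LinearEquiv.arrowCongr (isoEquiv e) (isoEquiv e)
  have hF : azF B ∘ₗ (TensorProduct.congr (isoEquiv e) (isoEquiv e)).toLinearMap =
      c.toLinearMap ∘ₗ azF A := by
    apply TensorProduct.ext'
    intro a b
    refine LinearMap.ext fun x => ?_
    obtain ⟨x, rfl⟩ := (isoEquiv e).surjective x
    change azF B (isoEquiv e a ⊗ₜ isoEquiv e b) (isoEquiv e x) =
      isoEquiv e (azF A (a ⊗ₜ b) ((isoEquiv e).symm (isoEquiv e x)))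
    rw [LinearEquiv.symm_apply_apply, azF_tmul, azF_tmul, isoEquiv_mulLin, hb]
  have h2 : Function.Bijective (azF B ∘ (TensorProduct.congr (isoEquiv e) (isoEquiv e))) := by
    have := c.bijective.comp h
    have h' : c ∘ azF A = azF B ∘ (TensorProduct.congr (isoEquiv e) (isoEquiv e)) :=
      congr(DFunLike.coe $(hF.symm))
    rwa [h'] at this
  exact (Function.Bijective.of_comp_iff _
    (TensorProduct.congr (isoEquiv e) (isoEquiv e)).bijective).1 h2

end YDMod

end DualAlgebras

end

noncomputable section

attribute [local instance] zeroHomClass_linearMap zeroHomClass_linearEquiv addHomClass_linearMap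
  addHomClass_linearEquiv

set_option linter.unusedSectionVars false

section BarAzumaya

variable {k : Type u} [CommRing k]

namespace FaithfullyProjective

lemma of_sum {M ι : Type*} [AddCommGroup M] [Module k M] [Module.Finite k M]
    [Module.Projective k M] [Fintype ι] (f : ι → Module.Dual k M) (m : ι → M)
    (h : ∑ j, f j (m j) = 1) : FaithfullyProjective k M where
  finite := inferInstance
  projective := inferInstance
  generator := by
    let e := Fintype.equivFin ι
    refine ⟨Fintype.card ι, f ∘ e.symm, m ∘ e.symm, ?_⟩
    rw [← h]
    exact e.symm.sum_comp fun j => f j (m j)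

lemma self : FaithfullyProjective k k :=
  of_sum (ι := Unit) (fun _ => LinearMap.id) (fun _ => 1) (by simp)

variable {M N : Type*} [AddCommGroup M] [Module k M] [AddCommGroup N] [Module k N]

lemma tensor [hM : FaithfullyProjective k M] [hN : FaithfullyProjective k N] :
    FaithfullyProjective k (M ⊗[k] N) := by
  obtain ⟨n, f, x, h⟩ := hM.generator
  obtain ⟨n', f', x', h'⟩ := hN.generator
  refine of_sum (ι := Fin n × Fin n')
    (fun p => LinearMap.mul' k k ∘ₗ TensorProduct.map (f p.1) (f' p.2))
    (fun p => x p.1 ⊗ₜ x' p.2) ?_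
  simp only [LinearMap.comp_apply, map_tmul, LinearMap.mul'_apply]
  rw [Fintype.sum_prod_type]
  dsimp only
  rw [← Finset.sum_mul_sum, h, h', one_mul]

lemma dual [hM : FaithfullyProjective k M] : FaithfullyProjective k (Module.Dual k M) := by
  obtain ⟨n, f, x, h⟩ := hM.generator
  exact of_sum (fun i => Module.Dual.eval k M (x i)) f h

lemma of_equiv [hM : FaithfullyProjective k M] (e : M ≃ₗ[k] N) : FaithfullyProjective k N := by
  obtain ⟨n, f, x, h⟩ := hM.generator
  have := Module.Finite.equiv e
  have := Module.Projective.of_equiv e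
  exact of_sum (fun i => f i ∘ₗ e.symm.toLinearMap) (fun i => e (x i)) (by simpa using h)

end FaithfullyProjective

variable {H : Type v} [Ring H] [HopfAlgebra k H] [BijectiveAntipode k H]
  [Module.Finite k H] [Module.Projective k H]

namespace YDStruct

variable {M P : Type*} [AddCommGroup M] [Module k M] [AddCommGroup P] [Module k P]
  [Module.Finite k M] [Module.Projective k M] {X : YDStruct k H M} {Z : YDStruct k H P}

/-- If a morphism `T : X ⊗ Z → X` identifies `Z` with `End(X)` then so does `T ∘ φ`. -/
lemma curry_comp_braid_bijective {T : M ⊗[k] P →ₗ[k] M} (hT : IsHom (X.tensor Z) X T)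
    (h : Function.Bijective (TensorProduct.curry T).flip) :
    Function.Bijective (TensorProduct.curry (T ∘ₗ braid Z X)) := by
  let t := LinearEquiv.ofBijective (TensorProduct.curry T).flip h
  have ht : ∀ z m, t z m = T (m ⊗ₜ z) := fun _ _ => rfl
  let κ := TensorProduct.curry (T ∘ₗ braid Z X)
  have hκ : IsHom Z X.endStr κ := (hT.comp (isHom_braid Z X)).curry
  let U : M ⊗[k] Module.End k M →ₗ[k] M :=
    endEval k M ∘ₗ (braidEquiv X.endStr X).symm.toLinearMap
  have hU : IsHom (X.tensor X.endStr) X U :=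
    (isHom_endEval X).comp (IsHom.symm (e := braidEquiv X.endStr X) (isHom_braid X.endStr X))
  have hUb : ∀ w, U (braid X.endStr X w) = endEval k M w := fun w =>
    congrArg (endEval k M) ((braidEquiv X.endStr X).symm_apply_apply w)
  let κ' : Module.End k M →ₗ[k] P := t.symm.toLinearMap ∘ₗ (TensorProduct.curry U).flip
  have hTκ' : ∀ (f : Module.End k M) m, T (m ⊗ₜ κ' f) = U (m ⊗ₜ f) := fun f m =>
    congr($(t.apply_symm_apply ((TensorProduct.curry U).flip f)) m)
  have hκ' : IsHom X.endStr Z κ' := .of_pairing_right hT hU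
    (fun w w' hw => t.injective (LinearMap.ext hw)) hTκ'
  have h₁ : ∀ f, κ (κ' f) = f := by
    intro f
    refine LinearMap.ext fun m => ?_
    change T (braid Z X (κ' f ⊗ₜ m)) = endEval k M (f ⊗ₜ m)
    rw [hκ'.braid_map_left, ← hUb]
    generalize braid X.endStr X (f ⊗ₜ m) = w
    induction w with
    | zero => simp
    | add x y hx hy => simp only [map_add, hx, hy]
    | tmul x y => exact hTκ' y x
  have h₂ : ∀ w : P ⊗[k] M, U (κ.lTensor M (braid Z X w)) = T (braid Z X w) := by
    intro w
    induction w with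
    | zero => simp
    | add x y hx hy => simp only [map_add, hx, hy]
    | tmul z m =>
      rw [← hκ.braid_map_left, hUb]
      rfl
  have h₃ : ∀ z, κ' (κ z) = z := by
    intro z
    apply t.injective
    refine LinearMap.ext fun m => ?_
    rw [ht, ht, hTκ']
    obtain ⟨w, hw⟩ := (braid_bijective (X := Z) (Y := X)).2 (m ⊗ₜ z)
    have := h₂ w
    rwa [hw, LinearMap.lTensor_tmul] at this
  exact Function.bijective_iff_has_inverse.2 ⟨κ', h₃, h₁⟩

end YDStruct

namespace YDMod

open YDStruct MonoidalCategory

variable (A B : Mon (YDMod k H))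

/-- The canonical map `G` as a map `A ⊗ (A ⊗ A) → A`. -/
def azGAct : A.X ⊗[k] (A.X ⊗[k] A.X) →ₗ[k] A.X :=
  mulLin A ∘ₗ (barMul A).rTensor A.X ∘ₗ (TensorProduct.assoc k A.X A.X A.X).symm.toLinearMap

lemma isHom_azGAct : IsHom (A.X.str.tensor (A.X.str.tensor A.X.str)) A.X.str (azGAct A) :=
  (isHom_mulLin A).comp (((isHom_barMul A).tensor (isHom_id _)).comp (isHom_assoc _ _ _).symm)

/-- The canonical map `F` of `Ā` as a map on `A ⊗ A`. -/
def barAzF : A.X ⊗[k] A.X →ₗ[k] Module.End k A.X := azF (barAlg A)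

lemma barAzF_tmul (a b c : A.X) : barAzF A (a ⊗ₜ b) c =
    barMul A (a ⊗ₜ barMul A (braid A.X.str A.X.str (b ⊗ₜ c))) := rfl

lemma barMul_tmul_mulLin (a : A.X) (w : A.X ⊗[k] A.X) :
    barMul A (a ⊗ₜ mulLin A w) = mulLin A ((mulLin A).rTensor A.X
      (braid A.X.str (A.X.str.tensor A.X.str) (a ⊗ₜ w))) := by
  rw [barMul_apply, (isHom_mulLin A).braid_map_right]

lemma barAzF_eq (w : A.X ⊗[k] A.X) (c : A.X) :
    barAzF A w c = azGAct A (braid (A.X.str.tensor A.X.str) A.X.str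
      (braid A.X.str A.X.str w ⊗ₜ c)) := by
  induction w with
  | zero => simp
  | add x y hx hy => simp only [add_tmul, map_add, LinearMap.add_apply, hx, hy]
  | tmul a b =>
    rw [barAzF_tmul, barMul_apply A (braid _ _ _), barMul_tmul_mulLin,
      (isHom_braid A.X.str A.X.str).braid_map_right, (isHom_braid A.X.str A.X.str).braid_map_right, braid_tensor_right]
    generalize braid A.X.str A.X.str (a ⊗ₜ b) = w
    induction w with
    | zero => simp
    | add x y hx hy => simp only [add_tmul, map_add, LinearMap.add_apply, hx, hy]
    | tmul x y =>
      rw [onR_tmul, braid_tensor_left]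
      generalize braid A.X.str A.X.str (y ⊗ₜ c) = w
      induction w with
      | zero => simp
      | add x y hx hy => simp only [tmul_add, map_add, hx, hy]
      | tmul x' y' =>
        rw [assoc_symm_tmul, LinearMap.rTensor_tmul, LinearMap.rTensor_tmul, LinearMap.rTensor_tmul,
          onL_tmul]
        generalize braid A.X.str A.X.str (x ⊗ₜ x') = w
        induction w with
        | zero => simp
        | add x y hx hy => simp only [add_tmul, map_add, hx, hy]
        | tmul u v => rfl

variable {A B}

lemma azF_barAlg_bijective [Module.Finite k A.X] [Module.Projective k A.X]
    (h : Function.Bijective (azG A)) : Function.Bijective (azF (barAlg A)) := by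
  have h₁ := curry_comp_braid_bijective (isHom_azGAct A) h
  have h₂ : barAzF A = TensorProduct.curry (azGAct A ∘ₗ
      braid (A.X.str.tensor A.X.str) A.X.str) ∘ₗ braid A.X.str A.X.str :=
    LinearMap.ext fun w => LinearMap.ext fun c => barAzF_eq A w c
  change Function.Bijective (barAzF A)
  rw [h₂]
  exact h₁.comp braid_bijective

variable (A) in
/-- `D(Ā)` is the opposite algebra of `D(A)`. -/
def dualAlgBarIso : barAlg (dualAlg A) ≅ dualAlg (barAlg A) :=
  monIso (A := barAlg (dualAlg A)) (B := dualAlg (barAlg A)) (LinearEquiv.refl k A.X)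
    (isHom_id A.X.str.dual) rfl (barMul_dualAlg A)

lemma isHAzumaya_barAlg (h : IsHAzumaya A) : IsHAzumaya (barAlg A) := by
  have _ := h.1
  have hD := (isHAzumaya_dualAlg_iff A).2 h
  have _ := hD.1
  exact ⟨h.1, azF_barAlg_bijective h.3, (azF_dualAlg_bijective _).1
    (azF_bijective_of_iso (dualAlgBarIso A) (azF_barAlg_bijective hD.3))⟩

lemma azF_tensor_bijective (hA : IsHAzumaya A) (hB : IsHAzumaya B) :
    Function.Bijective (azF (A ⊗ B)) :=
  have _ := hA.1
  have _ := hB.1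
  smashAzF_bijective A B hA.2 hB.2

set_option maxRecDepth 4000 in
lemma isHAzumaya_tensor (hA : IsHAzumaya A) (hB : IsHAzumaya B) : IsHAzumaya (A ⊗ B) := by
  have _ := hA.1
  have _ := hB.1
  have h := azF_tensor_bijective ((isHAzumaya_dualAlg_iff B).2 hB) ((isHAzumaya_dualAlg_iff A).2 hA)
  have h' := azF_bijective_of_iso (dualAlgTensorIso A B) h
  exact ⟨.tensor (M := A.X) (N := B.X), azF_tensor_bijective hA hB,
    (azF_dualAlg_bijective (A ⊗ B)).1 h'⟩

lemma isHAzumaya_of_iso (e : A ≅ B) (hA : IsHAzumaya A) : IsHAzumaya B :=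
  have _ := hA.1
  ⟨.of_equiv (isoEquiv e), azF_bijective_of_iso e hA.2, (azF_dualAlg_bijective _).1
    (azF_bijective_of_iso (dualAlgIso e) ((azF_dualAlg_bijective _).2 hA.3))⟩

end YDMod

end BarAzumaya

section UnitAzumaya

variable {k : Type u} [CommRing k] {H : Type v} [Ring H] [HopfAlgebra k H]

namespace YDMod

open YDStruct MonoidalCategory

lemma azG_one (A : Mon (YDMod k H)) : azG A (oneEl A ⊗ₜ oneEl A) = 1 := by
  ext1 c
  rw [azG_tmul, mulLin_oneEl, barMul_apply, braid_tmul_smul_one (isHom_oneEl A), oneEl_mulLin]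
  rfl

lemma bijective_of_apply_one {f : k ⊗[k] k →ₗ[k] Module.End k k} (hf : f (1 ⊗ₜ 1) = 1) :
    Function.Bijective f := by
  let e : k ⊗[k] k ≃ₗ[k] Module.End k k :=
    TensorProduct.lid k k ≪≫ₗ (LinearMap.ringLmapEquivSelf k k k).symm
  have h : f = e.toLinearMap := by
    ext
    simp [e, hf]
  rw [h]
  exact e.bijective

/-- The unit algebra is `H`-Azumaya. -/
lemma isHAzumaya_unit : IsHAzumaya (𝟙_ (Mon (YDMod k H))) where
  faithfullyProjective := .self
  bijective_F := bijective_of_apply_one (azF_one (𝟙_ (Mon (YDMod k H))))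
  bijective_G := bijective_of_apply_one (azG_one (𝟙_ (Mon (YDMod k H))))

end YDMod

end UnitAzumaya

end

noncomputable section

attribute [local instance] zeroHomClass_linearMap zeroHomClass_linearEquiv addHomClass_linearMap
  addHomClass_linearEquiv

set_option linter.unusedSectionVars false

section LeftDual

variable {k : Type u} [CommRing k] {H : Type v} [Ring H] [HopfAlgebra k H]

namespace YDStruct

variable {M N : Type*} [AddCommGroup M] [Module k M] [AddCommGroup N] [Module k N]

section Intertwine

variable {X : YDStruct k H M} {ρ : H →ₐ[k] Module.End k N} {χ : N →ₗ[k] N ⊗[k] H}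
  {f : N →ₗ[k] M}

lemma coassoc_of_intertwine (hχ : ∀ n, X.coact (f n) = f.rTensor H (χ n)) (n : N) :
    f.rTensor (H ⊗[k] H) (TensorProduct.assoc k N H H (χ.rTensor H (χ n))) =
      f.rTensor (H ⊗[k] H) ((comul (R := k) (A := H)).lTensor N (χ n)) := by
  have h₁ : ∀ z : N ⊗[k] H, f.rTensor (H ⊗[k] H) (TensorProduct.assoc k N H H (χ.rTensor H z)) =
      TensorProduct.assoc k M H H (X.coact.rTensor H (f.rTensor H z)) := by
    intro z
    induction z with
    | zero => simp
    | add x y hx hy => simp only [map_add, hx, hy]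
    | tmul x a =>
      simp only [LinearMap.rTensor_tmul, hχ]
      generalize χ x = w
      induction w with
      | zero => simp
      | add x y hx hy => simp only [add_tmul, map_add, hx, hy]
      | tmul x a => simp
  have h₂ : ∀ z : N ⊗[k] H, f.rTensor (H ⊗[k] H) ((comul (R := k) (A := H)).lTensor N z) =
      (comul (R := k) (A := H)).lTensor M (f.rTensor H z) := by
    intro z
    induction z with
    | zero => simp
    | add x y hx hy => simp only [map_add, hx, hy]
    | tmul x a => simp
  rw [h₁, h₂, ← hχ, X.coassoc]

lemma counit_coact_of_intertwine (hχ : ∀ n, X.coact (f n) = f.rTensor H (χ n)) (n : N) :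
    f (TensorProduct.rid k N ((counit (R := k) (A := H)).lTensor N (χ n))) = f n := by
  have h₁ : ∀ z : N ⊗[k] H, f (TensorProduct.rid k N ((counit (R := k) (A := H)).lTensor N z)) =
      TensorProduct.rid k M ((counit (R := k) (A := H)).lTensor M (f.rTensor H z)) := by
    intro z
    induction z with
    | zero => simp
    | add x y hx hy => simp only [map_add, hx, hy]
    | tmul x a => simp
  rw [h₁, ← hχ, X.counit_coact]

lemma compat_of_intertwine (hρ : ∀ h n, f (ρ h n) = X.act h (f n))
    (hχ : ∀ n, X.coact (f n) = f.rTensor H (χ n)) (h : H) (n : N) :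
    f.rTensor H (TensorProduct.map₂ ρ.toLinearMap (LinearMap.mul k H) (comul (R := k) h) (χ n)) =
      f.rTensor H (TensorProduct.lift ((LinearMap.lTensorHom N ∘ₗ
        (LinearMap.mul k H).flip).compl₂ (χ ∘ₗ ρ.toLinearMap.flip n)) (comul (R := k) h)) := by
  have h₁ : ∀ (x : H ⊗[k] H) (z : N ⊗[k] H), f.rTensor H
      (TensorProduct.map₂ ρ.toLinearMap (LinearMap.mul k H) x z) =
      TensorProduct.map₂ X.act.toLinearMap (LinearMap.mul k H) x (f.rTensor H z) := by
    intro x z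
    induction x with
    | zero => simp
    | add x y hx hy => simp only [map_add, LinearMap.add_apply, hx, hy]
    | tmul a b =>
      induction z with
      | zero => simp
      | add x y hx hy => simp only [map_add, hx, hy]
      | tmul n c => simp [hρ]
  have h₂ : ∀ x : H ⊗[k] H, f.rTensor H (TensorProduct.lift ((LinearMap.lTensorHom N ∘ₗ
      (LinearMap.mul k H).flip).compl₂ (χ ∘ₗ ρ.toLinearMap.flip n)) x) = X.cR (f n) x := by
    intro x
    induction x with
    | zero => simp
    | add x y hx hy => simp only [map_add, hx, hy]
    | tmul a b =>
      rw [cR_tmul, ← hρ, hχ]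
      change f.rTensor H ((LinearMap.mulRight k a).lTensor N (χ (ρ b n))) = _
      generalize χ (ρ b n) = w
      induction w with
      | zero => simp
      | add x y hx hy => simp only [map_add, hx, hy]
      | tmul x a => simp
  rw [h₁, h₂, ← hχ]
  exact X.compat h (f n)

end Intertwine

lemma rTensor_prod_ext {M M' Q : Type*} [AddCommGroup M] [Module k M] [AddCommGroup M']
    [Module k M'] [AddCommGroup Q] [Module k Q] {z w : (M × M') ⊗[k] Q}
    (h₁ : (LinearMap.fst k M M').rTensor Q z = (LinearMap.fst k M M').rTensor Q w)
    (h₂ : (LinearMap.snd k M M').rTensor Q z = (LinearMap.snd k M M').rTensor Q w) : z = w := by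
  have h : ∀ z : (M × M') ⊗[k] Q, z =
      (LinearMap.inl k M M').rTensor Q ((LinearMap.fst k M M').rTensor Q z) +
        (LinearMap.inr k M M').rTensor Q ((LinearMap.snd k M M').rTensor Q z) := by
    intro z
    induction z with
    | zero => simp
    | add x y hx hy =>
      simp only [map_add]
      nth_rw 1 [hx, hy]
      abel
    | tmul x y => simp [← add_tmul]
  rw [h z, h w, h₁, h₂]

/-- The direct sum of two Yetter-Drinfel'd modules. -/
def prod (X : YDStruct k H M) (Y : YDStruct k H N) : YDStruct k H (M × N) :=
  let ρ : H →ₐ[k] Module.End k (M × N) := (LinearMap.prodMapAlgHom k M N).comp (X.act.prod Y.act)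
  let χ : M × N →ₗ[k] (M × N) ⊗[k] H :=
    ((LinearMap.inl k M N).rTensor H ∘ₗ X.coact).coprod ((LinearMap.inr k M N).rTensor H ∘ₗ Y.coact)
  have h₁ : ∀ n, X.coact (LinearMap.fst k M N n) = (LinearMap.fst k M N).rTensor H (χ n) := by
    intro n
    simp [χ, ← LinearMap.rTensor_comp_apply]
  have h₂ : ∀ n, Y.coact (LinearMap.snd k M N n) = (LinearMap.snd k M N).rTensor H (χ n) := by
    intro n
    simp [χ, ← LinearMap.rTensor_comp_apply]
  have h₃ : ∀ h n, LinearMap.fst k M N (ρ h n) = X.act h (LinearMap.fst k M N n) :=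
    fun _ _ => rfl
  have h₄ : ∀ h n, LinearMap.snd k M N (ρ h n) = Y.act h (LinearMap.snd k M N n) :=
    fun _ _ => rfl
  { act := ρ
    coact := χ
    coassoc m := rTensor_prod_ext (coassoc_of_intertwine h₁ m) (coassoc_of_intertwine h₂ m)
    counit_coact m := Prod.ext (counit_coact_of_intertwine h₁ m) (counit_coact_of_intertwine h₂ m)
    compat h m := rTensor_prod_ext (compat_of_intertwine h₃ h₁ h m)
      (compat_of_intertwine h₄ h₂ h m) }

lemma isHom_inl (X : YDStruct k H M) (Y : YDStruct k H N) :
    IsHom X (X.prod Y) (LinearMap.inl k M N) where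
  act_comm h m := by simp [prod]
  coact_comm m := by simp [prod]

lemma isHom_inr (X : YDStruct k H M) (Y : YDStruct k H N) :
    IsHom Y (X.prod Y) (LinearMap.inr k M N) where
  act_comm h m := by simp [prod]
  coact_comm m := by simp [prod]

lemma isHom_fst (X : YDStruct k H M) (Y : YDStruct k H N) :
    IsHom (X.prod Y) X (LinearMap.fst k M N) where
  act_comm h m := rfl
  coact_comm m := by simp [prod, ← LinearMap.rTensor_comp_apply]

lemma isHom_snd (X : YDStruct k H M) (Y : YDStruct k H N) :
    IsHom (X.prod Y) Y (LinearMap.snd k M N) where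
  act_comm h m := rfl
  coact_comm m := by simp [prod, ← LinearMap.rTensor_comp_apply]

section Retract

variable (X : YDStruct k H M) (ι : N →ₗ[k] M) (π : M →ₗ[k] N) (hπ : π ∘ₗ ι = LinearMap.id)
  (hι : IsHom X X (ι ∘ₗ π))

lemma rTensor_injective_of_retract (Q : Type*) [AddCommGroup Q] [Module k Q] {ι : N →ₗ[k] M}
    {π : M →ₗ[k] N} (hπ : π ∘ₗ ι = LinearMap.id) : Function.Injective (ι.rTensor Q) := by
  apply Function.LeftInverse.injective (g := π.rTensor Q)
  intro z
  rw [← LinearMap.rTensor_comp_apply, hπ, LinearMap.rTensor_id, LinearMap.id_apply]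

/-- The image of an idempotent endomorphism of a Yetter-Drinfel'd module. -/
def retract : YDStruct k H N :=
  have hπι : ∀ n, π (ι n) = n := fun n => congr($hπ n)
  let σ : H →ₗ[k] N →ₗ[k] N := LinearMap.llcomp k N M N π ∘ₗ
    (LinearMap.llcomp k N M M).flip ι ∘ₗ X.act.toLinearMap
  have hσ : ∀ h n, ι (σ h n) = X.act h (ι n) := by
    intro h n
    have := hι.act_comm h (ι n)
    simpa [hπι, σ] using this
  let ρ : H →ₐ[k] Module.End k N := AlgHom.ofLinearMap σ
    (by
      ext n
      simp [σ, hπι])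
    (by
      intro a b
      ext n
      apply Function.LeftInverse.injective hπι
      rw [hσ, Module.End.mul_apply, hσ, hσ, map_mul, Module.End.mul_apply])
  have h₁ : ∀ n, X.coact (ι n) = ι.rTensor H ((π.rTensor H ∘ₗ X.coact ∘ₗ ι) n) := by
    intro n
    have := hι.coact_comm (ι n)
    simpa [hπι, LinearMap.rTensor_comp] using this
  { act := ρ
    coact := π.rTensor H ∘ₗ X.coact ∘ₗ ι
    coassoc m := rTensor_injective_of_retract _ hπ (coassoc_of_intertwine h₁ m)
    counit_coact m := Function.LeftInverse.injective hπι (counit_coact_of_intertwine h₁ m)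
    compat h m := rTensor_injective_of_retract _ hπ (compat_of_intertwine (ρ := ρ) hσ h₁ h m) }

lemma isHom_retract : IsHom (retract X ι π hπ hι) X ι where
  act_comm h n := by
    have hπι : ∀ n, π (ι n) = n := fun n => congr($hπ n)
    have := hι.act_comm h (ι n)
    simpa [hπι, retract] using this
  coact_comm n := by
    have hπι : ∀ n, π (ι n) = n := fun n => congr($hπ n)
    have := hι.coact_comm (ι n)
    simpa [hπι, retract, LinearMap.rTensor_comp] using this

end Retract

variable [Module.Finite k M] [Module.Projective k M] [BijectiveAntipode k H]
  [Module.Finite k H] [Module.Projective k H]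

variable (k M) in
/-- The embedding of `M^*` into `End(M × k)`. -/
def dualIncl : Module.Dual k M →ₗ[k] Module.End k (M × k) :=
  LinearMap.llcomp k (M × k) k (M × k) (LinearMap.inr k M k) ∘ₗ
    (LinearMap.llcomp k (M × k) M k).flip (LinearMap.fst k M k)

variable (k M) in
/-- The projection of `End(M × k)` onto `M^*`. -/
def dualProj : Module.End k (M × k) →ₗ[k] Module.Dual k M :=
  LinearMap.llcomp k M (M × k) k (LinearMap.snd k M k) ∘ₗ
    (LinearMap.llcomp k M (M × k) (M × k)).flip (LinearMap.inl k M k)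

lemma dualProj_comp_dualIncl : dualProj k M ∘ₗ dualIncl k M = LinearMap.id := rfl

lemma isHom_dualIncl_comp_dualProj (X : YDStruct k H M) :
    IsHom (X.prod (unit k H)).endStr (X.prod (unit k H)).endStr (dualIncl k M ∘ₗ dualProj k M) := by
  let X' := X.prod (unit k H)
  have hp : IsHom X' X' (LinearMap.inl k M k ∘ₗ LinearMap.fst k M k) :=
    (isHom_inl _ _).comp (isHom_fst _ _)
  have hq : IsHom X' X' (LinearMap.inr k M k ∘ₗ LinearMap.snd k M k) :=
    (isHom_inr _ _).comp (isHom_snd _ _)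
  exact .of_pairing_left (isHom_endEval X')
    (hq.comp ((isHom_endEval X').comp ((isHom_id X'.endStr).tensor hp)))
    (fun _ _ h => LinearMap.ext h) (fun _ _ => rfl)

/-- The left dual `M^*` of a Yetter-Drinfel'd module `M`. -/
def leftDual (X : YDStruct k H M) : YDStruct k H (Module.Dual k M) :=
  retract (X.prod (unit k H)).endStr (dualIncl k M) (dualProj k M) dualProj_comp_dualIncl
    (isHom_dualIncl_comp_dualProj X)

lemma isHom_contractLeft (X : YDStruct k H M) :
    IsHom (X.leftDual.tensor X) (unit k H) (contractLeft k M) := by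
  have h := (isHom_snd X (unit k H)).comp ((isHom_endEval (X.prod (unit k H))).comp
    ((isHom_retract _ _ _ dualProj_comp_dualIncl (isHom_dualIncl_comp_dualProj X)).tensor
      (isHom_inl X (unit k H))))
  have e : contractLeft k M = LinearMap.snd k M k ∘ₗ endEval k (M × k) ∘ₗ
      TensorProduct.map (dualIncl k M) (LinearMap.inl k M k) :=
    TensorProduct.ext' fun _ _ => rfl
  rw [e]
  exact h

end YDStruct

end LeftDual

end

noncomputable section

attribute [local instance] zeroHomClass_linearMap zeroHomClass_linearEquiv addHomClass_linearMap
  addHomClass_linearEquiv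

set_option linter.unusedSectionVars false

section DualEnd

variable {k : Type u} [CommRing k] {H : Type v} [Ring H] [HopfAlgebra k H]

lemma transpose_bijective {P : Type*} [AddCommGroup P] [Module k P] [Module.Finite k P]
    [Module.Projective k P] : Function.Bijective (Module.Dual.transpose (R := k) (M := P) (M' := P)) := by
  refine ⟨fun f g h => ?_, fun g => ?_⟩
  · refine LinearMap.ext fun p => (Module.evalEquiv k P).injective (LinearMap.ext fun ξ => ?_)
    exact congr($h ξ p)
  · refine ⟨(Module.evalEquiv k P).symm.toLinearMap ∘ₗ g.dualMap ∘ₗ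
      (Module.evalEquiv k P).toLinearMap, ?_⟩
    refine LinearMap.ext fun ξ => LinearMap.ext fun p => ?_
    change ξ ((Module.evalEquiv k P).symm (g.dualMap (Module.evalEquiv k P p))) = _
    rw [Module.apply_evalEquiv_symm_apply]
    rfl

namespace YDMod

open YDStruct MonoidalCategory

variable [BijectiveAntipode k H] [Module.Finite k H] [Module.Projective k H]
  (P : YDMod k H) (N : YDMod k (HopfDual k H)) [Module.Finite k P] [Module.Projective k P]
  [Module.Finite k N] [Module.Projective k N] (c : N ≃ₗ[k] Module.Dual k P)

variable {P N} in
/-- The transpose of endomorphisms of `P` with respect to a perfect pairing `P ⊗ N → k`. -/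
def transposeAct : Module.End k P ⊗[k] N →ₗ[k] N :=
  c.symm.toLinearMap ∘ₗ TensorProduct.lift (Module.Dual.transpose (R := k) (M := P) (M' := P)) ∘ₗ
    c.toLinearMap.lTensor _

lemma transposeAct_tmul (f : Module.End k P) (n : N) (p : P) :
    c (transposeAct c (f ⊗ₜ n)) p = c n (f p) := by
  change c (c.symm _) p = _
  rw [LinearEquiv.apply_symm_apply]
  rfl

lemma isHom_transposeAct (hc : IsHom (P.str.dual.tensor N.str) (YDStruct.unit k (HopfDual k H))
    (TensorProduct.lift c.toLinearMap.flip)) :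
    IsHom (P.str.endStr.dual.tensor N.str) N.str (transposeAct c) := by
  refine .of_pairing_right hc (hc.comp (((isHom_endEval P.str).dual_flip.tensor
    (isHom_id N.str)).comp (isHom_assoc _ _ _).symm)) (fun w w' h => ?_) fun z p => ?_
  · exact c.injective (LinearMap.ext h)
  · induction z with
    | zero => simp
    | add x y hx hy => simp only [tmul_add, map_add, hx, hy]
    | tmul f n => exact transposeAct_tmul P N c f n p

lemma curry_transposeAct_bijective : Function.Bijective (TensorProduct.curry (transposeAct c)) := by
  have h : TensorProduct.curry (transposeAct c) = (LinearEquiv.conj c.symm).toLinearMap ∘ₗ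
      Module.Dual.transpose (R := k) (M := P) (M' := P) := rfl
  rw [h]
  exact (LinearEquiv.conj c.symm).bijective.comp transpose_bijective

lemma curry_transposeAct_mul (f g : Module.End k P) : TensorProduct.curry (transposeAct c) (g * f) =
    TensorProduct.curry (transposeAct c) f * TensorProduct.curry (transposeAct c) g := by
  refine LinearMap.ext fun n => c.injective (LinearMap.ext fun p => ?_)
  change c (transposeAct c ((g * f) ⊗ₜ n)) p =
    c (transposeAct c (f ⊗ₜ transposeAct c (g ⊗ₜ n))) p
  simp only [transposeAct_tmul, Module.End.mul_apply]

lemma curry_transposeAct_one : TensorProduct.curry (transposeAct c) 1 = 1 := by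
  refine LinearMap.ext fun n => c.injective (LinearMap.ext fun p => ?_)
  change c (transposeAct c (1 ⊗ₜ n)) p = c n p
  rw [transposeAct_tmul, Module.End.one_apply]

/-- `D(End(P)) ≃ End(N)` for a perfect pairing `D(P) ⊗ N → k` of Yetter-Drinfel'd modules. -/
def dualAlgEndIso (hc : IsHom (P.str.dual.tensor N.str) (YDStruct.unit k (HopfDual k H))
    (TensorProduct.lift c.toLinearMap.flip)) : dualAlg P.endAlg ≅ N.endAlg :=
  monIso (A := dualAlg P.endAlg) (B := N.endAlg)
    (LinearEquiv.ofBijective (TensorProduct.curry (transposeAct c))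
      (curry_transposeAct_bijective P N c))
    (isHom_transposeAct P N c hc).curry
    (by
      rw [oneEl_endAlg]
      refine Eq.trans ?_ (curry_transposeAct_one P N c)
      exact congrArg (TensorProduct.curry (transposeAct c)) (oneEl_endAlg P))
    (curry_transposeAct_mul P N c)

/-- `D(P^*)` -/
def dualLeftDual : YDMod k (HopfDual k H) := ⟨Module.Dual k P, P.str.leftDual.dual⟩

instance : Module.Finite k (dualLeftDual P) := inferInstanceAs (Module.Finite k (Module.Dual k P))

instance : Module.Projective k (dualLeftDual P) :=
  inferInstanceAs (Module.Projective k (Module.Dual k P))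

/-- `D(End(P)) ≃ End(D(P^*))` -/
def dualAlgEndAlg : dualAlg P.endAlg ≅ (dualLeftDual P).endAlg :=
  dualAlgEndIso P (dualLeftDual P) (LinearEquiv.refl k (Module.Dual k P)) (by
    have h := (isHom_dualUnit (k := k) (H := H)).symm.comp (isHom_contractLeft P.str).dual_flip
    have e : TensorProduct.lift (LinearEquiv.refl k (Module.Dual k P)).toLinearMap.flip =
        (LinearEquiv.refl k k).symm.toLinearMap ∘ₗ contractLeft k P ∘ₗ
          (TensorProduct.comm k P (Module.Dual k P)).toLinearMap :=
      TensorProduct.ext' fun _ _ => rfl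
    exact e ▸ h)

/-- The Yetter-Drinfel'd `H`-module `P` with `D(P) = N^*`. -/
def undualLeftDual : YDMod k H := ⟨Module.Dual k N, N.str.leftDual.undual⟩

instance : Module.Finite k (undualLeftDual N) := inferInstanceAs (Module.Finite k (Module.Dual k N))

instance : Module.Projective k (undualLeftDual N) :=
  inferInstanceAs (Module.Projective k (Module.Dual k N))

/-- Every algebra `End(N)` over `H^*` is of the form `D(End(P))`. -/
def dualAlgEndUndual : dualAlg (undualLeftDual N).endAlg ≅ N.endAlg :=
  dualAlgEndIso (undualLeftDual N) N (Module.evalEquiv k N) (by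
    change IsHom (N.str.leftDual.undual.dual.tensor N.str) _ _
    rw [dual_undual]
    have e : TensorProduct.lift (Module.evalEquiv k N).toLinearMap.flip = contractLeft k N :=
      TensorProduct.ext' fun _ _ => rfl
    exact e ▸ isHom_contractLeft N.str)


end YDMod

end DualEnd

end

noncomputable section

attribute [local instance] zeroHomClass_linearMap zeroHomClass_linearEquiv addHomClass_linearMap
  addHomClass_linearEquiv

set_option linter.unusedSectionVars false

section BrauerGroup

open YDStruct YDMod MonoidalCategory

variable {k : Type u} [CommRing k] {H : Type v} [Ring H] [HopfAlgebra k H]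
  [BijectiveAntipode k H] [Module.Finite k H] [Module.Projective k H]

namespace BrauerEquiv

variable {A B C A' B' : Mon (YDMod k H)}

lemma of_end_iso (M N : YDMod k H) [FaithfullyProjective k M] [FaithfullyProjective k N]
    (e : A ⊗ M.endAlg ≅ B ⊗ N.endAlg) : BrauerEquiv A B :=
  ⟨M, N, inferInstance, inferInstance, ⟨e⟩⟩

lemma of_iso (e : A ≅ B) : BrauerEquiv A B := by
  have : FaithfullyProjective k (unitObj k H) := .self
  exact of_end_iso (unitObj k H) (unitObj k H) (whiskerRightIso e _)

lemma symm (h : BrauerEquiv A B) : BrauerEquiv B A := by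
  obtain ⟨M, N, _, _, ⟨e⟩⟩ := h
  exact of_end_iso N M e.symm

instance (M N : YDMod k H) [FaithfullyProjective k M] [FaithfullyProjective k N] :
    FaithfullyProjective k (YDMod.tensorObj M N) := .tensor (M := M) (N := N)

lemma trans (h : BrauerEquiv A B) (h' : BrauerEquiv B C) : BrauerEquiv A C := by
  obtain ⟨M, N, _, _, ⟨e⟩⟩ := h
  obtain ⟨P, Q, _, _, ⟨e'⟩⟩ := h'
  exact of_end_iso (YDMod.tensorObj M P) (YDMod.tensorObj Q N)
    (whiskerLeftIso A (endTensorIso M P).symm ≪≫ (α_ A M.endAlg P.endAlg).symm ≪≫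
      whiskerRightIso e P.endAlg ≪≫ α_ B N.endAlg P.endAlg ≪≫
      whiskerLeftIso B (endCommIso N.endAlg P) ≪≫ (α_ B P.endAlg N.endAlg).symm ≪≫
      whiskerRightIso e' N.endAlg ≪≫ α_ C Q.endAlg N.endAlg ≪≫
      whiskerLeftIso C (endTensorIso Q N))

lemma equivalence : Equivalence (BrauerEquiv (k := k) (H := H)) :=
  ⟨fun A => of_iso (Iso.refl A), symm, trans⟩

/-- `(A # End(M)) # (B # End(N)) ≃ (A # B) # End(M ⊗ N)` -/
def tensorEndIso (A B : Mon (YDMod k H)) (M N : YDMod k H) [FaithfullyProjective k M]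
    [FaithfullyProjective k N] :
    (A ⊗ M.endAlg) ⊗ (B ⊗ N.endAlg) ≅ (A ⊗ B) ⊗ (YDMod.tensorObj M N).endAlg :=
  α_ A M.endAlg (B ⊗ N.endAlg) ≪≫ whiskerLeftIso A ((α_ M.endAlg B N.endAlg).symm ≪≫
    whiskerRightIso (endCommIso B M).symm N.endAlg ≪≫ α_ B M.endAlg N.endAlg ≪≫
    whiskerLeftIso B (endTensorIso M N)) ≪≫ (α_ A B (YDMod.tensorObj M N).endAlg).symm

lemma tensor (h : BrauerEquiv A A') (h' : BrauerEquiv B B') : BrauerEquiv (A ⊗ B) (A' ⊗ B') := by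
  obtain ⟨M, N, _, _, ⟨e⟩⟩ := h
  obtain ⟨P, Q, _, _, ⟨e'⟩⟩ := h'
  exact of_end_iso (YDMod.tensorObj M P) (YDMod.tensorObj N Q)
    ((tensorEndIso A B M P).symm ≪≫ tensorIso e e' ≪≫ tensorEndIso A' B' N Q)

lemma endAlg_unit (M : YDMod k H) [FaithfullyProjective k M] :
    BrauerEquiv M.endAlg (𝟙_ (Mon (YDMod k H))) := by
  have : FaithfullyProjective k (unitObj k H) := .self
  exact of_end_iso (unitObj k H) (YDMod.tensorObj M (unitObj k H))
    (endTensorIso M (unitObj k H) ≪≫ (λ_ _).symm)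

lemma tensor_barAlg (hA : IsHAzumaya A) : BrauerEquiv (A ⊗ barAlg A) (𝟙_ (Mon (YDMod k H))) := by
  have := hA.1
  exact (of_iso (azFIso A hA.2)).trans (endAlg_unit A.X)

set_option maxRecDepth 4000 in
lemma dualAlg (h : BrauerEquiv A B) : BrauerEquiv (YDMod.dualAlg A) (YDMod.dualAlg B) := by
  obtain ⟨M, N, _, _, ⟨e⟩⟩ := h
  have : FaithfullyProjective k (dualLeftDual M) := .dual (M := M)
  have : FaithfullyProjective k (dualLeftDual N) := .dual (M := N)
  have i : ∀ (A : Mon (YDMod k H)) (M : YDMod k H) [FaithfullyProjective k M],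
      Nonempty (YDMod.dualAlg A ⊗ (dualLeftDual M).endAlg ≅ YDMod.dualAlg (A ⊗ M.endAlg)) :=
    fun A M _ => ⟨endCommIso (YDMod.dualAlg A) (dualLeftDual M) ≪≫
      whiskerRightIso (dualAlgEndAlg M).symm (YDMod.dualAlg A) ≪≫ dualAlgTensorIso A M.endAlg⟩
  obtain ⟨i₁⟩ := i A M
  obtain ⟨i₂⟩ := i B N
  exact of_end_iso (dualLeftDual M) (dualLeftDual N) (i₁ ≪≫ dualAlgIso e ≪≫ i₂.symm)

set_option maxRecDepth 4000 in
lemma of_dualAlg (h : BrauerEquiv (YDMod.dualAlg A) (YDMod.dualAlg B)) : BrauerEquiv A B := by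
  obtain ⟨M, N, _, _, ⟨e⟩⟩ := h
  have : FaithfullyProjective k (undualLeftDual M) := .dual (M := M)
  have : FaithfullyProjective k (undualLeftDual N) := .dual (M := N)
  have i : ∀ (A : Mon (YDMod k H)) (M : YDMod k (HopfDual k H)) [FaithfullyProjective k M],
      Nonempty (YDMod.dualAlg A ⊗ M.endAlg ≅ YDMod.dualAlg ((undualLeftDual M).endAlg ⊗ A)) :=
    fun A M _ => ⟨whiskerLeftIso (YDMod.dualAlg A) (dualAlgEndUndual M).symm ≪≫
      dualAlgTensorIso (undualLeftDual M).endAlg A⟩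
  obtain ⟨i₁⟩ := i A M
  obtain ⟨i₂⟩ := i B N
  exact of_end_iso (undualLeftDual M) (undualLeftDual N) (endCommIso A (undualLeftDual M) ≪≫
    ofDualAlgIso (i₁.symm ≪≫ e ≪≫ i₂) ≪≫ (endCommIso B (undualLeftDual N)).symm)

end BrauerEquiv

namespace BQ

lemma mk_eq {A B : Mon (YDMod k H)} {hA : IsHAzumaya A} {hB : IsHAzumaya B}
    (h : BrauerEquiv A B) : mk A hA = mk B hB := Quot.sound h

lemma mk_eq_iff {A B : Mon (YDMod k H)} {hA : IsHAzumaya A} {hB : IsHAzumaya B} :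
    mk A hA = mk B hB ↔ BrauerEquiv A B :=
  (BrauerEquiv.equivalence.comap fun A : AzumayaAlg k H => A.1).quot_mk_eq_iff _ _

/-- The product `[A][B] = [A # B]`. -/
def mul : BQ k H → BQ k H → BQ k H :=
  Quot.map₂ (fun A B => ⟨A.1 ⊗ B.1, isHAzumaya_tensor A.2 B.2⟩)
    (fun _ _ _ h => (BrauerEquiv.of_iso (Iso.refl _)).tensor h)
    (fun _ _ _ h => h.tensor (.of_iso (Iso.refl _)))

lemma mul_assoc (a b c : BQ k H) : mul (mul a b) c = mul a (mul b c) := by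
  obtain ⟨A⟩ := a
  obtain ⟨B⟩ := b
  obtain ⟨C⟩ := c
  exact Quot.sound (.of_iso (α_ A.1 B.1 C.1))

variable (k H) in
/-- The class of the unit algebra. -/
def one : BQ k H := mk (𝟙_ (Mon (YDMod k H))) isHAzumaya_unit

lemma mul_one (a : BQ k H) : mul a (one k H) = a := by
  obtain ⟨A⟩ := a
  exact Quot.sound (.of_iso (ρ_ A.1))

lemma exists_mul_eq_one (a : BQ k H) : ∃ b, mul a b = one k H := by
  obtain ⟨A⟩ := a
  exact ⟨mk (barAlg A.1) (isHAzumaya_barAlg A.2), Quot.sound (.tensor_barAlg A.2)⟩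

variable (k H) in
/-- The group structure on `BQ(k, H)`. -/
@[reducible]
def group : Group (BQ k H) :=
  letI : Mul (BQ k H) := ⟨mul⟩
  letI : One (BQ k H) := ⟨one k H⟩
  letI : Inv (BQ k H) := ⟨fun a => (exists_mul_eq_one a).choose⟩
  Group.ofRightAxioms mul_assoc mul_one fun a => (exists_mul_eq_one a).choose_spec

lemma isBrauerGroup : IsBrauerGroup (group k H) where
  equivalence := BrauerEquiv.equivalence.comap fun A : AzumayaAlg k H => A.1
  mul_mk _ _ hA hB := ⟨isHAzumaya_tensor hA hB, rfl⟩

/-- The map `[A] ↦ [D(A)]`. -/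
def dual : BQ k H → BQ k (HopfDual k H) :=
  Quot.map (fun A => ⟨YDMod.dualAlg A.1, (isHAzumaya_dualAlg_iff A.1).2 A.2⟩)
    fun _ _ h => h.dualAlg

lemma dual_bijective : Function.Bijective (dual (k := k) (H := H)) := by
  constructor
  · rintro ⟨A⟩ ⟨B⟩ h
    exact mk_eq (mk_eq_iff.1 h).of_dualAlg
  · rintro ⟨B⟩
    have h : IsHAzumaya (undualAlg B.1) := (isHAzumaya_dualAlg_iff _).1
      (isHAzumaya_of_iso (dualAlgUndualAlg B.1).symm B.2)
    exact ⟨mk _ h, Quot.sound (.of_iso (dualAlgUndualAlg B.1))⟩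

lemma dual_mul (a b : BQ k H) : dual (mul a b) = mul (dual b) (dual a) := by
  obtain ⟨A⟩ := a
  obtain ⟨B⟩ := b
  exact Quot.sound (.of_iso (dualAlgTensorIso A.1 B.1).symm)

/-- The anti-isomorphism `[A] ↦ [D(A)]`. -/
def dualEquiv : letI := group k H; letI := group k (HopfDual k H);
    BQ k H ≃* (BQ k (HopfDual k H))ᵐᵒᵖ :=
  letI := group k H
  letI := group k (HopfDual k H)
  { Equiv.ofBijective dual dual_bijective |>.trans MulOpposite.opEquiv with
    map_mul' a b := congrArg MulOpposite.op (dual_mul a b) }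

end BQ

end BrauerGroup

end

theorem proposition5p2 {k : Type u} [CommRing k] {H : Type v} [Ring H] [HopfAlgebra k H]
    [Module.Finite k H] [Module.Projective k H] [BijectiveAntipode k H] :
    ((YDMod.dualFunctor k H).IsEquivalence ∧
      ∀ M N : YDMod k H,
        Functor.LaxMonoidal.μ (YDMod.dualFunctor k H) M N ≫
            (YDMod.dualFunctor k H).map (β_ M N).hom =
          (β_ ((YDMod.dualFunctor k H).obj M) ((YDMod.dualFunctor k H).obj N)).hom ≫
            Functor.LaxMonoidal.μ (YDMod.dualFunctor k H) N M) ∧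
    ∃ (G : Group (BQ k H)) (G' : Group (BQ k (HopfDual k H))),
      IsBrauerGroup G ∧ IsBrauerGroup G' ∧
      (∃ e : BQ k H ≃* (BQ k (HopfDual k H))ᵐᵒᵖ,
        ∀ (A : Mon (YDMod k H)) (hA : IsHAzumaya A), ∃ hDA : IsHAzumaya (YDMod.dualAlg A),
          e (BQ.mk A hA) = MulOpposite.op (BQ.mk (YDMod.dualAlg A) hDA)) ∧
      (∃ e : BQ k H ≃* BQ k (HopfDual k H),
        ∀ (A : Mon (YDMod k H)) (hA : IsHAzumaya A), ∃ hDA : IsHAzumaya (YDMod.dualAlg A),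
          e (BQ.mk A hA) = (BQ.mk (YDMod.dualAlg A) hDA)⁻¹) := by
  refine ⟨⟨YDMod.dualFunctor_isEquivalence, YDMod.dualFunctor_braided⟩,
    BQ.group k H, BQ.group k (HopfDual k H), BQ.isBrauerGroup, BQ.isBrauerGroup,
    ⟨BQ.dualEquiv, fun A hA => ⟨(YDMod.isHAzumaya_dualAlg_iff A).2 hA, rfl⟩⟩, ?_⟩
  let _ := BQ.group k H
  let _ := BQ.group k (HopfDual k H)
  exact ⟨BQ.dualEquiv.trans (MulEquiv.inv' (BQ k (HopfDual k H))).symm,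
    fun A hA => ⟨(YDMod.isHAzumaya_dualAlg_iff A).2 hA, rfl⟩⟩
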